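/- **Conventions.** Let $s=\mathbb R^{\infty}$ (countable product topology), $\Sigma=\{x\in s:\sup_i|x_i|<\infty\}$, $\sigma=\{x\in s: x_i=0\text{ for all but finitely many } i\}$. Let $s^\infty,\Sigma^\infty,\sigma^\infty$ be the countable powers, $s^\infty$ with the product topology, and put $\Sigma^\infty_f=\{(x_k)\in\Sigma^\infty: x_k=0\text{ for all but finitely many }k\}$, $\sigma^\infty_f=\{(x_k)\in\sigma^\infty: x_k=0\text{ for all but finitely many }k\}$, $s^\infty_b=\{(x_k)\in s^\infty:\sup_{k,i}|(x_k)_i|<\infty\}$. For a space $Y$ with subsets $Y_1,\dots,Y_l$ and a space $E$ with subsets $E_1,\dots,E_l$ (no inclusions among the $Y_j$ or among the $E_j$ are required), $(Y,Y_1,\dots,Y_l)$ is called $(E,E_1,\dots,E_l)$-*stable* if there is a homeomorphism $\Phi:Y\times E\to Y$ with $\Phi(Y_j\times E_j)=Y_j$ for all $j$. A $C^1$-triangulation of a smooth manifold $M$ is a locally finite simplicial complex $K$ in some $\mathbb R^N$ with a homeomorphism $|K|\to M$ that is $C^1$ with injective differential on each closed simplex; PL maps and compact subpolyhedra of $M$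 are understood through it. For $X\subset M$, $\mathcal H_X(M)$ is the group of homeomorphisms of $M$ onto itself fixing $X$ pointwise, with the compact-open topology. A Riemannian manifold carries its path metric $d_M$; $\mathcal H^{\rm loc\,LIP}_X(M)$, $\mathcal H^{\rm LIP}_X(M)$, $\mathcal H^{\rm PL}_X(M)$ are the subgroups of those $h$ such that $h,h^{-1}$ are locally Lipschitz, such that $h,h^{-1}$ are Lipschitz, and of PL-homeomorphisms; $\mathcal H^{\rm LIP,c}_X(M)$, $\mathcal H^{\rm PL,c}_X(M)$ consist of the elements with compact support. **Proposition 4.2.** Let $n\ge 1$, let $M$ be a connected (smooth) Riemannian $n$-manifold, possibly with boundary, with a $C^1$-triangulation, and let $X\ne M$ be a compact subpolyhedron of $M$ (possibly empty). (i) $(\mathcal H_X(M),\mathcal H^{\rm loc\,LIP}_X(M),\mathcal H^{\rm LIP}_X(M),\mathcal H^{\rm LIP,c}_X(M),\mathcal H^{\rm PL}_X(M),\mathcal H^{\rm PL,c}_X(M))$ is $(s,\Sigma,\Sigma,\Sigma,\sigma,\sigma)$-stable. (ii) If $M$ is noncompact, then $(\mathcal H_X(M),\mathcal H^{\rm loc\,LIP}_X(M),\mathcal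 H^{\rm LIP,c}_X(M),\mathcal H^{\rm PL}_X(M),\mathcal H^{\rm PL,c}_X(M))$ is $(s^\infty,\Sigma^\infty,\Sigma^\infty_f,\sigma^\infty,\sigma^\infty_f)$-stable. (iii) If $M$ is noncompact and contains a sequence of points $p_k$ $(k=1,2,\dots)$ such that, for some constant $\varepsilon>0$, $d_M(p_k,p_\ell)\ge\varepsilon$ whenever $k\ne\ell$, then $(\mathcal H_X(M),\mathcal H^{\rm loc\,LIP}_X(M),\mathcal H^{\rm LIP}_X(M),\mathcal H^{\rm LIP,c}_X(M))$ is $(s^\infty,\Sigma^\infty,s^\infty_b,\Sigma^\infty_f)$-stable. -/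

import Mathlib

open scoped Manifold ContDiff Topology Bundle

noncomputable section

/-! ### The model spaces -/

/-- `s = ℝ^∞`, the countable product of lines, with the product topology. -/
abbrev SeqS : Type := ℕ → ℝ

/-- `s^∞`, the countable product of copies of `s`, with the product topology. -/
abbrev SeqSInf : Type := ℕ → SeqS

/-- `Σ`: the bounded sequences. -/
def bigSigma : Set SeqS := {x | ∃ C : ℝ, ∀ i, |x i| ≤ C}

/-- `σ`: the sequences with only finitely many nonzero terms. -/
def smallSigma : Set SeqS := {x | {i | x i ≠ 0}.Finite}

/-- `Σ^∞`: the countable product of copies of `Σ`. -/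
def bigSigmaInf : Set SeqSInf := {x | ∀ k, x k ∈ bigSigma}

/-- `σ^∞`: the countable product of copies of `σ`. -/
def smallSigmaInf : Set SeqSInf := {x | ∀ k, x k ∈ smallSigma}

/-- `Σ^∞_f`: the elements of `Σ^∞` with only finitely many nonzero entries `x k ∈ Σ`. -/
def bigSigmaInfFin : Set SeqSInf := {x | x ∈ bigSigmaInf ∧ {k | x k ≠ 0}.Finite}

/-- `σ^∞_f`: the elements of `σ^∞` with only finitely many nonzero entries `x k ∈ σ`. -/
def smallSigmaInfFin : Set SeqSInf := {x | x ∈ smallSigmaInf ∧ {k | x k ≠ 0}.Finite}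

/-- `s^∞_b`: the uniformly bounded double sequences. -/
def seqSInfBdd : Set SeqSInf := {x | ∃ C : ℝ, ∀ k i, |x k i| ≤ C}

/-- The tuple `(X, A 0, …, A (l - 1))` is `(E, B 0, …, B (l - 1))`-stable: there is a homeomorphism
of tuples `(X × E, A 0 × B 0, …) ≅ (X, A 0, …)`. -/
def IsTupleStable (X E : Type*) [TopologicalSpace X] [TopologicalSpace E] {l : ℕ}
    (A : Fin l → Set X) (B : Fin l → Set E) : Prop :=
  ∃ Φ : X × E ≃ₜ X, ∀ i, Φ '' (A i ×ˢ B i) = A i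

/-! ### Triangulations and piecewise linear maps -/

/-- Piecewise linear maps between polyhedra `P ⊆ F` and `Q ⊆ G`, in the sense of Rourke and
Sanderson: a continuous map `g` such that each point `a` of `P` has a star neighbourhood in `P` on
which `g` is affine along each segment issuing from `a`. -/
def IsPiecewiseLinear {F G : Type*} [NormedAddCommGroup F] [NormedSpace ℝ F]
    [NormedAddCommGroup G] [NormedSpace ℝ G] (P : Set F) (Q : Set G) (g : P → Q) : Prop :=
  Continuous g ∧ ∀ a : P, ∃ U ∈ 𝓝 a, ∀ x ∈ U, ∀ t ∈ Set.Icc (0 : ℝ) 1,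
    ∃ hy : AffineMap.lineMap (a : F) (x : F) t ∈ P,
      (g ⟨AffineMap.lineMap (a : F) (x : F) t, hy⟩ : G) =
        AffineMap.lineMap (g a : G) (g x : G) t

/-- A `C¹`-triangulation of a manifold `M` (possibly with boundary): a locally finite simplicial
complex `K` in some `ℝ^N` and a homeomorphism `|K| ≅ M` whose restriction to each closed simplex is
of class `C¹` with injective differential.

`toFun` is the homeomorphism as a map on the ambient space; its values off `|K|` play no role. A
derivative of `toFun` within a closed simplex is uniquely determined on the vectors parallel to the
simplex, and injectivity is required on those vectors. -/
structure C1Triangulation {E : Type*} [NormedAddCommGroup E] [NormedSpace ℝ E]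
    {H : Type*} [TopologicalSpace H] (I : ModelWithCorners ℝ E H)
    (M : Type*) [TopologicalSpace M] [ChartedSpace H M] where
  N : ℕ
  K : Geometry.SimplicialComplex ℝ (EuclideanSpace ℝ (Fin N))
  locallyFinite : ∀ x ∈ K.space, ∃ U ∈ 𝓝 x,
    {s ∈ K.faces | (convexHull ℝ (s : Set (EuclideanSpace ℝ (Fin N))) ∩ U).Nonempty}.Finite
  homeo : K.space ≃ₜ M
  toFun : EuclideanSpace ℝ (Fin N) → M
  toFun_eq : ∀ x : K.space, toFun x = homeo x
  contMDiffOn : ∀ s ∈ K.faces, ContMDiffOn 𝓘(ℝ, EuclideanSpace ℝ (Fin N)) I 1 toFun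
    (convexHull ℝ (s : Set (EuclideanSpace ℝ (Fin N))))
  nondegenerate : ∀ s ∈ K.faces, ∀ x ∈ convexHull ℝ (s : Set (EuclideanSpace ℝ (Fin N))),
    ∃ D : TangentSpace 𝓘(ℝ, EuclideanSpace ℝ (Fin N)) x →L[ℝ] TangentSpace I (toFun x),
      HasMFDerivWithinAt 𝓘(ℝ, EuclideanSpace ℝ (Fin N)) I toFun
        (convexHull ℝ (s : Set (EuclideanSpace ℝ (Fin N)))) x D ∧
      ∀ v ∈ vectorSpan ℝ (s : Set (EuclideanSpace ℝ (Fin N))), D v = 0 → v = 0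

namespace C1Triangulation

variable {E : Type*} [NormedAddCommGroup E] [NormedSpace ℝ E] {H : Type*} [TopologicalSpace H]
  {I : ModelWithCorners ℝ E H} {M : Type*} [TopologicalSpace M] [ChartedSpace H M]

/-- `X ⊆ M` is a compact subpolyhedron: it corresponds to the underlying space of a finite
simplicial complex contained in `|K|`. -/
def IsCompactSubpolyhedron (T : C1Triangulation I M) (X : Set M) : Prop :=
  ∃ L : Geometry.SimplicialComplex ℝ (EuclideanSpace ℝ (Fin T.N)),
    L.faces.Finite ∧ L.space ⊆ T.K.space ∧ L.space = {y | ∃ x ∈ X, (T.homeo.symm x : _) = y}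

/-- A homeomorphism of `M` is PL if it corresponds to a PL map `|K| → |K|`. -/
def IsPL (T : C1Triangulation I M) (h : M ≃ₜ M) : Prop :=
  IsPiecewiseLinear T.K.space T.K.space fun y => T.homeo.symm (h (T.homeo y))

end C1Triangulation

/-! ### Groups of homeomorphisms -/

/-- `H_X(M)`: the homeomorphisms of `M` onto itself that fix `X` pointwise. -/
def HomeoFix (M : Type*) [TopologicalSpace M] (X : Set M) : Type _ :=
  {h : M ≃ₜ M // ∀ x ∈ X, h x = x}

/-- `H_X(M)` carries the compact-open topology. -/
instance (M : Type*) [TopologicalSpace M] (X : Set M) : TopologicalSpace (HomeoFix M X) :=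
  TopologicalSpace.induced (fun h => (h.1 : C(M, M))) inferInstance

namespace HomeoFix

/-- Homeomorphisms with compact support. -/
def compactSupp (M : Type*) [TopologicalSpace M] (X : Set M) : Set (HomeoFix M X) :=
  {h | IsCompact (closure {x | h.1 x ≠ x})}

/-- `H_X^{loc LIP}(M)`: both `h` and `h⁻¹` are locally Lipschitz. -/
def locLIP (M : Type*) [MetricSpace M] (X : Set M) : Set (HomeoFix M X) :=
  {h | LocallyLipschitz h.1 ∧ LocallyLipschitz h.1.symm}

/-- `H_X^{LIP}(M)`: both `h` and `h⁻¹` are Lipschitz. -/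
def LIP (M : Type*) [MetricSpace M] (X : Set M) : Set (HomeoFix M X) :=
  {h | (∃ C, LipschitzWith C h.1) ∧ ∃ C, LipschitzWith C h.1.symm}

/-- `H_X^{LIP,c}(M)`: Lipschitz homeomorphisms with compact support. -/
def LIPc (M : Type*) [MetricSpace M] (X : Set M) : Set (HomeoFix M X) :=
  LIP M X ∩ compactSupp M X

variable {E : Type*} [NormedAddCommGroup E] [NormedSpace ℝ E] {H : Type*} [TopologicalSpace H]
  {I : ModelWithCorners ℝ E H} {M : Type*} [TopologicalSpace M] [ChartedSpace H M]

/-- `H_X^{PL}(M)`: PL-homeomorphisms with respect to the triangulation `T`. -/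
def PL (T : C1Triangulation I M) (X : Set M) : Set (HomeoFix M X) :=
  {h | T.IsPL h.1}

/-- `H_X^{PL,c}(M)`: PL-homeomorphisms with compact support. -/
def PLc (T : C1Triangulation I M) (X : Set M) : Set (HomeoFix M X) :=
  PL T X ∩ compactSupp M X

end HomeoFix

end

/-! All three statements come from one splitting of the group. Off `X` choose disjoint, locally
finite cells: a single one for (i), a sequence of them for (ii) and (iii). Each cell contains a
sequence of arcs on a ray, shrinking geometrically to a base point, with disjoint neighbourhoods. A
family `τ` of numbers in (-1,1), one per arc, defines a homeomorphism `glue τ` that slides the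
midpoint of each arc to the parameter given by `τ`. The coordinate `coord` of a homeomorphism `h` at
an arc is the parameter at which the image arc is balanced: it cuts the image into two pieces whose
sizes are in the same ratio as those of the two halves of the original arc.

Since `glue τ` carries the halves of an arc to the pieces cut off at `τ`, the composite `h ∘ glue τ`
has coordinate 0 exactly when `h` has coordinate `τ` (`coord_glue_trans_eq_zero_iff`). Hence `h ↦ (h
∘ glue (coord h), coord h)` splits the group as {coordinate 0} times a countable power of (-1,1).
That power is `s` or `s^∞`, and the homeomorphism `s × s ≅ s` absorbs a further factor
(`isTupleStable_of_coord`).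

Size needs care: images of arcs may have no length, and diameter is not strictly monotone.
`packSize` is continuous under uniform convergence and strictly monotone on compact sets, so the
balanced point exists, is unique and varies continuously. It is comparable to the diameter, so a
bi-Lipschitz image is balanced at a point bounded away from the ends by a constant depending only on
the Lipschitz constants (`balancePt_bound`). It is isometry invariant, so arcs whose images are
affinely parametrized segments have coordinate 0. A PL map is affine on the ray near the base point,
hence has finitely many nonzero coordinates per cell.

Conversely, `glue τ` is locally Lipschitz if each row of `τ` stays away from ±1, Lipschitz if this
holds uniformly, PL if each row is finitely supported, and compactly supported if finitely many rows
are nonzero. Thus the subgroups correspond to the subsets of the model space.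

Sizes are measured after a map `ψ`. For PL maps `ψ` is the triangulation `T.embed`, comparable to
the metric of `M` only locally and on continua (`exists_diamComparable`); for (iii) it is the
identity, which gives uniform bounds. The cells come from `exists_cell`; their distortion depends on
the dimension only, so the slides are uniformly Lipschitz even on noncompact `M`. -/

noncomputable section

/-! ### The packing size of a bounded set -/

section PackSize

variable {Z : Type*} [MetricSpace Z]

/-- The largest `r` such that `A` contains `n + 2` points at pairwise distance at least `r`. -/
def spread (n : ℕ) (A : Set Z) : ℝ :=
  sSup {r | 0 ≤ r ∧ ∃ x : Fin (n + 2) → Z, (∀ i, x i ∈ A) ∧ ∀ i j, i ≠ j → r ≤ dist (x i) (x j)}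

/-- A weighted sum of the packing numbers of `A`: an isometry invariant size, comparable to the
diameter and strictly monotone on compact sets. -/
def packSize (A : Set Z) : ℝ := ∑' n : ℕ, (1 / 2 : ℝ) ^ (n + 1) * spread n A

lemma spread_nonneg (n : ℕ) (A : Set Z) : 0 ≤ spread n A :=
  Real.sSup_nonneg fun _ hr => hr.1

lemma spread_le_diam (n : ℕ) {A : Set Z} (hA : Bornology.IsBounded A) :
    spread n A ≤ Metric.diam A := by
  refine Real.sSup_le ?_ Metric.diam_nonneg
  rintro r ⟨-, x, hx, hr⟩
  exact (hr 0 1 (by simp)).trans (Metric.dist_le_diam_of_mem hA (hx _) (hx _))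

lemma le_spread {n : ℕ} {A : Set Z} (hA : Bornology.IsBounded A) {r : ℝ} (hr : 0 ≤ r)
    (x : Fin (n + 2) → Z) (hx : ∀ i, x i ∈ A) (hd : ∀ i j, i ≠ j → r ≤ dist (x i) (x j)) :
    r ≤ spread n A := by
  refine le_csSup ⟨Metric.diam A, ?_⟩ ⟨hr, x, hx, hd⟩
  rintro r ⟨-, x, hx, hr⟩
  exact (hr 0 1 (by simp)).trans (Metric.dist_le_diam_of_mem hA (hx _) (hx _))

lemma dist_le_spread_zero {A : Set Z} (hA : Bornology.IsBounded A) {a b : Z} (ha : a ∈ A)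
    (hb : b ∈ A) : dist a b ≤ spread 0 A := by
  refine le_spread hA dist_nonneg ![a, b] (fun i => ?_) fun i j hij => ?_
  · fin_cases i <;> simpa
  · fin_cases i <;> fin_cases j <;> simp_all [dist_comm]

/-- Moving every point by at most `ε` lowers pairwise distances by at most `2ε`. The case `ε = 0` is
monotonicity under inclusion. -/
lemma spread_le_add {n : ℕ} {A B : Set Z} (hB : Bornology.IsBounded B) {ε : ℝ} (hε : 0 ≤ ε)
    (h : ∀ x ∈ A, ∃ y ∈ B, dist x y ≤ ε) : spread n A ≤ spread n B + 2 * ε := by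
  refine Real.sSup_le ?_ (by have := spread_nonneg n B; positivity)
  rintro r ⟨-, x, hx, hr⟩
  choose! f hfB hf using h
  by_cases hrε : r - 2 * ε < 0
  · have := spread_nonneg n B; linarith
  have := le_spread hB (not_lt.1 hrε) (fun i => f (x i)) (fun i => hfB _ (hx i)) fun i j hij => by
    have h1 := hf _ (hx i)
    have h2 := hf _ (hx j)
    have h3 := hr i j hij
    have h4 := dist_triangle4_right (x i) (x j) (f (x i)) (f (x j))
    have h5 := dist_triangle4 (x i) (f (x i)) (f (x j)) (x j)
    rw [dist_comm (f (x j)) (x j)] at h5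
    linarith
  linarith

lemma spread_image {Z' : Type*} [MetricSpace Z'] {f : Z → Z'} {A : Set Z} (n : ℕ)
    (hf : ∀ x ∈ A, ∀ y ∈ A, dist (f x) (f y) = dist x y) : spread n (f '' A) = spread n A := by
  unfold spread
  congr 1
  ext r
  constructor
  · rintro ⟨h0, x, hx, hr⟩
    choose y hy hyx using hx
    refine ⟨h0, y, hy, fun i j hij => ?_⟩
    rw [← hf _ (hy i) _ (hy j), hyx, hyx]
    exact hr i j hij
  · rintro ⟨h0, x, hx, hr⟩
    refine ⟨h0, fun i => f (x i), fun i => ⟨_, hx i, rfl⟩, fun i j hij => ?_⟩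
    rw [hf _ (hx i) _ (hx j)]
    exact hr i j hij

/-- Pigeonhole: among more points than there are balls of radius `η / 4` in a cover, two lie in the
same ball. -/
lemma exists_spread_lt {A : Set Z} (hA : TotallyBounded A) {η : ℝ} (hη : 0 < η) :
    ∃ n, spread n A < η := by
  obtain ⟨t, ht, hAt⟩ := Metric.totallyBounded_iff.1 hA (η / 4) (by positivity)
  refine ⟨ht.toFinset.card, lt_of_le_of_lt (Real.sSup_le ?_ (by positivity : 0 ≤ η / 2))
    (by linarith)⟩
  rintro r ⟨-, x, hx, hr⟩
  have : ∀ i, ∃ y ∈ ht.toFinset, dist (x i) y < η / 4 := fun i => by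
    simpa using hAt (hx i)
  choose y hy hxy using this
  obtain ⟨i, -, j, -, hij, he⟩ := Finset.exists_ne_map_eq_of_card_lt_of_maps_to
    (s := Finset.univ) (t := ht.toFinset) (f := y) (by simp) (fun i _ => hy i)
  have h1 := hr i j hij
  have h2 := hxy i
  have h3 := hxy j
  have h4 := dist_triangle_right (x i) (x j) (y i)
  rw [he] at h4 h2
  linarith

/-- Let `η` be a lower bound for the distance from `b` to `A`, and take the first `n` with `spread n
A < η`. By minimality `A` contains one point fewer with separation almost `η`; adding `b` gives a
configuration showing `η ≤ spread n B`. For `n = 0` the pair of `b` and any point of `A` does it. -/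
lemma spread_lt_of_notMem {A B : Set Z} (hA : IsCompact A) (hne : A.Nonempty) (hB : IsCompact B)
    (hAB : A ⊆ B) {b : Z} (hb : b ∈ B) (hbA : b ∉ A) : ∃ n, spread n A < spread n B := by
  obtain ⟨η, hη, hη'⟩ : ∃ η > 0, ∀ a ∈ A, η ≤ dist b a := by
    obtain ⟨η, hη, h⟩ := Metric.isOpen_iff.1 hA.isClosed.isOpen_compl b hbA
    refine ⟨η, hη, fun a ha => not_lt.1 fun hlt => h (Metric.mem_ball'.2 hlt) ha⟩
  have hex := exists_spread_lt hA.totallyBounded hη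
  classical
  refine ⟨Nat.find hex, (Nat.find_spec hex).trans_le ?_⟩
  rcases hn : Nat.find hex with _ | m
  · obtain ⟨a, ha⟩ := hne
    exact (hη' a ha).trans (dist_le_spread_zero hB.isBounded hb (hAB ha))
  · have hm : η ≤ spread m A := not_lt.1 (Nat.find_min hex (by omega))
    refine le_of_forall_pos_sub_le fun ε hε => ?_
    by_cases hneg : η - ε < 0
    · exact hneg.le.trans (spread_nonneg _ _)
    have hS : ({r | 0 ≤ r ∧ ∃ x : Fin (m + 2) → Z, (∀ i, x i ∈ A) ∧
        ∀ i j, i ≠ j → r ≤ dist (x i) (x j)} : Set ℝ).Nonempty := by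
      obtain ⟨a, ha⟩ := hne
      exact ⟨0, le_rfl, fun _ => a, fun _ => ha, fun _ _ _ => dist_nonneg⟩
    obtain ⟨r, ⟨-, x, hx, hr⟩, hlt⟩ := exists_lt_of_lt_csSup hS
      (show η - ε < _ from lt_of_lt_of_le (by linarith) hm)
    refine le_spread hB.isBounded (not_lt.1 hneg) (Fin.cons b x) ?_ ?_
    · intro i
      refine Fin.cases ?_ (fun i => ?_) i
      · simpa using hb
      · simpa using hAB (hx i)
    · intro i j
      refine Fin.cases ?_ (fun i => ?_) i <;> refine Fin.cases ?_ (fun j => ?_) j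
      · simp
      · intro _
        simpa using (hη' _ (hx j)).trans (by linarith : dist b (x j) ≤ dist b (x j) + ε)
      · intro _
        rw [dist_comm]
        simpa using (hη' _ (hx i)).trans (by linarith : dist b (x i) ≤ dist b (x i) + ε)
      · intro hij
        simpa using hlt.le.trans (hr i j (by simpa using hij))

lemma hasSum_half_pow_succ : HasSum (fun n : ℕ => (1 / 2 : ℝ) ^ (n + 1)) 1 := by
  have := hasSum_geometric_two.mul_left (1 / 2 : ℝ)
  simpa [pow_succ, mul_comm] using this

lemma summable_packSize {A : Set Z} (hA : Bornology.IsBounded A) :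
    Summable fun n : ℕ => (1 / 2 : ℝ) ^ (n + 1) * spread n A := by
  refine Summable.of_nonneg_of_le (fun n => mul_nonneg (by positivity) (spread_nonneg _ _))
    (fun n => mul_le_mul_of_nonneg_left (spread_le_diam n hA) (by positivity))
    (hasSum_half_pow_succ.summable.mul_right _)

lemma packSize_nonneg (A : Set Z) : 0 ≤ packSize A :=
  tsum_nonneg fun n => mul_nonneg (by positivity) (spread_nonneg _ _)

lemma packSize_le_diam {A : Set Z} (hA : Bornology.IsBounded A) : packSize A ≤ Metric.diam A := by
  have h := (summable_packSize hA).tsum_le_tsum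
    (fun n => mul_le_mul_of_nonneg_left (spread_le_diam n hA) (by positivity))
    (hasSum_half_pow_succ.summable.mul_right _)
  rwa [tsum_mul_right, hasSum_half_pow_succ.tsum_eq, one_mul] at h

lemma dist_le_two_mul_packSize {A : Set Z} (hA : Bornology.IsBounded A) {a b : Z} (ha : a ∈ A)
    (hb : b ∈ A) : dist a b ≤ 2 * packSize A := by
  have h := (summable_packSize hA).le_tsum 0
    fun n _ => mul_nonneg (by positivity) (spread_nonneg _ _)
  have h' := dist_le_spread_zero hA ha hb
  change _ ≤ packSize A at h
  norm_num at h
  linarith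

lemma packSize_le_add {A B : Set Z} (hA : Bornology.IsBounded A) (hB : Bornology.IsBounded B)
    {ε : ℝ} (hε : 0 ≤ ε) (h : ∀ x ∈ A, ∃ y ∈ B, dist x y ≤ ε) :
    packSize A ≤ packSize B + 2 * ε := by
  have h1 := (hasSum_half_pow_succ.mul_right (2 * ε))
  have h2 := (summable_packSize hA).tsum_le_tsum (fun n => mul_le_mul_of_nonneg_left
    (spread_le_add (n := n) hB hε h) (by positivity : (0 : ℝ) ≤ (1 / 2 : ℝ) ^ (n + 1)))
    (by simpa only [mul_add] using (summable_packSize hB).add h1.summable)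
  refine h2.trans_eq ?_
  simp only [mul_add]
  rw [(summable_packSize hB).tsum_add h1.summable, h1.tsum_eq, one_mul]
  rfl

lemma packSize_lt {A B : Set Z} (hA : IsCompact A) (hne : A.Nonempty) (hB : IsCompact B)
    (hAB : A ⊆ B) {b : Z} (hb : b ∈ B) (hbA : b ∉ A) : packSize A < packSize B := by
  obtain ⟨n, hn⟩ := spread_lt_of_notMem hA hne hB hAB hb hbA
  refine Summable.tsum_lt_tsum (i := n) (fun m => mul_le_mul_of_nonneg_left ?_ (by positivity))
    (mul_lt_mul_of_pos_left hn (by positivity)) (summable_packSize hA.isBounded)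
    (summable_packSize hB.isBounded)
  simpa using spread_le_add (n := m) hB.isBounded le_rfl fun x hx => ⟨x, hAB hx, by simp⟩

lemma packSize_image {Z' : Type*} [MetricSpace Z'] {f : Z → Z'} {A : Set Z}
    (hf : ∀ x ∈ A, ∀ y ∈ A, dist (f x) (f y) = dist x y) :
    packSize (f '' A) = packSize A := by
  simp only [packSize, spread_image _ hf]

lemma packSize_singleton (a : Z) : packSize {a} = 0 :=
  le_antisymm (by simpa using packSize_le_diam (A := {a}) Bornology.isBounded_singleton)
    (packSize_nonneg _)

end PackSize

/-! ### Balanced points of arcs -/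

section Balance

open Set

variable {Z : Type*} [MetricSpace Z]

/-- By compactness of `K`, nearby parameters give uniformly close images, and `packSize_le_add`
applies in both directions. -/
lemma continuous_packSize_image {T : Type*} [TopologicalSpace T] {h : T → ℝ → Z}
    (hh : Continuous (Function.uncurry h)) {K : Set ℝ} (hK : IsCompact K) :
    Continuous fun t => packSize (h t '' K) := by
  rw [continuous_iff_continuousAt]
  intro t₀
  rw [ContinuousAt, Metric.tendsto_nhds]
  intro ε hε
  have hev : ∀ᶠ t in 𝓝 t₀, ∀ s ∈ K, dist (h t s) (h t₀ s) < ε / 4 := by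
    apply hK.eventually_forall_of_forall_eventually
    intro s _
    have h1 : Continuous fun q : T × ℝ => dist (h q.1 q.2) (h t₀ q.2) :=
      hh.dist (hh.comp (continuous_const.prodMk continuous_snd))
    exact h1.continuousAt.eventually_lt continuousAt_const (by simpa using by positivity)
  have hbd : ∀ t, Bornology.IsBounded (h t '' K) := fun t =>
    (hK.image (hh.comp (Continuous.prodMk_right t))).isBounded
  filter_upwards [hev] with t ht
  have h1 : packSize (h t '' K) ≤ packSize (h t₀ '' K) + 2 * (ε / 4) := by
    refine packSize_le_add (hbd _) (hbd _) (by positivity) ?_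
    rintro _ ⟨s, hs, rfl⟩
    exact ⟨_, ⟨s, hs, rfl⟩, (ht s hs).le⟩
  have h2 : packSize (h t₀ '' K) ≤ packSize (h t '' K) + 2 * (ε / 4) := by
    refine packSize_le_add (hbd _) (hbd _) (by positivity) ?_
    rintro _ ⟨s, hs, rfl⟩
    exact ⟨_, ⟨s, hs, rfl⟩, by rw [dist_comm]; exact (ht s hs).le⟩
  rw [Real.dist_eq, abs_lt]
  constructor <;> linarith

/-- The packing size of the piece of the curve `γ` between the parameters `a` and `b`. -/
def segSize (γ : ℝ → Z) (a b : ℝ) : ℝ := packSize (γ '' uIcc a b)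

/-- The moving interval is reparametrized affinely by the fixed interval [0,1]. The unordered
interval makes this valid even where the endpoints cross. -/
lemma continuous_segSize {T : Type*} [TopologicalSpace T] {h : T → ℝ → Z}
    (hh : Continuous (Function.uncurry h)) {a b : T → ℝ} (ha : Continuous a) (hb : Continuous b) :
    Continuous fun t => segSize (h t) (a t) (b t) := by
  have hl : Continuous fun q : T × ℝ => (q.1, AffineMap.lineMap (a q.1) (b q.1) q.2) := by
    simp only [AffineMap.lineMap_apply, vsub_eq_sub, vadd_eq_add, smul_eq_mul]
    fun_prop
  have h1 := continuous_packSize_image (h := fun t s => h t (AffineMap.lineMap (a t) (b t) s))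
    (hh.comp hl) (isCompact_Icc (a := (0 : ℝ)) (b := 1))
  convert h1 using 2 with t
  rw [segSize, ← segment_eq_uIcc, segment_eq_image_lineMap, image_image]

lemma segSize_self (γ : ℝ → Z) (a : ℝ) : segSize γ a a = 0 := by
  simp [segSize, packSize_singleton]

lemma segSize_nonneg (γ : ℝ → Z) (a b : ℝ) : 0 ≤ segSize γ a b := packSize_nonneg _

lemma segSize_left_lt {γ : ℝ → Z} (hγ : Continuous γ) (hi : InjOn γ (Icc (-1) 1)) {x y : ℝ}
    (hx : -1 ≤ x) (hxy : x < y) (hy : y ≤ 1) : segSize γ (-1) x < segSize γ (-1) y := by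
  rw [segSize, segSize, uIcc_of_le hx, uIcc_of_le (hx.trans hxy.le)]
  refine packSize_lt (isCompact_Icc.image hγ) ((nonempty_Icc.2 hx).image _)
    (isCompact_Icc.image hγ) (image_mono (Icc_subset_Icc_right hxy.le))
    (mem_image_of_mem _ (right_mem_Icc.2 (hx.trans hxy.le))) ?_
  rintro ⟨z, hz, he⟩
  have := hi ⟨hz.1, by linarith [hz.2]⟩ ⟨by linarith, hy⟩ he
  linarith [hz.2]

lemma segSize_right_lt {γ : ℝ → Z} (hγ : Continuous γ) (hi : InjOn γ (Icc (-1) 1)) {x y : ℝ}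
    (hx : -1 ≤ x) (hxy : x < y) (hy : y ≤ 1) : segSize γ y 1 < segSize γ x 1 := by
  rw [segSize, segSize, uIcc_of_le hy, uIcc_of_le (hxy.le.trans hy)]
  refine packSize_lt (isCompact_Icc.image hγ) ((nonempty_Icc.2 hy).image _)
    (isCompact_Icc.image hγ) (image_mono (Icc_subset_Icc_left hxy.le))
    (mem_image_of_mem _ (left_mem_Icc.2 (hxy.le.trans hy))) ?_
  rintro ⟨z, hz, he⟩
  have := hi ⟨by linarith [hz.1], hz.2⟩ ⟨hx, by linarith⟩ he
  linarith [hz.1]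

/-- The weighted difference of the sizes of the two pieces into which `x` divides `γ`. -/
def imbalance (α β : ℝ) (γ : ℝ → Z) (x : ℝ) : ℝ :=
  β * segSize γ (-1) x - α * segSize γ x 1

lemma imbalance_strictMonoOn {α β : ℝ} (hα : 0 < α) (hβ : 0 < β) {γ : ℝ → Z} (hγ : Continuous γ)
    (hi : InjOn γ (Icc (-1) 1)) : StrictMonoOn (imbalance α β γ) (Icc (-1) 1) := by
  intro x hx y hy hxy
  have h1 := mul_lt_mul_of_pos_left (segSize_left_lt hγ hi hx.1 hxy hy.2) hβ
  have h2 := mul_lt_mul_of_pos_left (segSize_right_lt hγ hi hx.1 hxy hy.2) hα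
  simp only [imbalance]
  linarith

lemma continuous_imbalance {T : Type*} [TopologicalSpace T] {h : T → ℝ → Z} (α β : ℝ)
    (hh : Continuous (Function.uncurry h)) {x : T → ℝ} (hx : Continuous x) :
    Continuous fun t => imbalance α β (h t) (x t) :=
  ((continuous_segSize hh continuous_const hx).const_mul β).sub
    ((continuous_segSize hh hx continuous_const).const_mul α)

lemma exists_imbalance_eq_zero {α β : ℝ} (hα : 0 < α) (hβ : 0 < β) {γ : ℝ → Z}
    (hγ : Continuous γ) (hi : InjOn γ (Icc (-1) 1)) :
    ∃ x : Ioo (-1 : ℝ) 1, imbalance α β γ x = 0 := by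
  have hc : Continuous (imbalance α β γ) :=
    continuous_imbalance (h := fun _ : ℝ => γ) α β (hγ.comp continuous_snd) continuous_id
  have h0 : imbalance α β γ (-1) < 0 := by
    have := mul_pos hα ((segSize_self γ 1).symm.trans_lt
      (segSize_right_lt hγ hi le_rfl (by norm_num) le_rfl))
    simpa [imbalance, segSize_self] using this
  have h1 : 0 < imbalance α β γ 1 := by
    have := mul_pos hβ ((segSize_self γ (-1)).symm.trans_lt
      (segSize_left_lt hγ hi le_rfl (by norm_num) le_rfl))
    simpa [imbalance, segSize_self] using this
  obtain ⟨x, hx, hx0⟩ := intermediate_value_Ioo (by norm_num : (-1 : ℝ) ≤ 1) hc.continuousOn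
    ⟨h0, h1⟩
  exact ⟨⟨x, hx⟩, hx0⟩

open Classical in
/-- The point at which the arc `γ` is balanced. -/
def balancePt (α β : ℝ) (γ : ℝ → Z) : Ioo (-1 : ℝ) 1 :=
  if h : ∃ x : Ioo (-1 : ℝ) 1, imbalance α β γ x = 0 then h.choose else ⟨0, by norm_num⟩

lemma imbalance_balancePt {α β : ℝ} (hα : 0 < α) (hβ : 0 < β) {γ : ℝ → Z}
    (hγ : Continuous γ) (hi : InjOn γ (Icc (-1) 1)) :
    imbalance α β γ (balancePt α β γ) = 0 := by
  have h := exists_imbalance_eq_zero hα hβ hγ hi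
  rw [balancePt, dif_pos h]
  exact h.choose_spec

lemma balancePt_eq {α β : ℝ} (hα : 0 < α) (hβ : 0 < β) {γ : ℝ → Z}
    (hγ : Continuous γ) (hi : InjOn γ (Icc (-1) 1)) {x : Ioo (-1 : ℝ) 1}
    (hx : imbalance α β γ x = 0) : balancePt α β γ = x := by
  have h := imbalance_balancePt hα hβ hγ hi
  exact Subtype.ext ((imbalance_strictMonoOn hα hβ hγ hi).injOn
    (Ioo_subset_Icc_self (balancePt α β γ).2) (Ioo_subset_Icc_self x.2) (h.trans hx.symm))

/-- The imbalance is strictly increasing in the parameter, so its sign at a fixed `a` tells on which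
side of `a` the balanced point lies. That sign is stable under small changes of the curve. -/
lemma continuous_balancePt {T : Type*} [TopologicalSpace T] {h : T → ℝ → Z} {α β : ℝ}
    (hα : 0 < α) (hβ : 0 < β) (hh : Continuous (Function.uncurry h))
    (hi : ∀ t, InjOn (h t) (Icc (-1) 1)) : Continuous fun t => balancePt α β (h t) := by
  have hγ : ∀ t, Continuous (h t) := fun t => hh.comp (Continuous.prodMk_right t)
  have hc : ∀ x : ℝ, Continuous fun t => imbalance α β (h t) x := fun x =>
    continuous_imbalance α β hh continuous_const
  have hm := fun t => imbalance_strictMonoOn hα hβ (hγ t) (hi t)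
  have hz := fun t => imbalance_balancePt hα hβ (hγ t) (hi t)
  rw [continuous_iff_continuousAt]
  intro t₀
  rw [ContinuousAt, tendsto_order]
  constructor
  · intro a ha
    have h1 := hm t₀ (Ioo_subset_Icc_self a.2) (Ioo_subset_Icc_self (balancePt α β (h t₀)).2) ha
    rw [hz] at h1
    filter_upwards [(hc a).continuousAt.eventually_lt continuousAt_const h1] with t ht
    rw [← hz t] at ht
    exact ((hm t).lt_iff_lt (Ioo_subset_Icc_self a.2)
      (Ioo_subset_Icc_self (balancePt α β (h t)).2)).1 ht
  · intro a ha
    have h1 := hm t₀ (Ioo_subset_Icc_self (balancePt α β (h t₀)).2) (Ioo_subset_Icc_self a.2) ha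
    rw [hz] at h1
    filter_upwards [continuousAt_const.eventually_lt (hc a).continuousAt h1] with t ht
    rw [← hz t] at ht
    exact ((hm t).lt_iff_lt (Ioo_subset_Icc_self (balancePt α β (h t)).2)
      (Ioo_subset_Icc_self a.2)).1 ht

/-- If the size of the pieces of two arcs is comparable to the length of the parameter interval,
then the balanced point stays away from the ends. -/
lemma balancePt_bound {γ₀ γ : ℝ → Z} {C R : ℝ} (hC : 0 < C) (hR : 0 < R)
    (hγ : Continuous γ) (hi : InjOn γ (Icc (-1) 1))
    (h₀ : ∀ x y, -1 ≤ x → x ≤ y → y ≤ 1 →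
      R * (y - x) ≤ C * segSize γ₀ x y ∧ segSize γ₀ x y ≤ C * (R * (y - x)))
    (h : ∀ x y, -1 ≤ x → x ≤ y → y ≤ 1 →
      R * (y - x) ≤ C * segSize γ x y ∧ segSize γ x y ≤ C * (R * (y - x))) :
    |(balancePt (segSize γ₀ (-1) 0) (segSize γ₀ 0 1) γ : ℝ)| ≤ (C ^ 4 - 1) / (C ^ 4 + 1) := by
  have hα := h₀ (-1) 0 le_rfl (by norm_num) (by norm_num)
  have hβ := h₀ 0 1 (by norm_num) (by norm_num) le_rfl
  set α := segSize γ₀ (-1) 0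
  set β := segSize γ₀ 0 1
  norm_num at hα hβ
  have hα0 : 0 < α := by
    by_contra hn
    nlinarith
  have hβ0 : 0 < β := by
    by_contra hn
    nlinarith
  have hz := imbalance_balancePt hα0 hβ0 hγ hi
  generalize balancePt α β γ = p at hz ⊢
  obtain ⟨x, hx⟩ := p
  simp only [imbalance] at hz ⊢
  have hl := h (-1) x le_rfl hx.1.le hx.2.le
  have hr := h x 1 hx.1.le hx.2.le le_rfl
  set l := segSize γ (-1) x
  set r := segSize γ x 1
  have hzz : β * l = α * r := by linarith
  have hR2 : 0 < R * R := by positivity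
  have hl0 : 0 ≤ l := segSize_nonneg _ _ _
  have hr0 : 0 ≤ r := segSize_nonneg _ _ _
  -- The scale `R` enters both sides of `β * l = α * r` to the same power and cancels, so the final
  -- bound depends on `C` alone.
  have k1 : (R * R) * (x + 1) ≤ C ^ 2 * (β * l) := by
    calc (R * R) * (x + 1) = R * (R * (x - -1)) := by ring
      _ ≤ (C * β) * (C * l) := mul_le_mul hβ.1 hl.1
          (mul_nonneg hR.le (by linarith [hx.1])) (by positivity)
      _ = _ := by ring
  have k2 : (R * R) * (1 - x) ≤ C ^ 2 * (α * r) := by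
    calc (R * R) * (1 - x) = R * (R * (1 - x)) := by ring
      _ ≤ (C * α) * (C * r) := mul_le_mul hα.1 hr.1
          (mul_nonneg hR.le (by linarith [hx.2])) (by positivity)
      _ = _ := by ring
  have k3 : β * l ≤ C ^ 2 * ((R * R) * (x + 1)) := by
    calc β * l ≤ (C * R) * (C * (R * (x - -1))) := mul_le_mul hβ.2 hl.2 hl0 (by positivity)
      _ = _ := by ring
  have k4 : α * r ≤ C ^ 2 * ((R * R) * (1 - x)) := by
    calc α * r ≤ (C * R) * (C * (R * (1 - x))) := mul_le_mul hα.2 hr.2 hr0 (by positivity)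
      _ = _ := by ring
  have hC2 : 0 < C ^ 2 := by positivity
  have m1 : x + 1 ≤ C ^ 4 * (1 - x) := by
    refine le_of_mul_le_mul_left ?_ hR2
    calc (R * R) * (x + 1) ≤ C ^ 2 * (C ^ 2 * ((R * R) * (1 - x))) :=
          k1.trans (mul_le_mul_of_nonneg_left (hzz.trans_le k4) hC2.le)
      _ = _ := by ring
  have m2 : 1 - x ≤ C ^ 4 * (x + 1) := by
    refine le_of_mul_le_mul_left ?_ hR2
    calc (R * R) * (1 - x) ≤ C ^ 2 * (C ^ 2 * ((R * R) * (x + 1))) :=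
          k2.trans (mul_le_mul_of_nonneg_left (hzz.symm.trans_le k3) hC2.le)
      _ = _ := by ring
  have hC4 : 0 < C ^ 4 + 1 := by positivity
  rw [abs_le, ← neg_div, div_le_iff₀ hC4, le_div_iff₀ hC4]
  constructor <;> nlinarith

end Balance

/-! ### Gluing disjointly supported maps -/

section Glue

open Set

variable {M ι : Type*}

open Classical in
/-- The map which is `g i` on `D i` and the identity elsewhere. -/
def glueMap (D : ι → Set M) (g : ι → M → M) (x : M) : M :=
  if h : ∃ i, x ∈ D i then g h.choose x else x

lemma glueMap_of_mem {D : ι → Set M} (hD : Pairwise (Function.onFun Disjoint D)) (g : ι → M → M)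
    {i : ι} {x : M} (hx : x ∈ D i) : glueMap D g x = g i x := by
  have h : ∃ i, x ∈ D i := ⟨i, hx⟩
  have : h.choose = i := by
    by_contra hne
    exact (disjoint_left.1 (hD hne)) h.choose_spec hx
  rw [glueMap, dif_pos h, this]

lemma glueMap_of_notMem {D : ι → Set M} (g : ι → M → M) {x : M} (hx : ∀ i, x ∉ D i) :
    glueMap D g x = x :=
  dif_neg (by simpa using hx)

/-- Closed sets `D i` of which, locally, all but finitely many are arbitrarily small. -/
def IsLocallyNull [MetricSpace M] (D : ι → Set M) : Prop :=
  ∀ x : M, ∀ ε > 0, ∃ U ∈ 𝓝 x,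
    {i | (D i ∩ U).Nonempty ∧ ∃ y ∈ D i, ∃ z ∈ D i, ε ≤ dist y z}.Finite

/-- Near `x₀` compare with the one `g i` for which `x₀ ∈ D i`, or with the identity. The other large
pieces are closed, finite in number locally, and miss a neighbourhood of `x₀`; the small pieces are
preserved by their maps, so points there move by less than `ε / 2`. -/
lemma continuous_glueMap [MetricSpace M] {T : Type*} [TopologicalSpace T] {D : ι → Set M}
    (hD : Pairwise (Function.onFun Disjoint D)) (hc : ∀ i, IsClosed (D i)) (hn : IsLocallyNull D)
    {g : ι → T → M → M} (hg : ∀ i, Continuous fun q : T × M => g i q.1 q.2)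
    (hoff : ∀ i t x, x ∉ D i → g i t x = x) (hmaps : ∀ i t x, x ∈ D i → g i t x ∈ D i) :
    Continuous fun q : T × M => glueMap D (fun i => g i q.1) q.2 := by
  rw [continuous_iff_continuousAt]
  rintro ⟨t₀, x₀⟩
  rw [ContinuousAt, Metric.tendsto_nhds]
  intro ε hε
  obtain ⟨U, hU, hfin⟩ := hn x₀ (ε / 2) (by positivity)
  obtain ⟨g', hg', hg'₀, hgD⟩ : ∃ g' : T → M → M, (Continuous fun q : T × M => g' q.1 q.2) ∧
      g' t₀ x₀ = glueMap D (fun i => g i t₀) x₀ ∧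
      ∀ t x, (∃ i, x₀ ∈ D i ∧ x ∈ D i ∧ g' t x = g i t x) ∨
        ((∀ i, x₀ ∈ D i → x ∉ D i) ∧ g' t x = x) := by
    by_cases h : ∃ i, x₀ ∈ D i
    · obtain ⟨i, hi⟩ := h
      refine ⟨g i, hg i, (glueMap_of_mem hD (fun i => g i t₀) hi).symm, fun t x => ?_⟩
      by_cases hx : x ∈ D i
      · exact Or.inl ⟨i, hi, hx, rfl⟩
      · refine Or.inr ⟨fun j hj hxj => ?_, hoff i t x hx⟩
        have : j = i := by
          by_contra hne
          exact (disjoint_left.1 (hD hne)) hj hi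
        exact hx (this ▸ hxj)
    · push Not at h
      exact ⟨fun _ x => x, continuous_snd, (glueMap_of_notMem (fun i => g i t₀) h).symm,
        fun t x => Or.inr ⟨fun i hi => absurd hi (h i), rfl⟩⟩
  have e1 : ∀ᶠ q : T × M in 𝓝 (t₀, x₀), q.2 ∈ U :=
    continuous_snd.continuousAt.eventually_mem (x := (t₀, x₀)) hU
  have e2 : ∀ᶠ q : T × M in 𝓝 (t₀, x₀), ∀ i ∈ {i | (D i ∩ U).Nonempty ∧
      ∃ y ∈ D i, ∃ z ∈ D i, ε / 2 ≤ dist y z}, x₀ ∉ D i → q.2 ∉ D i := by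
    rw [Filter.eventually_all_finite hfin]
    intro i _
    by_cases hx : x₀ ∈ D i
    · exact Filter.Eventually.of_forall fun _ h => absurd hx h
    · filter_upwards [continuous_snd.continuousAt.eventually_mem (x := (t₀, x₀))
        ((hc i).isOpen_compl.mem_nhds hx)] with q hq _ using hq
  have e3 : ∀ᶠ q : T × M in 𝓝 (t₀, x₀), dist (g' q.1 q.2) (g' t₀ x₀) < ε / 2 :=
    Metric.tendsto_nhds.1 hg'.continuousAt _ (by positivity)
  filter_upwards [e1, e2, e3] with ⟨t, x⟩ h1 h2 h3
  simp only at h1 h2 h3 ⊢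
  rw [← hg'₀]
  rcases hgD t x with ⟨i, hi₀, hi, he⟩ | ⟨hno, he⟩
  · rw [glueMap_of_mem hD _ hi, ← he]
    linarith
  · rw [he] at h3
    by_cases h : ∃ i, x ∈ D i
    · obtain ⟨i, hi⟩ := h
      rw [glueMap_of_mem hD _ hi]
      have hsmall : dist (g i t x) x < ε / 2 := by
        by_contra hge
        exact h2 i ⟨⟨x, hi, h1⟩, _, hmaps i t x hi, x, hi, not_lt.1 hge⟩
          (fun h => hno i h hi) hi
      linarith [dist_triangle (g i t x) x (g' t₀ x₀)]
    · push Not at h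
      rw [glueMap_of_notMem _ h]
      linarith

/-- For points in different pieces `D i` and `D j`, the glued map agrees at both points with `g i ∘
g j`. This gives the constant `L * L` without any path between the points. -/
lemma dist_glueMap_le [MetricSpace M] {D : ι → Set M}
    (hD : Pairwise (Function.onFun Disjoint D)) {g : ι → M → M}
    (hoff : ∀ i x, x ∉ D i → g i x = x) (hmaps : ∀ i x, x ∈ D i → g i x ∈ D i)
    {L : ℝ} (hL : 1 ≤ L) {x y : M}
    (h : ∀ i, x ∈ D i ∨ y ∈ D i → ∀ a b, dist (g i a) (g i b) ≤ L * dist a b) :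
    dist (glueMap D g x) (glueMap D g y) ≤ L * L * dist x y := by
  have hL0 : 0 ≤ L := by linarith
  have hLL : L ≤ L * L := le_mul_of_one_le_left hL0 hL
  have key : ∀ i, (x ∈ D i ∨ y ∈ D i) → (x ∈ D i ∨ ∀ j, x ∉ D j) → (y ∈ D i ∨ ∀ j, y ∉ D j) →
      dist (glueMap D g x) (glueMap D g y) ≤ L * L * dist x y := by
    intro i hi hx hy
    have hx' : glueMap D g x = g i x := by
      rcases hx with hx | hx
      · exact glueMap_of_mem hD g hx
      · rw [glueMap_of_notMem g hx, hoff i x (hx i)]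
    have hy' : glueMap D g y = g i y := by
      rcases hy with hy | hy
      · exact glueMap_of_mem hD g hy
      · rw [glueMap_of_notMem g hy, hoff i y (hy i)]
    rw [hx', hy']
    exact (h i hi x y).trans (mul_le_mul_of_nonneg_right hLL dist_nonneg)
  by_cases hx : ∃ i, x ∈ D i <;> by_cases hy : ∃ j, y ∈ D j
  · obtain ⟨i, hi⟩ := hx
    obtain ⟨j, hj⟩ := hy
    by_cases hij : i = j
    · subst hij
      exact key i (Or.inl hi) (Or.inl hi) (Or.inl hj)
    have hd := disjoint_left.1 (hD hij)
    have h1 : glueMap D g x = g i (g j x) := by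
      rw [hoff j x fun hxj => hd hi hxj, glueMap_of_mem hD g hi]
    have h2 : glueMap D g y = g i (g j y) := by
      rw [hoff i (g j y) fun hyi => hd hyi (hmaps j y hj), glueMap_of_mem hD g hj]
    rw [h1, h2, mul_assoc]
    exact (h i (Or.inl hi) _ _).trans (mul_le_mul_of_nonneg_left (h j (Or.inr hj) _ _) hL0)
  · obtain ⟨i, hi⟩ := hx
    exact key i (Or.inl hi) (Or.inl hi) (Or.inr (by simpa using hy))
  · obtain ⟨j, hj⟩ := hy
    exact key j (Or.inr hj) (Or.inr (by simpa using hx)) (Or.inl hj)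
  · rw [glueMap_of_notMem g (by simpa using hx), glueMap_of_notMem g (by simpa using hy)]
    exact le_mul_of_one_le_left dist_nonneg (hL.trans hLL)

end Glue

/-! ### Stability from a system of coordinates -/

section TupleStable

open Set

/-- Here `c` is a coordinate, and `tw`, `un` are inverse changes of it. Normalizing `g` by `tw g (c
g)` gives coordinate `e₀`; the homeomorphism keeps this normalized part and replaces the coordinate
`c g` by the merger of `c g` with the new factor. -/
lemma isTupleStable_of_coord {G E : Type*} [TopologicalSpace G] [TopologicalSpace E] {l : ℕ}
    {A : Fin l → Set G} {B : Fin l → Set E} {c : G → E} (hc : Continuous c) {tw un : G → E → G}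
    (htw : Continuous fun q : G × E => tw q.1 q.2) (hun : Continuous fun q : G × E => un q.1 q.2)
    {e₀ : E} (h₁ : ∀ g t, un (tw g t) t = g) (h₂ : ∀ g t, tw (un g t) t = g)
    (h₃ : ∀ g, c (tw g (c g)) = e₀) (h₄ : ∀ g t, c g = e₀ → c (un g t) = t)
    (m : E × E ≃ₜ E) (hm : ∀ j p, m p ∈ B j ↔ p.1 ∈ B j ∧ p.2 ∈ B j)
    (hA : ∀ j, ∀ g ∈ A j, c g ∈ B j) (hA₁ : ∀ j, ∀ g ∈ A j, ∀ t ∈ B j, tw g t ∈ A j)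
    (hA₂ : ∀ j, ∀ g ∈ A j, ∀ t ∈ B j, un g t ∈ A j) : IsTupleStable G E A B := by
  have hcc : Continuous fun g => tw g (c g) := htw.comp (continuous_id.prodMk hc)
  let Φ : G × E ≃ₜ G :=
    { toFun := fun q => un (tw q.1 (c q.1)) (m (c q.1, q.2))
      invFun := fun g => (un (tw g (c g)) (m.symm (c g)).1, (m.symm (c g)).2)
      left_inv := by
        rintro ⟨g, x⟩
        have e : c (un (tw g (c g)) (m (c g, x))) = m (c g, x) := h₄ _ _ (h₃ g)
        simp only [e, h₂, Homeomorph.symm_apply_apply, h₁]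
      right_inv := by
        intro g
        have e : c (un (tw g (c g)) (m.symm (c g)).1) = (m.symm (c g)).1 := h₄ _ _ (h₃ g)
        simp only [e, h₂, Prod.mk.eta, Homeomorph.apply_symm_apply, h₁]
      continuous_toFun := hun.comp ((hcc.comp continuous_fst).prodMk
        (m.continuous.comp ((hc.comp continuous_fst).prodMk continuous_snd)))
      continuous_invFun := by
        have := m.symm.continuous.comp hc
        exact (hun.comp (hcc.prodMk (continuous_fst.comp this))).prodMk
          (continuous_snd.comp this) }
  refine ⟨Φ, fun j => Subset.antisymm ?_ fun g hg => ?_⟩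
  · rintro _ ⟨⟨g, x⟩, ⟨hg, hx⟩, rfl⟩
    exact hA₂ j _ (hA₁ j g hg _ (hA j g hg)) _ ((hm j _).2 ⟨hA j g hg, hx⟩)
  · have hmem : (m.symm (c g)).1 ∈ B j ∧ (m.symm (c g)).2 ∈ B j := by
      rw [← hm, Homeomorph.apply_symm_apply]
      exact hA j g hg
    exact ⟨Φ.symm g, ⟨hA₂ j _ (hA₁ j g hg _ (hA j g hg)) _ hmem.1, hmem.2⟩,
      Φ.apply_symm_apply g⟩

/-- Two sequences are merged into one. -/
def mergeSeq : SeqS × SeqS ≃ₜ SeqS where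
  toFun p i := Sum.elim p.1 p.2 (Equiv.natSumNatEquivNat.symm i)
  invFun z := (fun i => z (Equiv.natSumNatEquivNat (Sum.inl i)),
    fun i => z (Equiv.natSumNatEquivNat (Sum.inr i)))
  left_inv p := by simp
  right_inv z := by
    funext i
    obtain ⟨j, rfl⟩ := Equiv.natSumNatEquivNat.surjective i
    rcases j with j | j <;> simp
  continuous_toFun := by
    refine continuous_pi fun i => ?_
    rcases Equiv.natSumNatEquivNat.symm i with j | j
    · exact (continuous_apply j).comp continuous_fst
    · exact (continuous_apply j).comp continuous_snd
  continuous_invFun := by fun_prop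

lemma mergeSeq_inl (p : SeqS × SeqS) (i : ℕ) :
    mergeSeq p (Equiv.natSumNatEquivNat (Sum.inl i)) = p.1 i := by
  change Sum.elim p.1 p.2 (Equiv.natSumNatEquivNat.symm _) = _
  rw [Equiv.symm_apply_apply, Sum.elim_inl]

lemma mergeSeq_inr (p : SeqS × SeqS) (i : ℕ) :
    mergeSeq p (Equiv.natSumNatEquivNat (Sum.inr i)) = p.2 i := by
  change Sum.elim p.1 p.2 (Equiv.natSumNatEquivNat.symm _) = _
  rw [Equiv.symm_apply_apply, Sum.elim_inr]

lemma forall_mergeSeq {P : ℝ → Prop} (p : SeqS × SeqS) :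
    (∀ i, P (mergeSeq p i)) ↔ (∀ i, P (p.1 i)) ∧ ∀ i, P (p.2 i) := by
  rw [← Equiv.natSumNatEquivNat.forall_congr_right (q := fun i => P (mergeSeq p i)), Sum.forall]
  simp only [mergeSeq_inl, mergeSeq_inr]

lemma mergeSeq_mem_bigSigma (p : SeqS × SeqS) :
    mergeSeq p ∈ bigSigma ↔ p.1 ∈ bigSigma ∧ p.2 ∈ bigSigma := by
  constructor
  · rintro ⟨C, hC⟩
    have := (forall_mergeSeq (P := fun r => |r| ≤ C) p).1 hC
    exact ⟨⟨C, this.1⟩, C, this.2⟩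
  · rintro ⟨⟨C, hC⟩, C', hC'⟩
    exact ⟨max C C', (forall_mergeSeq (P := fun r => |r| ≤ max C C') p).2
      ⟨fun i => (hC i).trans (le_max_left _ _), fun i => (hC' i).trans (le_max_right _ _)⟩⟩

lemma mergeSeq_mem_smallSigma (p : SeqS × SeqS) :
    mergeSeq p ∈ smallSigma ↔ p.1 ∈ smallSigma ∧ p.2 ∈ smallSigma := by
  have : {i | mergeSeq p i ≠ 0} =
      Equiv.natSumNatEquivNat '' (Sum.inl '' {i | p.1 i ≠ 0} ∪ Sum.inr '' {i | p.2 i ≠ 0}) := by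
    ext i
    obtain ⟨j, rfl⟩ := Equiv.natSumNatEquivNat.surjective i
    rw [Equiv.natSumNatEquivNat.injective.mem_set_image, mem_ofPred_eq]
    rcases j with j | j
    · rw [mergeSeq_inl]; simp
    · rw [mergeSeq_inr]; simp
  simp only [smallSigma, mem_ofPred_eq]
  rw [this, finite_image_iff Equiv.natSumNatEquivNat.injective.injOn, finite_union,
    finite_image_iff Sum.inl_injective.injOn, finite_image_iff Sum.inr_injective.injOn]

lemma mergeSeq_eq_zero (p : SeqS × SeqS) : mergeSeq p = 0 ↔ p.1 = 0 ∧ p.2 = 0 := by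
  simp only [funext_iff, Pi.zero_apply]
  exact forall_mergeSeq (P := fun r => r = 0) p

/-- Two double sequences are merged into one, row by row. -/
def mergeSeqInf : SeqSInf × SeqSInf ≃ₜ SeqSInf where
  toFun p k := mergeSeq (p.1 k, p.2 k)
  invFun z := (fun k => (mergeSeq.symm (z k)).1, fun k => (mergeSeq.symm (z k)).2)
  left_inv p := by simp
  right_inv z := by simp
  continuous_toFun := by
    refine continuous_pi fun k => mergeSeq.continuous.comp ?_
    exact ((continuous_apply k).comp continuous_fst).prodMk
      ((continuous_apply k).comp continuous_snd)
  continuous_invFun := by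
    refine (continuous_pi fun k => ?_).prodMk (continuous_pi fun k => ?_)
    · exact continuous_fst.comp (mergeSeq.symm.continuous.comp (continuous_apply k))
    · exact continuous_snd.comp (mergeSeq.symm.continuous.comp (continuous_apply k))

lemma mergeSeqInf_mem_bigSigmaInf (p : SeqSInf × SeqSInf) :
    mergeSeqInf p ∈ bigSigmaInf ↔ p.1 ∈ bigSigmaInf ∧ p.2 ∈ bigSigmaInf := by
  simp only [bigSigmaInf, mem_ofPred_eq, ← forall_and]
  exact forall_congr' fun k => mergeSeq_mem_bigSigma _

lemma mergeSeqInf_mem_smallSigmaInf (p : SeqSInf × SeqSInf) :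
    mergeSeqInf p ∈ smallSigmaInf ↔ p.1 ∈ smallSigmaInf ∧ p.2 ∈ smallSigmaInf := by
  simp only [smallSigmaInf, mem_ofPred_eq, ← forall_and]
  exact forall_congr' fun k => mergeSeq_mem_smallSigma _

lemma finite_mergeSeqInf_ne_zero (p : SeqSInf × SeqSInf) :
    {k | mergeSeqInf p k ≠ 0}.Finite ↔ {k | p.1 k ≠ 0}.Finite ∧ {k | p.2 k ≠ 0}.Finite := by
  rw [← finite_union]
  have : {k | mergeSeqInf p k ≠ 0} = {k | p.1 k ≠ 0} ∪ {k | p.2 k ≠ 0} := by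
    ext k
    have := mergeSeq_eq_zero (p.1 k, p.2 k)
    simp only [mem_ofPred_eq, mem_union, ne_eq]
    rw [show mergeSeqInf p k = mergeSeq (p.1 k, p.2 k) from rfl, this]
    tauto
  rw [this]

lemma mergeSeqInf_mem_bigSigmaInfFin (p : SeqSInf × SeqSInf) :
    mergeSeqInf p ∈ bigSigmaInfFin ↔ p.1 ∈ bigSigmaInfFin ∧ p.2 ∈ bigSigmaInfFin := by
  simp only [bigSigmaInfFin, mem_ofPred_eq, mergeSeqInf_mem_bigSigmaInf, finite_mergeSeqInf_ne_zero]
  tauto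

lemma mergeSeqInf_mem_smallSigmaInfFin (p : SeqSInf × SeqSInf) :
    mergeSeqInf p ∈ smallSigmaInfFin ↔ p.1 ∈ smallSigmaInfFin ∧ p.2 ∈ smallSigmaInfFin := by
  simp only [smallSigmaInfFin, mem_ofPred_eq, mergeSeqInf_mem_smallSigmaInf,
    finite_mergeSeqInf_ne_zero]
  tauto

lemma mergeSeqInf_mem_seqSInfBdd (p : SeqSInf × SeqSInf) :
    mergeSeqInf p ∈ seqSInfBdd ↔ p.1 ∈ seqSInfBdd ∧ p.2 ∈ seqSInfBdd := by
  constructor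
  · rintro ⟨C, hC⟩
    have := fun k => (forall_mergeSeq (P := fun r => |r| ≤ C) (p.1 k, p.2 k)).1 (hC k)
    exact ⟨⟨C, fun k => (this k).1⟩, C, fun k => (this k).2⟩
  · rintro ⟨⟨C, hC⟩, C', hC'⟩
    exact ⟨max C C', fun k => (forall_mergeSeq (P := fun r => |r| ≤ max C C') (p.1 k, p.2 k)).2
      ⟨fun i => (hC k i).trans (le_max_left _ _), fun i => (hC' k i).trans (le_max_right _ _)⟩⟩

end TupleStable

/-! ### Slider families -/

section Slider

open Set

/-- A family of arcs with disjoint small neighbourhoods `D i`, and homeomorphisms supported in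
`D i` which slide the midpoint of the `i`-th arc along the arc. -/
structure SliderFamily (M : Type*) [MetricSpace M] (ι : Type*) where
  D : ι → Set M
  isCompact_D : ∀ i, IsCompact (D i)
  disjoint_D : Pairwise (Function.onFun Disjoint D)
  isLocallyNull_D : IsLocallyNull D
  arc : ι → ℝ → M
  continuous_arc : ∀ i, Continuous (arc i)
  injOn_arc : ∀ i, InjOn (arc i) (Icc (-1) 1)
  arc_mem : ∀ i x, arc i x ∈ D i
  slide : ι → Ioo (-1 : ℝ) 1 → M ≃ₜ M
  continuous_slide : ∀ i, Continuous fun q : Ioo (-1 : ℝ) 1 × M => slide i q.1 q.2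
  continuous_slide_symm : ∀ i, Continuous fun q : Ioo (-1 : ℝ) 1 × M => (slide i q.1).symm q.2
  slide_of_notMem : ∀ i τ x, x ∉ D i → slide i τ x = x
  slide_zero : ∀ i x, slide i ⟨0, by norm_num⟩ x = x
  image_left : ∀ i τ, slide i τ '' (arc i '' uIcc (-1) 0) = arc i '' uIcc (-1) (τ : ℝ)
  image_right : ∀ i τ, slide i τ '' (arc i '' uIcc 0 1) = arc i '' uIcc (τ : ℝ) 1

namespace SliderFamily

variable {M : Type*} [MetricSpace M] {ι : Type*} (S : SliderFamily M ι)

lemma slide_mem (i : ι) (τ : Ioo (-1 : ℝ) 1) {x : M} (hx : x ∈ S.D i) :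
    S.slide i τ x ∈ S.D i := by
  by_contra h
  have h' := S.slide_of_notMem i τ _ h
  rw [(S.slide i τ).injective h'] at h
  exact h hx

lemma slide_symm_of_notMem (i : ι) (τ : Ioo (-1 : ℝ) 1) {x : M} (hx : x ∉ S.D i) :
    (S.slide i τ).symm x = x := by
  rw [Homeomorph.symm_apply_eq, S.slide_of_notMem i τ x hx]

lemma slide_symm_mem (i : ι) (τ : Ioo (-1 : ℝ) 1) {x : M} (hx : x ∈ S.D i) :
    (S.slide i τ).symm x ∈ S.D i := by
  by_contra h
  have h' := S.slide_of_notMem i τ _ h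
  rw [Homeomorph.apply_symm_apply] at h'
  exact h (h' ▸ hx)

lemma isClosed_D (i : ι) : IsClosed (S.D i) := (S.isCompact_D i).isClosed

lemma continuous_glue : Continuous fun q : (ι → Ioo (-1 : ℝ) 1) × M =>
    glueMap S.D (fun i => S.slide i (q.1 i)) q.2 :=
  continuous_glueMap (g := fun i (t : ι → Ioo (-1 : ℝ) 1) => S.slide i (t i))
    S.disjoint_D S.isClosed_D S.isLocallyNull_D
    (fun i => (S.continuous_slide i).comp (f := fun q : (ι → Ioo (-1 : ℝ) 1) × M =>
      (q.1 i, q.2)) (by fun_prop))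
    (fun i _ _ hx => S.slide_of_notMem i _ _ hx) fun i _ _ hx => S.slide_mem i _ hx

lemma continuous_glue_symm : Continuous fun q : (ι → Ioo (-1 : ℝ) 1) × M =>
    glueMap S.D (fun i => (S.slide i (q.1 i)).symm) q.2 :=
  continuous_glueMap (g := fun i (t : ι → Ioo (-1 : ℝ) 1) => (S.slide i (t i)).symm)
    S.disjoint_D S.isClosed_D S.isLocallyNull_D
    (fun i => (S.continuous_slide_symm i).comp (f := fun q : (ι → Ioo (-1 : ℝ) 1) × M =>
      (q.1 i, q.2)) (by fun_prop))
    (fun i _ _ hx => S.slide_symm_of_notMem i _ hx) fun i _ _ hx => S.slide_symm_mem i _ hx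

/-- The homeomorphism that slides all the arcs simultaneously. -/
def glue (τ : ι → Ioo (-1 : ℝ) 1) : M ≃ₜ M where
  toFun := glueMap S.D fun i => S.slide i (τ i)
  invFun := glueMap S.D fun i => (S.slide i (τ i)).symm
  left_inv x := by
    by_cases h : ∃ i, x ∈ S.D i
    · obtain ⟨i, hi⟩ := h
      rw [glueMap_of_mem S.disjoint_D _ hi, glueMap_of_mem S.disjoint_D _ (S.slide_mem i _ hi)]
      simp
    · push Not at h
      rw [glueMap_of_notMem (fun i => S.slide i (τ i)) h, glueMap_of_notMem _ h]
  right_inv x := by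
    by_cases h : ∃ i, x ∈ S.D i
    · obtain ⟨i, hi⟩ := h
      rw [glueMap_of_mem S.disjoint_D _ hi,
        glueMap_of_mem S.disjoint_D _ (S.slide_symm_mem i _ hi)]
      simp
    · push Not at h
      rw [glueMap_of_notMem (fun i => (S.slide i (τ i)).symm) h, glueMap_of_notMem _ h]
  continuous_toFun := S.continuous_glue.comp (Continuous.prodMk_right τ)
  continuous_invFun := S.continuous_glue_symm.comp (Continuous.prodMk_right τ)

lemma glue_of_mem (τ : ι → Ioo (-1 : ℝ) 1) {i : ι} {x : M} (hx : x ∈ S.D i) :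
    S.glue τ x = S.slide i (τ i) x :=
  glueMap_of_mem S.disjoint_D (fun i => S.slide i (τ i)) hx

lemma glue_of_notMem (τ : ι → Ioo (-1 : ℝ) 1) {x : M} (hx : ∀ i, x ∉ S.D i) :
    S.glue τ x = x :=
  glueMap_of_notMem (fun i => S.slide i (τ i)) hx

lemma glue_image_left (τ : ι → Ioo (-1 : ℝ) 1) (i : ι) :
    S.glue τ '' (S.arc i '' uIcc (-1) 0) = S.arc i '' uIcc (-1) (τ i : ℝ) := by
  rw [← S.image_left i (τ i)]
  refine image_congr ?_
  rintro _ ⟨s, -, rfl⟩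
  exact S.glue_of_mem τ (S.arc_mem i s)

lemma glue_image_right (τ : ι → Ioo (-1 : ℝ) 1) (i : ι) :
    S.glue τ '' (S.arc i '' uIcc 0 1) = S.arc i '' uIcc (τ i : ℝ) 1 := by
  rw [← S.image_right i (τ i)]
  refine image_congr ?_
  rintro _ ⟨s, -, rfl⟩
  exact S.glue_of_mem τ (S.arc_mem i s)

variable {X : Set M} (hX : ∀ i, Disjoint (S.D i) X)

include hX in
lemma glue_fix (τ : ι → Ioo (-1 : ℝ) 1) {x : M} (hx : x ∈ X) : S.glue τ x = x :=
  S.glue_of_notMem τ fun i hi => disjoint_left.1 (hX i) hi hx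

/-- `h` precomposed with the sliding homeomorphism. -/
def twist (h : HomeoFix M X) (τ : ι → Ioo (-1 : ℝ) 1) : HomeoFix M X :=
  ⟨(S.glue τ).trans h.1, fun x hx => by
    rw [Homeomorph.trans_apply, S.glue_fix hX τ hx, h.2 x hx]⟩

/-- `h` precomposed with the inverse of the sliding homeomorphism. -/
def untwist (h : HomeoFix M X) (τ : ι → Ioo (-1 : ℝ) 1) : HomeoFix M X :=
  ⟨(S.glue τ).symm.trans h.1, fun x hx => by
    rw [Homeomorph.trans_apply, (S.glue τ).symm_apply_eq.2 (S.glue_fix hX τ hx).symm, h.2 x hx]⟩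

lemma twist_val (h : HomeoFix M X) (τ : ι → Ioo (-1 : ℝ) 1) :
    (S.twist hX h τ).1 = (S.glue τ).trans h.1 := rfl

lemma untwist_val (h : HomeoFix M X) (τ : ι → Ioo (-1 : ℝ) 1) :
    (S.untwist hX h τ).1 = (S.glue τ).symm.trans h.1 := rfl

lemma untwist_twist (h : HomeoFix M X) (τ : ι → Ioo (-1 : ℝ) 1) :
    S.untwist hX (S.twist hX h τ) τ = h :=
  Subtype.ext (Homeomorph.ext fun x => by simp [untwist_val, twist_val])

lemma twist_untwist (h : HomeoFix M X) (τ : ι → Ioo (-1 : ℝ) 1) :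
    S.twist hX (S.untwist hX h τ) τ = h :=
  Subtype.ext (Homeomorph.ext fun x => by simp [untwist_val, twist_val])

omit S in
lemma continuous_homeoFix_val : Continuous fun h : HomeoFix M X => (h.1 : C(M, M)) :=
  continuous_induced_dom

omit S in
lemma continuous_homeoFix_eval [LocallyCompactSpace M] {T : Type*} [TopologicalSpace T]
    {h : T → HomeoFix M X} (hh : Continuous h) {x : T → M} (hx : Continuous x) :
    Continuous fun t => (h t).1 (x t) :=
  (continuous_homeoFix_val.comp hh).eval hx

/-- Continuity into the compact-open topology follows from that of the uncurried map; local
compactness of `M` makes evaluation jointly continuous. -/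
lemma continuous_twist [LocallyCompactSpace M] :
    Continuous fun q : HomeoFix M X × (ι → Ioo (-1 : ℝ) 1) => S.twist hX q.1 q.2 := by
  refine continuous_induced_rng.2 (ContinuousMap.continuous_of_continuous_uncurry _ ?_)
  exact continuous_homeoFix_eval (continuous_fst.comp continuous_fst)
    (S.continuous_glue.comp ((continuous_snd.comp continuous_fst).prodMk continuous_snd))

lemma continuous_untwist [LocallyCompactSpace M] :
    Continuous fun q : HomeoFix M X × (ι → Ioo (-1 : ℝ) 1) => S.untwist hX q.1 q.2 := by
  refine continuous_induced_rng.2 (ContinuousMap.continuous_of_continuous_uncurry _ ?_)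
  exact continuous_homeoFix_eval (continuous_fst.comp continuous_fst)
    (S.continuous_glue_symm.comp ((continuous_snd.comp continuous_fst).prodMk continuous_snd))

variable {Z : Type*} [MetricSpace Z] {ψ : M → Z} (hψ : Continuous ψ) (hψi : Function.Injective ψ)

variable (ψ) in
/-- The `i`-th coordinate of `h`: the point where the image of the `i`-th arc is balanced. -/
def coord (h : M ≃ₜ M) (i : ι) : Ioo (-1 : ℝ) 1 :=
  balancePt (segSize (fun x => ψ (S.arc i x)) (-1) 0) (segSize (fun x => ψ (S.arc i x)) 0 1)
    fun x => ψ (h (S.arc i x))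

include hψ in
lemma continuous_image_arc (h : M ≃ₜ M) (i : ι) : Continuous fun x => ψ (h (S.arc i x)) :=
  hψ.comp (h.continuous.comp (S.continuous_arc i))

omit [MetricSpace Z] in
include hψi in
lemma injOn_image_arc (h : M ≃ₜ M) (i : ι) : InjOn (fun x => ψ (h (S.arc i x))) (Icc (-1) 1) :=
  fun _ hx _ hy he => S.injOn_arc i hx hy (h.injective (hψi he))

include hψ hψi

lemma segSize_left_pos (i : ι) : 0 < segSize (fun x => ψ (S.arc i x)) (-1) 0 :=
  (segSize_self (fun x => ψ (S.arc i x)) (-1)).symm.trans_lt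
    (segSize_left_lt (S.continuous_image_arc hψ (Homeomorph.refl M) i)
      (S.injOn_image_arc hψi (Homeomorph.refl M) i) le_rfl (by norm_num) (by norm_num))

lemma segSize_right_pos (i : ι) : 0 < segSize (fun x => ψ (S.arc i x)) 0 1 :=
  (segSize_self (fun x => ψ (S.arc i x)) 1).symm.trans_lt
    (segSize_right_lt (S.continuous_image_arc hψ (Homeomorph.refl M) i)
      (S.injOn_image_arc hψi (Homeomorph.refl M) i) (by norm_num) (by norm_num) le_rfl)

lemma coord_eq_iff (h : M ≃ₜ M) (i : ι) (x : Ioo (-1 : ℝ) 1) :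
    S.coord ψ h i = x ↔
      segSize (fun x => ψ (S.arc i x)) 0 1 * segSize (fun x => ψ (h (S.arc i x))) (-1) x =
      segSize (fun x => ψ (S.arc i x)) (-1) 0 * segSize (fun x => ψ (h (S.arc i x))) x 1 := by
  rw [← sub_eq_zero (b := _ * _)]
  constructor
  · rintro rfl
    exact imbalance_balancePt (S.segSize_left_pos hψ hψi i) (S.segSize_right_pos hψ hψi i)
      (S.continuous_image_arc hψ h i) (S.injOn_image_arc hψi h i)
  · exact balancePt_eq (S.segSize_left_pos hψ hψi i) (S.segSize_right_pos hψ hψi i)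
      (S.continuous_image_arc hψ h i) (S.injOn_image_arc hψi h i)

/-- Both sides express the same balance equation: the halves of the arc are carried by `glue τ` onto
the pieces cut off at `τ i`. -/
lemma coord_glue_trans_eq_zero_iff (h : M ≃ₜ M) (τ : ι → Ioo (-1 : ℝ) 1) (i : ι) :
    S.coord ψ ((S.glue τ).trans h) i = ⟨0, by norm_num⟩ ↔ S.coord ψ h i = τ i := by
  rw [S.coord_eq_iff hψ hψi, S.coord_eq_iff hψ hψi]
  have e1 : segSize (fun x => ψ ((S.glue τ).trans h (S.arc i x))) (-1) 0 =
      segSize (fun x => ψ (h (S.arc i x))) (-1) (τ i) := by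
    have := congrArg (fun A => packSize (ψ '' (h '' A))) (S.glue_image_left τ i)
    simpa only [image_image, segSize, Homeomorph.trans_apply] using this
  have e2 : segSize (fun x => ψ ((S.glue τ).trans h (S.arc i x))) 0 1 =
      segSize (fun x => ψ (h (S.arc i x))) (τ i) 1 := by
    have := congrArg (fun A => packSize (ψ '' (h '' A))) (S.glue_image_right τ i)
    simpa only [image_image, segSize, Homeomorph.trans_apply] using this
  rw [e1, e2]

/-- The weights in `coord` are the sizes of the two halves of the unmoved arc, chosen so that the
identity is balanced at 0. -/
lemma coord_eq_zero_of_eqOn {h : M ≃ₜ M} {i : ι} (hi : ∀ x ∈ S.D i, h x = x) :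
    S.coord ψ h i = ⟨0, by norm_num⟩ := by
  rw [S.coord_eq_iff hψ hψi]
  simp only [hi _ (S.arc_mem i _)]
  exact mul_comm _ _

lemma continuous_coord [LocallyCompactSpace M] :
    Continuous fun h : HomeoFix M X => S.coord ψ h.1 := by
  refine continuous_pi fun i => ?_
  refine continuous_balancePt (h := fun (h : HomeoFix M X) x => ψ (h.1 (S.arc i x)))
    (S.segSize_left_pos hψ hψi i) (S.segSize_right_pos hψ hψi i) ?_
    fun h => S.injOn_image_arc hψi h.1 i
  exact hψ.comp (continuous_homeoFix_eval continuous_fst ((S.continuous_arc i).comp continuous_snd))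

include hX in
/-- The stability criterion: the subsets `A j` have to be compatible with the coordinates and with
the sliding homeomorphisms. -/
theorem isTupleStable [LocallyCompactSpace M] {E : Type*} [TopologicalSpace E] {l : ℕ}
    {A : Fin l → Set (HomeoFix M X)} {B : Fin l → Set E} (σ : (ι → Ioo (-1 : ℝ) 1) ≃ₜ E)
    (m : E × E ≃ₜ E) (hm : ∀ j p, m p ∈ B j ↔ p.1 ∈ B j ∧ p.2 ∈ B j)
    (hA : ∀ j, ∀ h ∈ A j, σ (S.coord ψ h.1) ∈ B j)
    (hA₁ : ∀ j, ∀ τ, σ τ ∈ B j → ∀ h ∈ A j, S.twist hX h τ ∈ A j)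
    (hA₂ : ∀ j, ∀ τ, σ τ ∈ B j → ∀ h ∈ A j, S.untwist hX h τ ∈ A j) :
    IsTupleStable (HomeoFix M X) E A B := by
  refine isTupleStable_of_coord (c := fun h => σ (S.coord ψ h.1))
    (tw := fun h t => S.twist hX h (σ.symm t)) (un := fun h t => S.untwist hX h (σ.symm t))
    (e₀ := σ fun _ => ⟨0, by norm_num⟩) (σ.continuous.comp (S.continuous_coord hψ hψi))
    ((S.continuous_twist hX).comp
      (continuous_fst.prodMk (σ.symm.continuous.comp continuous_snd)))
    ((S.continuous_untwist hX).comp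
      (continuous_fst.prodMk (σ.symm.continuous.comp continuous_snd)))
    (fun h t => S.untwist_twist hX _ _) (fun h t => S.twist_untwist hX _ _) ?_ ?_ m hm hA
    (fun j h hh t ht => hA₁ j _ (by simpa using ht) h hh)
    (fun j h hh t ht => hA₂ j _ (by simpa using ht) h hh)
  · intro h
    refine congrArg σ (funext fun i => ?_)
    rw [twist_val, S.coord_glue_trans_eq_zero_iff hψ hψi, Homeomorph.symm_apply_apply]
  · intro h t ht
    rw [← σ.eq_symm_apply]
    refine funext fun i => ?_
    have h0 := congrFun (σ.injective ht) i
    rw [← S.twist_untwist hX h (σ.symm t), twist_val, S.coord_glue_trans_eq_zero_iff hψ hψi] at h0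
    exact h0

end SliderFamily

end Slider

/-! ### Slider families organised in cells -/

section CellSliders

open Set

/-- A slider family indexed by `κ × ℕ`: for each `c` the neighbourhoods `D (c, i)` shrink to a
point, locally only finitely many `c` occur, and there are uniform Lipschitz estimates. -/
structure CellSliders (M : Type*) [MetricSpace M] (κ : Type*) extends SliderFamily M (κ × ℕ) where
  locallyFinite : LocallyFinite fun c : κ => ⋃ i, D (c, i)
  exists_compact : ∀ c, ∃ K, IsCompact K ∧ ∀ i, D (c, i) ⊆ K
  pt : κ → M
  eventually_subset : ∀ c, ∀ U ∈ 𝓝 (pt c), ∀ᶠ i in Filter.atTop, D (c, i) ⊆ U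
  bilip : ℝ
  arc_bilip : ∀ i, ∃ R > 0, ∀ x ∈ Icc (-1 : ℝ) 1, ∀ y ∈ Icc (-1 : ℝ) 1,
    dist (arc i x) (arc i y) ≤ bilip * (R * |x - y|) ∧
      R * |x - y| ≤ bilip * dist (arc i x) (arc i y)
  slide_lip : ∀ δ < 1, ∃ L, 1 ≤ L ∧ ∀ i, ∀ τ : Ioo (-1 : ℝ) 1, |(τ : ℝ)| ≤ δ → ∀ x y,
    dist (slide i τ x) (slide i τ y) ≤ L * dist x y ∧
      dist ((slide i τ).symm x) ((slide i τ).symm y) ≤ L * dist x y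

/-- Locally finitely many cells matter, and in each of them all but finitely many pieces lie in the
ball of radius `ε / 2` about the base point. -/
lemma isLocallyNull_of_eventually_subset {M κ : Type*} [MetricSpace M] {D : κ × ℕ → Set M}
    (h₁ : LocallyFinite fun c : κ => ⋃ i, D (c, i)) {p : κ → M}
    (h₂ : ∀ c, ∀ U ∈ 𝓝 (p c), ∀ᶠ i in Filter.atTop, D (c, i) ⊆ U) : IsLocallyNull D := by
  intro x ε hε
  obtain ⟨U, hU, hfin⟩ := h₁ x
  refine ⟨U, hU, ?_⟩
  have h3 : ∀ c, {i | ¬ D (c, i) ⊆ Metric.ball (p c) (ε / 2)}.Finite := fun c => by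
    have := h₂ c _ (Metric.ball_mem_nhds _ (by positivity : 0 < ε / 2))
    rwa [← Nat.cofinite_eq_atTop] at this
  refine (hfin.biUnion fun c _ => (h3 c).image (Prod.mk c)).subset ?_
  rintro ⟨c, i⟩ ⟨hne, y, hy, z, hz, hyz⟩
  simp only [mem_iUnion]
  refine ⟨c, hne.mono (inter_subset_inter_left _ (subset_iUnion (fun i => D (c, i)) i)), i,
    fun hsub => ?_, rfl⟩
  have h1 := hsub hy
  have h2 := hsub hz
  rw [Metric.mem_ball] at h1 h2
  linarith [dist_triangle_right y z (p c)]

lemma exists_bound_of_eventually {f : ℕ → ℝ} (hf : ∀ i, f i < 1) {δ : ℝ} (hδ : δ < 1)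
    (h : ∀ᶠ i in Filter.atTop, f i ≤ δ) : ∃ δ < 1, ∀ i, f i ≤ δ := by
  obtain ⟨N, hN⟩ := Filter.eventually_atTop.1 h
  have : ∀ n, ∃ δ' < 1, δ ≤ δ' ∧ ∀ i < n, f i ≤ δ' := by
    intro n
    induction n with
    | zero => exact ⟨δ, hδ, le_rfl, by simp⟩
    | succ n ih =>
      obtain ⟨δ', h1, h2, h3⟩ := ih
      refine ⟨max δ' (f n), max_lt h1 (hf n), h2.trans (le_max_left _ _), fun i hi => ?_⟩
      rcases Nat.lt_succ_iff_lt_or_eq.1 hi with hi | rfl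
      · exact (h3 i hi).trans (le_max_left _ _)
      · exact le_max_right _ _
  obtain ⟨δ', h1, h2, h3⟩ := this N
  refine ⟨δ', h1, fun i => ?_⟩
  rcases lt_or_ge i N with hi | hi
  · exact h3 i hi
  · exact (hN i hi).trans h2

namespace CellSliders

variable {M : Type*} [MetricSpace M] {κ : Type*} (S : CellSliders M κ)

/-- The sliding parameters of the cells in `I` stay away from the ends. -/
def TameOn (I : Set κ) (τ : κ × ℕ → Ioo (-1 : ℝ) 1) : Prop :=
  ∃ δ < 1, ∀ c ∈ I, ∀ i, |(τ (c, i) : ℝ)| ≤ δ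

lemma tameOn_of_finite {I : Set κ} (hI : I.Finite) {τ : κ × ℕ → Ioo (-1 : ℝ) 1}
    (h : ∀ c ∈ I, TameOn {c} τ) : TameOn I τ := by
  choose! δ hδ hδ' using h
  rcases I.eq_empty_or_nonempty with rfl | hne
  · exact ⟨0, by norm_num, by simp⟩
  obtain ⟨c₀, hc₀, hmax⟩ := hI.exists_maximalFor δ I hne
  refine ⟨δ c₀, hδ c₀ hc₀, fun c hc i => (hδ' c hc c rfl i).trans ?_⟩
  rcases le_total (δ c) (δ c₀) with h | h
  · exact h
  · exact hmax hc h

/-- All slides that act on points of `U` belong to cells in `I` and share one Lipschitz constant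
`L`; `dist_glueMap_le` squares it. -/
lemma lipschitzOnWith_glue {τ : κ × ℕ → Ioo (-1 : ℝ) 1} {I : Set κ} (hτ : TameOn I τ) {U : Set M}
    (hU : ∀ c i, (S.D (c, i) ∩ U).Nonempty → c ∈ I) :
    ∃ C, LipschitzOnWith C (S.glue τ) U ∧ LipschitzOnWith C (S.glue τ).symm U := by
  obtain ⟨δ, hδ, hτ⟩ := hτ
  obtain ⟨L, hL, hlip⟩ := S.slide_lip δ hδ
  refine ⟨⟨L * L, by positivity⟩, LipschitzOnWith.of_dist_le_mul fun x hx y hy => ?_,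
    LipschitzOnWith.of_dist_le_mul fun x hx y hy => ?_⟩
  all_goals
    have hI : ∀ i : κ × ℕ, x ∈ S.D i ∨ y ∈ S.D i → i.1 ∈ I := by
      rintro ⟨c, i⟩ (h | h)
      exacts [hU c i ⟨x, h, hx⟩, hU c i ⟨y, h, hy⟩]
  · exact dist_glueMap_le S.disjoint_D (g := fun i => S.slide i (τ i))
      (fun i x hx => S.slide_of_notMem i _ x hx) (fun i x hx => S.slide_mem i _ hx) hL
      fun i hi a b => (hlip i _ (hτ _ (hI i hi) _) a b).1
  · exact dist_glueMap_le S.disjoint_D (g := fun i => (S.slide i (τ i)).symm)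
      (fun i x hx => S.slide_symm_of_notMem i _ hx) (fun i x hx => S.slide_symm_mem i _ hx) hL
      fun i hi a b => (hlip i _ (hτ _ (hI i hi) _) a b).2

lemma lipschitzWith_glue {τ : κ × ℕ → Ioo (-1 : ℝ) 1} (hτ : TameOn univ τ) :
    ∃ C, LipschitzWith C (S.glue τ) ∧ LipschitzWith C (S.glue τ).symm := by
  obtain ⟨C, h⟩ := S.lipschitzOnWith_glue hτ (U := univ) fun _ _ _ => mem_univ _
  exact ⟨C, by simpa only [lipschitzOnWith_univ] using h⟩

lemma locallyLipschitz_glue {τ : κ × ℕ → Ioo (-1 : ℝ) 1} (hτ : ∀ c, TameOn {c} τ) :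
    LocallyLipschitz (S.glue τ) ∧ LocallyLipschitz (S.glue τ).symm := by
  have key : ∀ x, ∃ C, ∃ U ∈ 𝓝 x, LipschitzOnWith C (S.glue τ) U ∧
      LipschitzOnWith C (S.glue τ).symm U := by
    intro x
    obtain ⟨U, hU, hfin⟩ := S.locallyFinite x
    obtain ⟨C, hC⟩ := S.lipschitzOnWith_glue (tameOn_of_finite hfin fun c _ => hτ c) (U := U)
      fun c i hne => hne.mono
        (inter_subset_inter_left _ (subset_iUnion (fun i => S.D (c, i)) i))
    exact ⟨C, U, hU, hC⟩
  constructor <;> intro x <;> obtain ⟨C, U, hU, h₁, h₂⟩ := key x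
  exacts [⟨C, U, hU, h₁⟩, ⟨C, U, hU, h₂⟩]

variable {X : Set M} (hX : ∀ i, Disjoint (S.D i) X)

lemma twist_mem_locLIP {τ : κ × ℕ → Ioo (-1 : ℝ) 1} (hτ : ∀ c, TameOn {c} τ)
    {h : HomeoFix M X} (hh : h ∈ HomeoFix.locLIP M X) :
    S.twist hX h τ ∈ HomeoFix.locLIP M X ∧ S.untwist hX h τ ∈ HomeoFix.locLIP M X := by
  have hg := S.locallyLipschitz_glue hτ
  exact ⟨⟨hh.1.comp hg.1, hg.2.comp hh.2⟩, ⟨hh.1.comp hg.2, hg.1.comp hh.2⟩⟩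

lemma twist_mem_LIP {τ : κ × ℕ → Ioo (-1 : ℝ) 1} (hτ : TameOn univ τ)
    {h : HomeoFix M X} (hh : h ∈ HomeoFix.LIP M X) :
    S.twist hX h τ ∈ HomeoFix.LIP M X ∧ S.untwist hX h τ ∈ HomeoFix.LIP M X := by
  obtain ⟨C, hg₁, hg₂⟩ := S.lipschitzWith_glue hτ
  obtain ⟨⟨C₁, h₁⟩, C₂, h₂⟩ := hh
  exact ⟨⟨⟨_, h₁.comp hg₁⟩, _, hg₂.comp h₂⟩, ⟨⟨_, h₁.comp hg₂⟩, _, hg₁.comp h₂⟩⟩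

/-- Slides with parameter 0 are the identity, so `glue τ` moves points only in the compact hulls of
the finitely many cells in `I`. -/
lemma twist_mem_compactSupp {τ : κ × ℕ → Ioo (-1 : ℝ) 1} {I : Set κ} (hI : I.Finite)
    (hτ : ∀ c ∉ I, ∀ i, (τ (c, i) : ℝ) = 0) {h : HomeoFix M X}
    (hh : h ∈ HomeoFix.compactSupp M X) :
    S.twist hX h τ ∈ HomeoFix.compactSupp M X ∧ S.untwist hX h τ ∈ HomeoFix.compactSupp M X := by
  choose K hK hDK using S.exists_compact
  have hKc : IsCompact (⋃ c ∈ I, K c) := hI.isCompact_biUnion fun c _ => hK c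
  have hgl : ∀ x ∉ ⋃ c ∈ I, K c, S.glue τ x = x := by
    intro x hx
    by_cases hxD : ∃ i, x ∈ S.D i
    · obtain ⟨⟨c, i⟩, hi⟩ := hxD
      rw [S.glue_of_mem τ hi]
      by_cases hc : c ∈ I
      · exact absurd (mem_biUnion hc (hDK c i hi)) hx
      · rw [show τ (c, i) = ⟨0, by norm_num⟩ from Subtype.ext (hτ c hc i), S.slide_zero]
    · exact S.glue_of_notMem τ (by simpa using hxD)
  have hgl' : ∀ x ∉ ⋃ c ∈ I, K c, (S.glue τ).symm x = x := fun x hx =>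
    (S.glue τ).symm_apply_eq.2 (hgl x hx).symm
  have hc : IsCompact (closure {x | h.1 x ≠ x} ∪ ⋃ c ∈ I, K c) := IsCompact.union hh hKc
  constructor
  · refine hc.of_isClosed_subset isClosed_closure (closure_minimal (fun x hx => ?_) hc.isClosed)
    by_contra hn
    simp only [mem_union, not_or] at hn
    refine hx ?_
    rw [S.twist_val, Homeomorph.trans_apply, hgl x hn.2]
    exact not_not.1 fun h' => hn.1 (subset_closure h')
  · refine hc.of_isClosed_subset isClosed_closure (closure_minimal (fun x hx => ?_) hc.isClosed)
    by_contra hn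
    simp only [mem_union, not_or] at hn
    refine hx ?_
    rw [S.untwist_val, Homeomorph.trans_apply, hgl' x hn.2]
    exact not_not.1 fun h' => hn.1 (subset_closure h')

variable {Z : Type*} [MetricSpace Z] {ψ : M → Z}

/-- `ψ` distorts the diameters of the continua contained in `U` at most by the factor `C`. -/
def DiamComparable (ψ : M → Z) (C : ℝ) (U : Set M) : Prop :=
  ∀ A ⊆ U, IsCompact A → IsPreconnected A →
    Metric.diam (ψ '' A) ≤ C * Metric.diam A ∧ Metric.diam A ≤ C * Metric.diam (ψ '' A)

/-- The chain of comparisons is: parameter length, distance of the endpoints, diameter of the piece,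
diameter of its image under `ψ`, packing size of that image. Pieces of arcs are continua, so
`DiamComparable` applies. -/
lemma segSize_bound (hψ : Continuous ψ) {C : ℝ} (hC : 0 < C) {U : Set M}
    (hU : DiamComparable ψ C U) {γ : ℝ → M} (hγ : Continuous γ) (hγU : ∀ x, γ x ∈ U) {K R : ℝ}
    (hK : 0 < K) (hR : 0 < R) (h : ∀ x ∈ Icc (-1 : ℝ) 1, ∀ y ∈ Icc (-1 : ℝ) 1,
      dist (γ x) (γ y) ≤ K * (R * |x - y|) ∧ R * |x - y| ≤ K * dist (γ x) (γ y)) {x y : ℝ}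
    (hx : -1 ≤ x) (hxy : x ≤ y) (hy : y ≤ 1) :
    R * (y - x) ≤ (2 * K * C) * segSize (fun s => ψ (γ s)) x y ∧
      segSize (fun s => ψ (γ s)) x y ≤ (2 * K * C) * (R * (y - x)) := by
  have hc : IsCompact (γ '' Icc x y) := isCompact_Icc.image hγ
  have hcψ : IsCompact (ψ '' (γ '' Icc x y)) := hc.image hψ
  obtain ⟨h₁, h₂⟩ := hU (γ '' Icc x y) (by rintro _ ⟨s, -, rfl⟩; exact hγU s) hc
    (isPreconnected_Icc.image γ hγ.continuousOn)
  have e : segSize (fun s => ψ (γ s)) x y = packSize (ψ '' (γ '' Icc x y)) := by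
    rw [segSize, uIcc_of_le hxy, image_image]
  have hd : Metric.diam (γ '' Icc x y) ≤ K * (R * (y - x)) := by
    refine Metric.diam_le_of_forall_dist_le
      (mul_nonneg hK.le (mul_nonneg hR.le (by linarith))) ?_
    rintro _ ⟨a, ha, rfl⟩ _ ⟨b, hb, rfl⟩
    refine (h a ⟨by linarith [ha.1], by linarith [ha.2]⟩ b
      ⟨by linarith [hb.1], by linarith [hb.2]⟩).1.trans ?_
    gcongr
    rw [abs_le]
    constructor <;> linarith [ha.1, ha.2, hb.1, hb.2]
  have hd' : Metric.diam (ψ '' (γ '' Icc x y)) ≤ 2 * packSize (ψ '' (γ '' Icc x y)) :=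
    Metric.diam_le_of_forall_dist_le (mul_nonneg zero_le_two (packSize_nonneg _))
      fun a ha b hb => dist_le_two_mul_packSize hcψ.isBounded ha hb
  rw [e]
  constructor
  · have h3 := (h x ⟨hx, hxy.trans hy⟩ y ⟨hx.trans hxy, hy⟩).2
    have h4 : dist (γ x) (γ y) ≤ Metric.diam (γ '' Icc x y) :=
      Metric.dist_le_diam_of_mem hc.isBounded (mem_image_of_mem _ (left_mem_Icc.2 hxy))
        (mem_image_of_mem _ (right_mem_Icc.2 hxy))
    rw [abs_sub_comm, abs_of_nonneg (by linarith : 0 ≤ y - x)] at h3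
    calc R * (y - x) ≤ K * (C * (2 * packSize (ψ '' (γ '' Icc x y)))) := by
          refine h3.trans (mul_le_mul_of_nonneg_left (h4.trans (h₂.trans ?_)) hK.le)
          exact mul_le_mul_of_nonneg_left hd' hC.le
      _ = _ := by ring
  · have h0 : 0 ≤ K * C * (R * (y - x)) :=
      mul_nonneg (by positivity) (mul_nonneg hR.le (by linarith))
    calc packSize (ψ '' (γ '' Icc x y)) ≤ C * (K * (R * (y - x))) :=
          (packSize_le_diam hcψ.isBounded).trans
            (h₁.trans (mul_le_mul_of_nonneg_left hd hC.le))
      _ = K * C * (R * (y - x)) := by ring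
      _ ≤ 2 * (K * C * (R * (y - x))) := by linarith
      _ = _ := by ring

lemma bilip_pos [Nonempty κ] : 0 < S.bilip := by
  obtain ⟨R, hR, h⟩ := S.arc_bilip (Classical.arbitrary κ, 0)
  have h1 := (h 0 (by norm_num) 1 (by norm_num)).2
  by_contra hn
  have : S.bilip * dist (S.arc (Classical.arbitrary κ, 0) 0) (S.arc (Classical.arbitrary κ, 0) 1)
      ≤ 0 := mul_nonpos_of_nonpos_of_nonneg (not_lt.1 hn) dist_nonneg
  norm_num at h1
  linarith

/-- A homeomorphism which is `L`-bi-Lipschitz near the arcs with indices in `I` has tame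
coordinates there. -/
lemma coord_bound (hψ : Continuous ψ) (hψi : Function.Injective ψ) {h : M ≃ₜ M} {C L : ℝ}
    (hC : 0 < C) (hL : 1 ≤ L) {I : Set (κ × ℕ)} {U V : Set M} (hU : DiamComparable ψ C U)
    (hV : DiamComparable ψ C V) (hIU : ∀ i ∈ I, S.D i ⊆ U) (hIV : ∀ i ∈ I, h '' S.D i ⊆ V)
    (hL₁ : ∀ i ∈ I, ∀ x ∈ S.D i, ∀ y ∈ S.D i, dist (h x) (h y) ≤ L * dist x y ∧
      dist x y ≤ L * dist (h x) (h y)) :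
    ∃ δ < 1, ∀ i ∈ I, |(S.coord ψ h i : ℝ)| ≤ δ := by
  rcases isEmpty_or_nonempty κ with hκ | hκ
  · exact ⟨0, by norm_num, fun i _ => hκ.elim i.1⟩
  have hb := S.bilip_pos
  have hL0 : 0 < L := by linarith
  set K := L * S.bilip
  have hK : 0 < K := by positivity
  have hK' : S.bilip ≤ K := le_mul_of_one_le_left hb.le hL
  -- The constant of `balancePt_bound` for `2 * K * C`, the factor in `segSize_bound`. It serves all
  -- arcs at once because their individual scales `R` have cancelled.
  refine ⟨((2 * K * C) ^ 4 - 1) / ((2 * K * C) ^ 4 + 1), ?_, fun i hi => ?_⟩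
  · rw [div_lt_one (by positivity)]
    linarith
  obtain ⟨R, hR, harc⟩ := S.arc_bilip i
  refine balancePt_bound (by positivity : 0 < 2 * K * C) hR (S.continuous_image_arc hψ h i)
    (S.injOn_image_arc hψi h i) (fun x y hx hxy hy => ?_) fun x y hx hxy hy => ?_
  · refine segSize_bound hψ hC hU (S.continuous_arc i) (fun x => hIU i hi (S.arc_mem i x)) hK hR
      (fun x hx y hy => ⟨(harc x hx y hy).1.trans ?_, (harc x hx y hy).2.trans ?_⟩) hx hxy hy
    · gcongr
    · gcongr
  · refine segSize_bound (γ := fun x => h (S.arc i x)) hψ hC hV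
      (h.continuous.comp (S.continuous_arc i))
      (fun x => hIV i hi (mem_image_of_mem _ (S.arc_mem i x))) hK hR
      (fun x hx y hy => ?_) hx hxy hy
    have h1 := hL₁ i hi _ (S.arc_mem i x) _ (S.arc_mem i y)
    have h2 := harc x hx y hy
    constructor
    · calc _ ≤ L * (S.bilip * (R * |x - y|)) :=
            h1.1.trans (mul_le_mul_of_nonneg_left h2.1 hL0.le)
        _ = _ := by ring
    · calc _ ≤ S.bilip * (L * dist (h (S.arc i x)) (h (S.arc i y))) :=
            h2.2.trans (mul_le_mul_of_nonneg_left h1.2 hb.le)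
        _ = _ := by ring

lemma tameOn_univ_coord (hψ : Continuous ψ) (hψi : Function.Injective ψ) {C : ℝ} (hC : 0 < C)
    (hcomp : DiamComparable ψ C univ) {h : HomeoFix M X} (hh : h ∈ HomeoFix.LIP M X) :
    TameOn univ (S.coord ψ h.1) := by
  obtain ⟨⟨C₁, h₁⟩, C₂, h₂⟩ := hh
  have hC₁ : (C₁ : ℝ) ≤ max 1 (max C₁ C₂) := (le_max_left _ _).trans (le_max_right _ _)
  have hC₂ : (C₂ : ℝ) ≤ max 1 (max C₁ C₂) := (le_max_right _ _).trans (le_max_right _ _)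
  obtain ⟨δ, hδ, hb⟩ := S.coord_bound hψ hψi (h := h.1) (L := max 1 (max C₁ C₂)) (I := univ) hC
    (le_max_left _ _) hcomp hcomp (fun _ _ => subset_univ _) (fun _ _ => subset_univ _)
    fun i _ x _ y _ => by
      refine ⟨(h₁.dist_le_mul x y).trans (mul_le_mul_of_nonneg_right hC₁ dist_nonneg), ?_⟩
      have := h₂.dist_le_mul (h.1 x) (h.1 y)
      rw [Homeomorph.symm_apply_apply, Homeomorph.symm_apply_apply] at this
      exact this.trans (mul_le_mul_of_nonneg_right hC₂ dist_nonneg)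
  exact ⟨δ, hδ, fun c _ i => hb _ (mem_univ _)⟩

/-- Near the base point of the cell `h` is bi-Lipschitz and `ψ` distorts continua boundedly, both
there and near the image point. All but finitely many arcs lie in that neighbourhood; the remaining
coordinates are finitely many points of the open interval. -/
lemma tameOn_coord (hψ : Continuous ψ) (hψi : Function.Injective ψ)
    (hcomp : ∀ q, ∃ C > 0, ∃ U ∈ 𝓝 q, DiamComparable ψ C U) {h : HomeoFix M X}
    (hh : h ∈ HomeoFix.locLIP M X) (c : κ) : TameOn {c} (S.coord ψ h.1) := by
  obtain ⟨C₁, U, hU, hCU⟩ := hh.1 (S.pt c)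
  obtain ⟨C₂, V, hV, hCV⟩ := hh.2 (h.1 (S.pt c))
  obtain ⟨C, hC, W, hW, hCW⟩ := hcomp (S.pt c)
  obtain ⟨C', hC', W', hW', hCW'⟩ := hcomp (h.1 (S.pt c))
  have hmax : ∀ {C C'' : ℝ} {W : Set M}, C ≤ C'' → DiamComparable ψ C W →
      DiamComparable ψ C'' W := fun hle hW A hA h1 h2 =>
    ⟨(hW A hA h1 h2).1.trans (mul_le_mul_of_nonneg_right hle Metric.diam_nonneg),
      (hW A hA h1 h2).2.trans (mul_le_mul_of_nonneg_right hle Metric.diam_nonneg)⟩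
  have hC₁ : (C₁ : ℝ) ≤ max 1 (max C₁ C₂) := (le_max_left _ _).trans (le_max_right _ _)
  have hC₂ : (C₂ : ℝ) ≤ max 1 (max C₁ C₂) := (le_max_right _ _).trans (le_max_right _ _)
  have hN : U ∩ W ∩ h.1 ⁻¹' (V ∩ W') ∈ 𝓝 (S.pt c) :=
    Filter.inter_mem (Filter.inter_mem hU hW)
      (h.1.continuous.continuousAt (Filter.inter_mem hV hW'))
  obtain ⟨δ, hδ, hb⟩ := S.coord_bound hψ hψi (h := h.1) (L := max 1 (max C₁ C₂))
    (I := {i | S.D i ⊆ U ∩ W ∩ h.1 ⁻¹' (V ∩ W')}) (lt_max_of_lt_left hC)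
    (le_max_left _ _) (hmax (le_max_left C C') hCW) (hmax (le_max_right C C') hCW')
    (fun i hi x hx => (hi hx).1.2) (by rintro i hi _ ⟨x, hx, rfl⟩; exact (hi hx).2.2)
    fun i hi x hx y hy => by
      refine ⟨(hCU.dist_le_mul x (hi hx).1.1 y (hi hy).1.1).trans
        (mul_le_mul_of_nonneg_right hC₁ dist_nonneg), ?_⟩
      have := hCV.dist_le_mul (h.1 x) (hi hx).2.1 (h.1 y) (hi hy).2.1
      rw [Homeomorph.symm_apply_apply, Homeomorph.symm_apply_apply] at this
      exact this.trans (mul_le_mul_of_nonneg_right hC₂ dist_nonneg)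
  obtain ⟨δ', hδ', hb'⟩ := exists_bound_of_eventually
    (f := fun i => |(S.coord ψ h.1 (c, i) : ℝ)|)
    (fun i => abs_lt.2 (S.coord ψ h.1 (c, i)).2) hδ
    ((S.eventually_subset c _ hN).mono fun i hi => hb (c, i) hi)
  exact ⟨δ', hδ', fun c' hc' i => by rw [mem_singleton_iff.1 hc']; exact hb' i⟩

lemma finite_coord_ne_zero (hψ : Continuous ψ) (hψi : Function.Injective ψ) {h : HomeoFix M X}
    (hh : h ∈ HomeoFix.compactSupp M X) : {c | ∃ i, (S.coord ψ h.1 (c, i) : ℝ) ≠ 0}.Finite := by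
  refine (S.locallyFinite.finite_nonempty_inter_compact hh).subset ?_
  rintro c ⟨i, hi⟩
  by_contra hne
  refine hi (congrArg Subtype.val
    (S.coord_eq_zero_of_eqOn hψ hψi (h := h.1) (i := (c, i)) fun x hx => ?_))
  by_contra hxne
  exact hne ⟨x, mem_iUnion.2 ⟨i, hx⟩, subset_closure hxne⟩

end CellSliders

end CellSliders

/-! ### Sliding along an axis in `ℝ^(m+1)` -/

section AxisSlide

open Set

variable {m : ℕ}

/-- The `ℓ¹`-box of radius `r` about the point `a` of the first axis. -/
def axisBox (a r : ℝ) : Set (Fin (m + 1) → ℝ) :=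
  {x | |x 0 - a| + ∑ j : Fin m, |x j.succ| ≤ r}

/-- The displacement profile of the sliding map, up to the factor `τ`. -/
def axisBump (a r : ℝ) (x : Fin (m + 1) → ℝ) : ℝ :=
  max 0 (min (r - ∑ j : Fin m, |x j.succ| + (x 0 - a)) (r - ∑ j : Fin m, |x j.succ| - (x 0 - a)))

/-- The displacement profile of the inverse of the sliding map, up to the factor `-τ`. -/
def axisBumpInv (a r τ : ℝ) (x : Fin (m + 1) → ℝ) : ℝ :=
  max 0 (min ((r - ∑ j : Fin m, |x j.succ| + (x 0 - a)) / (1 + τ))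
    ((r - ∑ j : Fin m, |x j.succ| - (x 0 - a)) / (1 - τ)))

/-- The sliding map: it moves `a` to `a + τ r` on the first axis. -/
def axisSlide (a r τ : ℝ) (x : Fin (m + 1) → ℝ) : Fin (m + 1) → ℝ :=
  x + Pi.single 0 (τ * axisBump a r x)

/-- The inverse of the sliding map. -/
def axisSlideInv (a r τ : ℝ) (x : Fin (m + 1) → ℝ) : Fin (m + 1) → ℝ :=
  x + Pi.single 0 (-τ * axisBumpInv a r τ x)

/-- With the other coordinates fixed, put `s = x 0 - a` and `w = r - ∑ |x j.succ|`. The map is `s ↦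
s + τ max(0, w - |s|)`, with slopes `1 + τ` and `1 - τ` on the two sides of 0. The two linear forms
`w + s` and `w - s` are multiplied by these slopes on their own sides, which explains the
denominators of `axisBumpInv`. -/
lemma axisSlideInv_axisSlide (a r : ℝ) {τ : ℝ} (h₁ : -1 < τ) (h₂ : τ < 1)
    (x : Fin (m + 1) → ℝ) : axisSlideInv a r τ (axisSlide a r τ x) = x := by
  have key : axisBumpInv a r τ (axisSlide a r τ x) = axisBump a r x := by
    simp only [axisBumpInv, axisBump, axisSlide, Pi.add_apply, Pi.single_eq_same,
      Pi.single_eq_of_ne (Fin.succ_ne_zero _), add_zero]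
    generalize r - ∑ j : Fin m, |x j.succ| = w
    have e : x 0 + τ * max 0 (min (w + (x 0 - a)) (w - (x 0 - a))) - a =
      (x 0 - a) + τ * max 0 (min (w + (x 0 - a)) (w - (x 0 - a))) := by ring
    rw [e]
    generalize x 0 - a = s
    have p₁ : 0 < 1 + τ := by linarith
    have p₂ : 0 < 1 - τ := by linarith
    rcases le_total (min (w + s) (w - s)) 0 with h0 | h0
    · rw [max_eq_left h0, mul_zero, add_zero]
      refine max_eq_left ?_
      rcases min_le_iff.1 h0 with h | h
      · exact (min_le_left _ _).trans (div_nonpos_of_nonpos_of_nonneg h p₁.le)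
      · exact (min_le_right _ _).trans (div_nonpos_of_nonpos_of_nonneg h p₂.le)
    · rw [max_eq_right h0]
      rcases le_total (w + s) (w - s) with h | h
      · rw [min_eq_left h] at h0 ⊢
        have e1 : (w + (s + τ * (w + s))) / (1 + τ) = w + s := by
          rw [div_eq_iff p₁.ne']; ring
        rw [e1, min_eq_left, max_eq_right h0]
        rw [le_div_iff₀ p₂]
        linarith
      · rw [min_eq_right h] at h0 ⊢
        have e1 : (w - (s + τ * (w - s))) / (1 - τ) = w - s := by
          rw [div_eq_iff p₂.ne']; ring
        rw [e1, min_eq_right, max_eq_right h0]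
        rw [le_div_iff₀ p₁]
        linarith
  rw [axisSlideInv, key, axisSlide, add_assoc, ← Pi.single_add, neg_mul, add_neg_cancel,
    Pi.single_zero, add_zero]

lemma axisSlide_axisSlideInv (a r : ℝ) {τ : ℝ} (h₁ : -1 < τ) (h₂ : τ < 1)
    (x : Fin (m + 1) → ℝ) : axisSlide a r τ (axisSlideInv a r τ x) = x := by
  have key : axisBump a r (axisSlideInv a r τ x) = axisBumpInv a r τ x := by
    simp only [axisBumpInv, axisBump, axisSlideInv, Pi.add_apply, Pi.single_eq_same,
      Pi.single_eq_of_ne (Fin.succ_ne_zero _), add_zero]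
    generalize r - ∑ j : Fin m, |x j.succ| = w
    have p₁ : 0 < 1 + τ := by linarith
    have p₂ : 0 < 1 - τ := by linarith
    have e : ∀ b, x 0 + -τ * b - a = (x 0 - a) - τ * b := fun b => by ring
    rw [e]
    generalize x 0 - a = s
    rcases le_total (min ((w + s) / (1 + τ)) ((w - s) / (1 - τ))) 0 with h0 | h0
    · rw [max_eq_left h0, mul_zero, sub_zero]
      refine max_eq_left ?_
      rcases min_le_iff.1 h0 with h | h
      · refine (min_le_left _ _).trans (not_lt.1 fun hn => ?_)
        exact absurd (div_pos hn p₁) h.not_gt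
      · refine (min_le_right _ _).trans (not_lt.1 fun hn => ?_)
        exact absurd (div_pos hn p₂) h.not_gt
    · rw [max_eq_right h0]
      have e1 : w + s = (1 + τ) * ((w + s) / (1 + τ)) := by field_simp
      have e2 : w - s = (1 - τ) * ((w - s) / (1 - τ)) := by field_simp
      generalize (w + s) / (1 + τ) = A at *
      generalize (w - s) / (1 - τ) = B at *
      rcases le_total A B with h | h
      · rw [min_eq_left h] at h0 ⊢
        have hle : w + (s - τ * A) ≤ w - (s - τ * A) := by
          have := mul_le_mul_of_nonneg_left h p₂.le
          linarith
        rw [min_eq_left hle, max_eq_right] <;> linarith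
      · rw [min_eq_right h] at h0 ⊢
        have hle : w - (s - τ * B) ≤ w + (s - τ * B) := by
          have := mul_le_mul_of_nonneg_left h p₁.le
          linarith
        rw [min_eq_right hle, max_eq_right] <;> linarith
  rw [axisSlide, key, axisSlideInv, add_assoc, ← Pi.single_add, neg_mul, neg_add_cancel,
    Pi.single_zero, add_zero]

lemma axisBump_eq_zero {a r : ℝ} {x : Fin (m + 1) → ℝ} (hx : x ∉ axisBox a r) :
    axisBump a r x = 0 := by
  simp only [axisBox, mem_ofPred_eq, not_le] at hx
  refine max_eq_left ?_
  rcases abs_cases (x 0 - a) with ⟨h, -⟩ | ⟨h, -⟩ <;> rw [h] at hx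
  · exact (min_le_right _ _).trans (by linarith)
  · exact (min_le_left _ _).trans (by linarith)

lemma axisSlide_of_notMem {a r τ : ℝ} {x : Fin (m + 1) → ℝ} (hx : x ∉ axisBox a r) :
    axisSlide a r τ x = x := by
  rw [axisSlide, axisBump_eq_zero hx, mul_zero, Pi.single_zero, add_zero]

lemma continuous_axisSlide (a r : ℝ) :
    Continuous fun q : Ioo (-1 : ℝ) 1 × (Fin (m + 1) → ℝ) => axisSlide a r q.1 q.2 := by
  unfold axisSlide axisBump
  refine continuous_snd.add ((continuous_single (A := fun _ : Fin (m + 1) => ℝ) 0).comp ?_)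
  fun_prop

lemma continuous_axisSlideInv (a r : ℝ) :
    Continuous fun q : Ioo (-1 : ℝ) 1 × (Fin (m + 1) → ℝ) => axisSlideInv a r q.1 q.2 := by
  unfold axisSlideInv axisBumpInv
  refine continuous_snd.add ((continuous_single (A := fun _ : Fin (m + 1) => ℝ) 0).comp ?_)
  have h1 : ∀ q : Ioo (-1 : ℝ) 1 × (Fin (m + 1) → ℝ), 1 + (q.1 : ℝ) ≠ 0 := fun q => by
    have := q.1.2.1; linarith
  have h2 : ∀ q : Ioo (-1 : ℝ) 1 × (Fin (m + 1) → ℝ), 1 - (q.1 : ℝ) ≠ 0 := fun q => by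
    have := q.1.2.2; linarith
  refine Continuous.mul (by fun_prop) (continuous_const.max (Continuous.min ?_ ?_))
  · exact Continuous.div (by fun_prop) (by fun_prop) h1
  · exact Continuous.div (by fun_prop) (by fun_prop) h2

lemma abs_axis_sub_le (a r : ℝ) (x y : Fin (m + 1) → ℝ) :
    |(r - ∑ j : Fin m, |x j.succ| + (x 0 - a)) - (r - ∑ j : Fin m, |y j.succ| + (y 0 - a))| ≤
      (m + 1) * dist x y ∧
    |(r - ∑ j : Fin m, |x j.succ| - (x 0 - a)) - (r - ∑ j : Fin m, |y j.succ| - (y 0 - a))| ≤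
      (m + 1) * dist x y := by
  have h1 : abs ((∑ j : Fin m, |x j.succ|) - ∑ j : Fin m, |y j.succ|) ≤ m * dist x y := by
    rw [← Finset.sum_sub_distrib]
    refine (Finset.abs_sum_le_sum_abs _ _).trans ?_
    refine (Finset.sum_le_card_nsmul _ _ (dist x y) fun j _ => ?_).trans_eq (by simp)
    exact (abs_abs_sub_abs_le_abs_sub _ _).trans (dist_le_pi_dist x y j.succ)
  have h2 : |x 0 - y 0| ≤ dist x y := dist_le_pi_dist x y 0
  rw [abs_le] at h1 h2 ⊢
  rw [abs_le]
  refine ⟨⟨?_, ?_⟩, ?_, ?_⟩ <;> linarith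

lemma dist_add_single_le {x y : Fin (m + 1) → ℝ} {b c L : ℝ} (hL : 0 ≤ L)
    (h : |b - c| ≤ L * dist x y) :
    dist (x + Pi.single 0 b) (y + Pi.single 0 c) ≤ (1 + L) * dist x y := by
  refine (dist_pi_le_iff (by positivity)).2 fun j => ?_
  refine Fin.cases ?_ (fun j => ?_) j
  · simp only [Pi.add_apply, Pi.single_eq_same]
    have h2 : |x 0 - y 0| ≤ dist x y := dist_le_pi_dist x y 0
    rw [Real.dist_eq, add_sub_add_comm]
    exact (abs_add_le _ _).trans (by linarith)
  · simp only [Pi.add_apply, Pi.single_eq_of_ne (Fin.succ_ne_zero _), add_zero]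
    have h2 := dist_le_pi_dist x y j.succ
    have : 0 ≤ L * dist x y := by positivity
    linarith

lemma abs_max_zero_min_sub_le {p q p' q' d : ℝ} (h₁ : |p - p'| ≤ d) (h₂ : |q - q'| ≤ d) :
    |max 0 (min p q) - max 0 (min p' q')| ≤ d := by
  have h3 := abs_max_sub_max_le_max 0 (min p q) 0 (min p' q')
  have h4 := abs_min_sub_min_le_max p q p' q'
  rw [sub_self, abs_zero, max_eq_right (abs_nonneg (min p q - min p' q'))] at h3
  exact h3.trans (h4.trans (max_le h₁ h₂))

/-- Only the inverse degenerates as `τ → ±1`, through the factors `1 / (1 ± τ)`; one constant is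
used for both maps. It does not depend on `a` or `r`, hence is common to all scales. -/
lemma dist_axisSlide_le (a r : ℝ) {τ δ : ℝ} (hδ : δ < 1) (hτ : |τ| ≤ δ)
    (x y : Fin (m + 1) → ℝ) :
    dist (axisSlide a r τ x) (axisSlide a r τ y) ≤ (1 + (m + 1) / (1 - δ)) * dist x y ∧
    dist (axisSlideInv a r τ x) (axisSlideInv a r τ y) ≤
      (1 + (m + 1) / (1 - δ)) * dist x y := by
  have hpos : 0 < 1 - δ := by linarith
  have hle1 : 1 - δ ≤ 1 := by linarith [abs_nonneg τ]
  obtain ⟨h1, h2⟩ := abs_axis_sub_le a r x y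
  have hτ1 : |τ| ≤ 1 := by linarith
  have hτ' := abs_le.1 hτ
  have hd : ∀ {z : ℝ}, 1 - δ ≤ z → ∀ {p q : ℝ}, |p - q| ≤ (m + 1) * dist x y →
      |p / z - q / z| ≤ (m + 1) / (1 - δ) * dist x y := by
    intro z hz p q hpq
    have hz0 : 0 < z := by linarith
    rw [← sub_div, abs_div, abs_of_pos hz0, div_mul_eq_mul_div]
    exact div_le_div₀ (by positivity) hpq hpos hz
  have hL : (0 : ℝ) ≤ (m + 1) / (1 - δ) := by positivity
  constructor
  · refine dist_add_single_le hL ?_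
    rw [← mul_sub, abs_mul]
    refine (mul_le_of_le_one_left (abs_nonneg _) hτ1).trans ?_
    refine (abs_max_zero_min_sub_le h1 h2).trans (mul_le_mul_of_nonneg_right ?_ dist_nonneg)
    rw [le_div_iff₀ hpos]
    exact mul_le_of_le_one_right (by positivity) hle1
  · refine dist_add_single_le hL ?_
    rw [← mul_sub, abs_mul, abs_neg]
    refine (mul_le_of_le_one_left (abs_nonneg _) hτ1).trans ?_
    exact abs_max_zero_min_sub_le (hd (by linarith) h1) (hd (by linarith) h2)

lemma axisSlide_single {a r τ x : ℝ} (hr : 0 ≤ r) (hx : x ∈ Icc (-1 : ℝ) 1) :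
    axisSlide a r τ (Pi.single 0 (a + r * x) : Fin (m + 1) → ℝ) =
      Pi.single 0 (a + r * (x + τ * (1 - |x|))) := by
  have : axisBump a r (Pi.single 0 (a + r * x) : Fin (m + 1) → ℝ) = r * (1 - |x|) := by
    simp only [axisBump, Pi.single_eq_same, Pi.single_eq_of_ne (Fin.succ_ne_zero _), abs_zero,
      Finset.sum_const_zero, sub_zero, add_sub_cancel_left]
    have e1 : r + r * x = r * (1 + x) := by ring
    have e2 : r - r * x = r * (1 - x) := by ring
    rw [e1, e2, ← mul_min_of_nonneg _ _ hr]
    have e3 : min (1 + x) (1 - x) = 1 - |x| := by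
      rcases abs_cases x with ⟨h, h'⟩ | ⟨h, h'⟩
      · rw [h, min_eq_right]; linarith
      · rw [h, min_eq_left] <;> linarith
    rw [e3]
    exact max_eq_right (mul_nonneg hr (by linarith [abs_le.2 hx]))
  rw [axisSlide, this, ← Pi.single_add]
  congr 1
  ring

lemma isCompact_axisBox (a r : ℝ) : IsCompact (axisBox a r : Set (Fin (m + 1) → ℝ)) := by
  refine Metric.isCompact_of_isClosed_isBounded (isClosed_le (by fun_prop) continuous_const)
    ((Metric.isBounded_closedBall (x := 0) (r := |a| + |r|)).subset fun x hx => ?_)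
  simp only [axisBox, mem_ofPred_eq] at hx
  have hs : ∀ j : Fin m, |x j.succ| ≤ ∑ j : Fin m, |x j.succ| := fun j =>
    Finset.single_le_sum (f := fun j : Fin m => |x j.succ|) (fun _ _ => abs_nonneg _)
      (Finset.mem_univ j)
  have hs0 : 0 ≤ ∑ j : Fin m, |x j.succ| := Finset.sum_nonneg fun _ _ => abs_nonneg _
  rw [mem_closedBall_zero_iff, pi_norm_le_iff_of_nonneg (by positivity)]
  intro j
  refine Fin.cases ?_ (fun j => ?_) j
  · rw [Real.norm_eq_abs]
    have := abs_sub_abs_le_abs_sub (x 0) a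
    linarith [le_abs_self r]
  · rw [Real.norm_eq_abs]
    linarith [hs j, abs_nonneg (x 0 - a), le_abs_self r, abs_nonneg a]

lemma norm_le_of_mem_axisBox {a r : ℝ} {x : Fin (m + 1) → ℝ} (hx : x ∈ axisBox a r) :
    ‖x‖ ≤ |a| + r := by
  simp only [axisBox, mem_ofPred_eq] at hx
  have hs : ∀ j : Fin m, |x j.succ| ≤ ∑ j : Fin m, |x j.succ| := fun j =>
    Finset.single_le_sum (f := fun j : Fin m => |x j.succ|) (fun _ _ => abs_nonneg _)
      (Finset.mem_univ j)
  have hs0 : 0 ≤ ∑ j : Fin m, |x j.succ| := Finset.sum_nonneg fun _ _ => abs_nonneg _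
  have h0 := abs_nonneg (x 0 - a)
  rw [pi_norm_le_iff_of_nonneg (by linarith [abs_nonneg a])]
  intro j
  refine Fin.cases ?_ (fun j => ?_) j
  · rw [Real.norm_eq_abs]
    have := abs_sub_abs_le_abs_sub (x 0) a
    linarith
  · rw [Real.norm_eq_abs]
    linarith [hs j, abs_nonneg a]

end AxisSlide

/-! ### Transporting maps through a chart -/

section ChartConj

open Set

variable {F M : Type*} [TopologicalSpace F] [TopologicalSpace M] (e : OpenPartialHomeomorph F M)

open Classical in
/-- The map which is `f` read in the chart `e`, and the identity off the chart. -/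
def chartConj (f : F → F) (x : M) : M := if x ∈ e.target then e (f (e.symm x)) else x

lemma chartConj_apply {f : F → F} {v : F} (hv : v ∈ e.source) :
    chartConj e f (e v) = e (f v) := by
  rw [chartConj, if_pos (e.map_source hv), e.left_inv hv]

lemma chartConj_of_notMem_target {f : F → F} {x : M} (hx : x ∉ e.target) :
    chartConj e f x = x := if_neg hx

lemma chartConj_of_notMem {f : F → F} {D : Set F}
    (hoff : ∀ v ∉ D, f v = v) {x : M} (hx : x ∉ e '' D) : chartConj e f x = x := by
  by_cases h : x ∈ e.target
  · rw [chartConj, if_pos h, hoff, e.right_inv h]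
    exact fun hm => hx ⟨_, hm, e.right_inv h⟩
  · exact chartConj_of_notMem_target e h

lemma mapsTo_source_of_eqOn {f g : F → F} {D : Set F} (hD : D ⊆ e.source)
    (hoff : ∀ v ∉ D, f v = v) (hgf : ∀ v, g (f v) = v) {v : F} (hv : v ∈ e.source) :
    f v ∈ e.source := by
  by_cases h : f v ∈ D
  · exact hD h
  · have h1 := hoff _ h
    have h2 := hgf (f v)
    rw [h1, hgf] at h2
    rwa [← h2]

lemma chartConj_chartConj {f g : F → F} {D : Set F} (hD : D ⊆ e.source)
    (hoff : ∀ v ∉ D, f v = v) (hgf : ∀ v, g (f v) = v) (x : M) :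
    chartConj e g (chartConj e f x) = x := by
  by_cases h : x ∈ e.target
  · have hv := e.map_target h
    rw [← e.right_inv h, chartConj_apply e hv,
      chartConj_apply e (mapsTo_source_of_eqOn e hD hoff hgf hv), hgf]
  · rw [chartConj_of_notMem_target e (f := f) h, chartConj_of_notMem_target e h]

/-- Inside the chart this is a composition. At a point off the chart the map is the identity nearby,
since the image of the compact `D` is closed. -/
lemma continuous_chartConj [T2Space M] {T : Type*} [TopologicalSpace T] {f g : T → F → F}
    {D : Set F} (hDc : IsCompact D) (hD : D ⊆ e.source) (hf : Continuous fun q : T × F => f q.1 q.2)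
    (hoff : ∀ t, ∀ v ∉ D, f t v = v) (hgf : ∀ t v, g t (f t v) = v) :
    Continuous fun q : T × M => chartConj e (f q.1) q.2 := by
  rw [continuous_iff_continuousAt]
  rintro ⟨t, x⟩
  by_cases hx : x ∈ e.target
  · have h1 : ContinuousAt (fun q : T × M => f q.1 (e.symm q.2)) (t, x) :=
      hf.continuousAt.comp (f := fun q : T × M => (q.1, e.symm q.2)) (continuousAt_fst.prodMk
        ((e.continuousAt_symm hx).comp (f := Prod.snd) continuousAt_snd))
    have h2 : ContinuousAt (fun q : T × M => e (f q.1 (e.symm q.2))) (t, x) :=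
      ContinuousAt.comp (f := fun q : T × M => f q.1 (e.symm q.2)) (g := e)
        (e.continuousAt (mapsTo_source_of_eqOn e hD (hoff t) (hgf t) (e.map_target hx))) h1
    refine h2.congr ?_
    filter_upwards [continuousAt_snd.eventually_mem (x := (t, x)) (e.open_target.mem_nhds hx)]
      with q hq
    exact (if_pos hq).symm
  · have hcl : IsClosed (e '' D) := (hDc.image_of_continuousOn (e.continuousOn.mono hD)).isClosed
    have hx' : x ∉ e '' D := fun ⟨v, hv, h⟩ => hx (h ▸ e.map_source (hD hv))
    refine continuousAt_snd.congr ?_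
    filter_upwards [continuousAt_snd.eventually_mem (x := (t, x)) (hcl.isOpen_compl.mem_nhds hx')]
      with q hq
    exact (chartConj_of_notMem e (hoff q.1) hq).symm

end ChartConj

/-! ### Cells -/

section Cell

open Set

/-- A chart defined on the ball of radius `4` about the origin of `ℝ^(m+1)` which multiplies
distances by `R` up to the factor `K`. -/
structure Cell (M : Type*) [MetricSpace M] (K : ℝ) (m : ℕ) where
  e : OpenPartialHomeomorph (Fin (m + 1) → ℝ) M
  source_eq : e.source = Metric.ball 0 4
  R : ℝ
  R_pos : 0 < R
  bilip : ∀ v ∈ e.source, ∀ w ∈ e.source,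
    dist (e v) (e w) ≤ K * (R * dist v w) ∧ R * dist v w ≤ K * dist (e v) (e w)
  far : ∀ v ∈ Metric.closedBall (0 : Fin (m + 1) → ℝ) 2, ∀ y ∉ e.target, R ≤ K * dist (e v) y

namespace Cell

variable {M : Type*} [MetricSpace M] {K : ℝ} {m : ℕ} (c : Cell M K m)

lemma axisBox_subset (i : ℕ) : axisBox ((1 / 2) ^ i) ((1 / 2) ^ i / 8) ⊆
    Metric.closedBall (0 : Fin (m + 1) → ℝ) (2 * (1 / 2) ^ i) := by
  intro x hx
  have h := norm_le_of_mem_axisBox hx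
  have h0 : (0 : ℝ) < (1 / 2) ^ i := by positivity
  rw [abs_of_pos h0] at h
  rw [mem_closedBall_zero_iff]
  linarith

lemma axisBox_subset_closedBall (i : ℕ) : axisBox ((1 / 2) ^ i) ((1 / 2) ^ i / 8) ⊆
    Metric.closedBall (0 : Fin (m + 1) → ℝ) 2 := by
  refine (axisBox_subset i).trans (Metric.closedBall_subset_closedBall ?_)
  have := pow_le_one₀ (n := i) (by norm_num : (0 : ℝ) ≤ 1 / 2) (by norm_num)
  linarith

lemma closedBall_subset_source : Metric.closedBall (0 : Fin (m + 1) → ℝ) 2 ⊆ c.e.source := by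
  rw [c.source_eq]
  exact Metric.closedBall_subset_ball (by norm_num)

lemma axisBox_subset_source (i : ℕ) :
    axisBox ((1 / 2) ^ i) ((1 / 2) ^ i / 8) ⊆ c.e.source :=
  (axisBox_subset_closedBall i).trans c.closedBall_subset_source

/-- In the first coordinate the boxes occupy the intervals from `7/8` to `9/8` times a power of
`1/2`, and half of `9/8` is less than `7/8`. -/
lemma disjoint_axisBox {i j : ℕ} (hij : i ≠ j) :
    Disjoint (axisBox ((1 / 2) ^ i) ((1 / 2) ^ i / 8) : Set (Fin (m + 1) → ℝ))
      (axisBox ((1 / 2) ^ j) ((1 / 2) ^ j / 8)) := by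
  wlog h : i < j generalizing i j
  · exact (this hij.symm (by omega)).symm
  refine disjoint_left.2 fun x hx hy => ?_
  simp only [axisBox, mem_ofPred_eq] at hx hy
  have hs0 : 0 ≤ ∑ j : Fin m, |x j.succ| := Finset.sum_nonneg fun _ _ => abs_nonneg _
  have h1 := abs_le.1 (show |x 0 - (1 / 2) ^ i| ≤ (1 / 2) ^ i / 8 by linarith)
  have h2 := abs_le.1 (show |x 0 - (1 / 2) ^ j| ≤ (1 / 2) ^ j / 8 by linarith)
  have h3 : ((1 : ℝ) / 2) ^ j ≤ (1 / 2) ^ i / 2 := by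
    have := pow_le_pow_of_le_one (by norm_num : (0 : ℝ) ≤ 1 / 2) (by norm_num)
      (Nat.succ_le_of_lt h)
    rw [pow_succ] at this
    linarith
  have h4 : (0 : ℝ) < (1 / 2) ^ i := by positivity
  linarith

/-- The sliding homeomorphism of `M` along the `i`-th arc of the cell. -/
def slide (i : ℕ) (τ : Ioo (-1 : ℝ) 1) : M ≃ₜ M where
  toFun := chartConj c.e (axisSlide ((1 / 2) ^ i) ((1 / 2) ^ i / 8) τ)
  invFun := chartConj c.e (axisSlideInv ((1 / 2) ^ i) ((1 / 2) ^ i / 8) τ)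
  left_inv := chartConj_chartConj c.e (c.axisBox_subset_source i)
    (fun _ hv => axisSlide_of_notMem hv) (axisSlideInv_axisSlide _ _ τ.2.1 τ.2.2)
  right_inv := chartConj_chartConj c.e (c.axisBox_subset_source i)
    (fun v hv => by
      conv_lhs => rw [← axisSlide_of_notMem (τ := τ) hv]
      exact axisSlideInv_axisSlide _ _ τ.2.1 τ.2.2 v)
    (axisSlide_axisSlideInv _ _ τ.2.1 τ.2.2)
  continuous_toFun := (continuous_chartConj c.e
    (f := fun t : Ioo (-1 : ℝ) 1 => axisSlide ((1 / 2) ^ i) ((1 / 2) ^ i / 8) t)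
    (g := fun t : Ioo (-1 : ℝ) 1 => axisSlideInv ((1 / 2) ^ i) ((1 / 2) ^ i / 8) t) (isCompact_axisBox _ _)
    (c.axisBox_subset_source i) (continuous_axisSlide _ _) (fun _ _ hv => axisSlide_of_notMem hv)
    (fun t => axisSlideInv_axisSlide _ _ t.2.1 t.2.2)).comp (Continuous.prodMk_right τ)
  continuous_invFun := (continuous_chartConj c.e
    (f := fun t : Ioo (-1 : ℝ) 1 => axisSlideInv ((1 / 2) ^ i) ((1 / 2) ^ i / 8) t)
    (g := fun t : Ioo (-1 : ℝ) 1 => axisSlide ((1 / 2) ^ i) ((1 / 2) ^ i / 8) t) (isCompact_axisBox _ _)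
    (c.axisBox_subset_source i) (continuous_axisSlideInv _ _)
    (fun τ v hv => by
      conv_lhs => rw [← axisSlide_of_notMem (τ := τ) hv]
      exact axisSlideInv_axisSlide _ _ τ.2.1 τ.2.2 v)
    (fun t => axisSlide_axisSlideInv _ _ t.2.1 t.2.2)).comp (Continuous.prodMk_right τ)

lemma slide_apply (i : ℕ) (τ : Ioo (-1 : ℝ) 1) (x : M) :
    c.slide i τ x = chartConj c.e (axisSlide ((1 / 2) ^ i) ((1 / 2) ^ i / 8) τ) x := rfl

lemma axisSlideInv_of_notMem {a r : ℝ} (τ : Ioo (-1 : ℝ) 1) {v : Fin (m + 1) → ℝ}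
    (hv : v ∉ axisBox a r) : axisSlideInv a r τ v = v := by
  conv_lhs => rw [← axisSlide_of_notMem (τ := τ) hv]
  exact axisSlideInv_axisSlide _ _ τ.2.1 τ.2.2 v

lemma continuous_slide (i : ℕ) :
    Continuous fun q : Ioo (-1 : ℝ) 1 × M => c.slide i q.1 q.2 :=
  continuous_chartConj c.e
    (f := fun t : Ioo (-1 : ℝ) 1 => axisSlide ((1 / 2) ^ i) ((1 / 2) ^ i / 8) t)
    (g := fun t : Ioo (-1 : ℝ) 1 => axisSlideInv ((1 / 2) ^ i) ((1 / 2) ^ i / 8) t) (isCompact_axisBox _ _)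
    (c.axisBox_subset_source i) (continuous_axisSlide _ _) (fun _ _ hv => axisSlide_of_notMem hv)
    (fun t => axisSlideInv_axisSlide _ _ t.2.1 t.2.2)

lemma continuous_slide_symm (i : ℕ) :
    Continuous fun q : Ioo (-1 : ℝ) 1 × M => (c.slide i q.1).symm q.2 :=
  continuous_chartConj c.e
    (f := fun t : Ioo (-1 : ℝ) 1 => axisSlideInv ((1 / 2) ^ i) ((1 / 2) ^ i / 8) t)
    (g := fun t : Ioo (-1 : ℝ) 1 => axisSlide ((1 / 2) ^ i) ((1 / 2) ^ i / 8) t) (isCompact_axisBox _ _)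
    (c.axisBox_subset_source i) (continuous_axisSlideInv _ _)
    (fun τ _ hv => axisSlideInv_of_notMem τ hv) (fun t => axisSlide_axisSlideInv _ _ t.2.1 t.2.2)

include c in
lemma one_le_bilip : 1 ≤ K := by
  have h := c.bilip 0 (c.closedBall_subset_source (by simp)) (fun _ => 1)
    (c.closedBall_subset_source (by simp [pi_norm_const]))
  have hd : dist (0 : Fin (m + 1) → ℝ) (fun _ => 1) = 1 := by
    simp [pi_norm_const]
  rw [hd, mul_one] at h
  have hR := c.R_pos
  by_contra hK
  rcases le_or_gt K 0 with h0 | h0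
  · have := mul_nonpos_of_nonpos_of_nonneg h0 (dist_nonneg (x := c.e 0) (y := c.e fun _ => 1))
    linarith
  · have h1 : K * dist (c.e 0) (c.e fun _ => 1) ≤ K * (K * c.R) :=
      mul_le_mul_of_nonneg_left h.1 h0.le
    have h2 : K * (K * c.R) < c.R := by
      have : K * K < 1 := by nlinarith
      nlinarith
    linarith

/-- Two points of the chart are compared through the bi-Lipschitz estimate. If `y` lies off the
chart and `x` is moved, the displacement of `x` is at most `4 * K * R`, which `far` bounds by a
multiple of the distance to `y`. -/
lemma dist_chartConj_le {f : (Fin (m + 1) → ℝ) → Fin (m + 1) → ℝ} {L : ℝ}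
    {D : Set (Fin (m + 1) → ℝ)} (hD : D ⊆ Metric.closedBall 0 2)
    (hf : ∀ v w, dist (f v) (f w) ≤ L * dist v w) (hoff : ∀ v ∉ D, f v = v)
    (hmaps : ∀ v ∈ D, f v ∈ D) (x y : M) :
    dist (chartConj c.e f x) (chartConj c.e f y) ≤ max (K * K * L) (1 + 4 * K * K) * dist x y := by
  have hK := c.one_le_bilip
  have hK0 : 0 ≤ K := by linarith
  have hR := c.R_pos
  have hsrc : ∀ v ∈ c.e.source, f v ∈ c.e.source := fun v hv => by
    by_cases h : v ∈ D
    · exact c.closedBall_subset_source (hD (hmaps v h))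
    · rwa [hoff v h]
  have h1max : (1 : ℝ) ≤ max (K * K * L) (1 + 4 * K * K) :=
    le_max_of_le_right (by nlinarith)
  have key : ∀ x ∈ c.e.target, ∀ y ∉ c.e.target, dist (chartConj c.e f x) (chartConj c.e f y) ≤
      max (K * K * L) (1 + 4 * K * K) * dist x y := by
    intro x hx y hy
    have hv := c.e.map_target hx
    rw [chartConj_of_notMem_target c.e hy, ← c.e.right_inv hx, chartConj_apply c.e hv]
    generalize c.e.symm x = v at hv
    by_cases hvD : v ∈ D
    · have h1 := (c.bilip _ (hsrc v hv) v hv).1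
      have h2 : dist (f v) v ≤ 4 := by
        have h3 := hD hvD
        have h4 := hD (hmaps v hvD)
        rw [Metric.mem_closedBall] at h3 h4
        linarith [dist_triangle_right (f v) v 0]
      have h3 := c.far v (hD hvD) y hy
      have h5 : dist (c.e (f v)) (c.e v) ≤ 4 * K * K * dist (c.e v) y := by
        calc _ ≤ K * (c.R * 4) := h1.trans (by gcongr)
          _ = 4 * K * c.R := by ring
          _ ≤ 4 * K * (K * dist (c.e v) y) := by gcongr
          _ = _ := by ring
      refine le_trans ?_ (mul_le_mul_of_nonneg_right (le_max_right _ _) dist_nonneg)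
      linarith [dist_triangle (c.e (f v)) (c.e v) y]
    · rw [hoff v hvD]
      exact le_mul_of_one_le_left dist_nonneg h1max
  by_cases hx : x ∈ c.e.target <;> by_cases hy : y ∈ c.e.target
  · have hv := c.e.map_target hx
    have hw := c.e.map_target hy
    rw [← c.e.right_inv hx, ← c.e.right_inv hy, chartConj_apply c.e hv, chartConj_apply c.e hw]
    generalize c.e.symm x = v at hv
    generalize c.e.symm y = w at hw
    have h1 := (c.bilip _ (hsrc v hv) _ (hsrc w hw)).1
    have h2 := (c.bilip v hv w hw).2
    refine le_trans ?_ (mul_le_mul_of_nonneg_right (le_max_left _ _) dist_nonneg)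
    by_cases hvw : v = w
    · subst hvw; simp
    have hd : 0 < dist v w := dist_pos.2 hvw
    have hL : 0 ≤ L := by
      have := dist_nonneg.trans (hf v w)
      exact nonneg_of_mul_nonneg_left this hd
    calc _ ≤ K * (c.R * (L * dist v w)) := h1.trans (by gcongr; exact hf v w)
      _ = K * L * (c.R * dist v w) := by ring
      _ ≤ K * L * (K * dist (c.e v) (c.e w)) := by gcongr
      _ = _ := by ring
  · exact key x hx y hy
  · rw [dist_comm, dist_comm x]
    exact key y hy x hx
  · rw [chartConj_of_notMem_target c.e hx, chartConj_of_notMem_target c.e hy]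
    exact le_mul_of_one_le_left dist_nonneg h1max

lemma axisSlide_mem {a r : ℝ} (τ : Ioo (-1 : ℝ) 1) {v : Fin (m + 1) → ℝ} (hv : v ∈ axisBox a r) :
    axisSlide a r τ v ∈ axisBox a r := by
  by_contra h
  have h1 := axisSlideInv_of_notMem τ h
  rw [axisSlideInv_axisSlide _ _ τ.2.1 τ.2.2] at h1
  exact h (h1 ▸ hv)

lemma axisSlideInv_mem {a r : ℝ} (τ : Ioo (-1 : ℝ) 1) {v : Fin (m + 1) → ℝ}
    (hv : v ∈ axisBox a r) : axisSlideInv a r τ v ∈ axisBox a r := by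
  by_contra h
  have h1 := axisSlide_of_notMem (τ := τ) h
  rw [axisSlide_axisSlideInv _ _ τ.2.1 τ.2.2] at h1
  exact h (h1 ▸ hv)

lemma dist_slide_le (i : ℕ) {τ : Ioo (-1 : ℝ) 1} {δ : ℝ} (hδ : δ < 1) (hτ : |(τ : ℝ)| ≤ δ)
    (x y : M) :
    dist (c.slide i τ x) (c.slide i τ y) ≤
      max (K * K * (1 + (m + 1) / (1 - δ))) (1 + 4 * K * K) * dist x y ∧
    dist ((c.slide i τ).symm x) ((c.slide i τ).symm y) ≤
      max (K * K * (1 + (m + 1) / (1 - δ))) (1 + 4 * K * K) * dist x y :=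
  ⟨c.dist_chartConj_le (axisBox_subset_closedBall i)
    (fun v w => (dist_axisSlide_le _ _ hδ hτ v w).1) (fun _ hv => axisSlide_of_notMem hv)
    (fun _ hv => axisSlide_mem τ hv) x y,
  c.dist_chartConj_le (axisBox_subset_closedBall i)
    (fun v w => (dist_axisSlide_le _ _ hδ hτ v w).2) (fun _ hv => axisSlideInv_of_notMem τ hv)
    (fun _ hv => axisSlideInv_mem τ hv) x y⟩

/-- The `i`-th arc of the cell, in the model. -/
def modelArc (m i : ℕ) (x : ℝ) : Fin (m + 1) → ℝ :=
  Pi.single 0 ((1 / 2) ^ i + (1 / 2) ^ i / 8 * (projIcc (-1 : ℝ) 1 (by norm_num) x : ℝ))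

lemma modelArc_of_mem {i : ℕ} {x : ℝ} (hx : x ∈ Icc (-1 : ℝ) 1) :
    modelArc m i x = Pi.single 0 ((1 / 2) ^ i + (1 / 2) ^ i / 8 * x) := by
  rw [modelArc, projIcc_of_mem _ hx]

lemma modelArc_mem (i : ℕ) (x : ℝ) :
    modelArc m i x ∈ axisBox ((1 / 2) ^ i) ((1 / 2) ^ i / 8) := by
  have h := (projIcc (-1 : ℝ) 1 (by norm_num) x).2
  simp only [axisBox, modelArc, mem_ofPred_eq, Pi.single_eq_same,
    Pi.single_eq_of_ne (Fin.succ_ne_zero _), abs_zero, Finset.sum_const_zero, add_zero,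
    add_sub_cancel_left]
  rw [abs_mul, abs_of_pos (by positivity : (0 : ℝ) < (1 / 2) ^ i / 8)]
  exact mul_le_of_le_one_right (by positivity) (abs_le.2 h)

lemma continuous_modelArc (m i : ℕ) : Continuous (modelArc m i) :=
  (continuous_single (A := fun _ : Fin (m + 1) => ℝ) 0).comp
    (continuous_const.add (continuous_const.mul (continuous_subtype_val.comp continuous_projIcc)))

lemma dist_modelArc {i : ℕ} {x y : ℝ} (hx : x ∈ Icc (-1 : ℝ) 1) (hy : y ∈ Icc (-1 : ℝ) 1) :
    dist (modelArc m i x) (modelArc m i y) = (1 / 2) ^ i / 8 * |x - y| := by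
  rw [modelArc_of_mem hx, modelArc_of_mem hy, dist_eq_norm, ← Pi.single_sub, Pi.norm_single,
    Real.norm_eq_abs, add_sub_add_left_eq_sub, ← mul_sub, abs_mul, abs_of_pos (by positivity)]

/-- The `i`-th arc of the cell. -/
def arc (i : ℕ) (x : ℝ) : M := c.e (modelArc m i x)

lemma modelArc_mem_source (i : ℕ) (x : ℝ) : modelArc m i x ∈ c.e.source :=
  c.axisBox_subset_source i (modelArc_mem i x)

lemma continuous_arc (i : ℕ) : Continuous (c.arc i) :=
  c.e.continuousOn.comp_continuous (continuous_modelArc m i) (c.modelArc_mem_source i)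

lemma arc_bilip (i : ℕ) {x y : ℝ} (hx : x ∈ Icc (-1 : ℝ) 1) (hy : y ∈ Icc (-1 : ℝ) 1) :
    dist (c.arc i x) (c.arc i y) ≤ K * (c.R * ((1 / 2) ^ i / 8) * |x - y|) ∧
      c.R * ((1 / 2) ^ i / 8) * |x - y| ≤ K * dist (c.arc i x) (c.arc i y) := by
  have h := c.bilip _ (c.modelArc_mem_source i x) _ (c.modelArc_mem_source i y)
  rwa [dist_modelArc hx hy, ← mul_assoc c.R] at h

lemma injOn_arc (i : ℕ) : InjOn (c.arc i) (Icc (-1) 1) := by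
  intro x hx y hy h
  have h1 := (c.arc_bilip i hx hy).2
  rw [h, dist_self, mul_zero] at h1
  have h2 : 0 < c.R * ((1 / 2) ^ i / 8) := mul_pos c.R_pos (by positivity)
  have h3 : |x - y| ≤ 0 := nonpos_of_mul_nonpos_right h1 h2
  exact sub_eq_zero.1 (abs_nonpos_iff.1 h3)

lemma slide_arc (i : ℕ) (τ : Ioo (-1 : ℝ) 1) {x : ℝ} (hx : x ∈ Icc (-1 : ℝ) 1) :
    c.slide i τ (c.arc i x) = c.arc i (x + τ * (1 - |x|)) := by
  have hx' : x + τ * (1 - |x|) ∈ Icc (-1 : ℝ) 1 := by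
    have h1 := τ.2.1
    have h2 := τ.2.2
    have h3 := abs_le.2 hx
    have h4 := neg_abs_le x
    have h5 := le_abs_self x
    constructor <;> nlinarith
  change c.slide i τ (c.e (modelArc m i x)) = c.e (modelArc m i _)
  rw [slide_apply, chartConj_apply c.e (c.modelArc_mem_source i x), modelArc_of_mem hx,
    modelArc_of_mem hx', axisSlide_single (by positivity) hx]

lemma slide_image_left (i : ℕ) (τ : Ioo (-1 : ℝ) 1) :
    c.slide i τ '' (c.arc i '' uIcc (-1) 0) = c.arc i '' uIcc (-1) (τ : ℝ) := by
  have h1 := τ.2.1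
  have h2 := τ.2.2
  have p : (0 : ℝ) < 1 + τ := by linarith
  rw [uIcc_of_le (by norm_num), uIcc_of_le h1.le]
  refine Subset.antisymm ?_ ?_
  · rintro _ ⟨_, ⟨x, hx, rfl⟩, rfl⟩
    refine ⟨_, ?_, (c.slide_arc i τ ⟨hx.1, hx.2.trans zero_le_one⟩).symm⟩
    rw [abs_of_nonpos hx.2]
    constructor <;> nlinarith [hx.1, hx.2]
  · rintro _ ⟨y, hy, rfl⟩
    have hx : (y - τ) / (1 + τ) ∈ Icc (-1 : ℝ) 0 := by
      rw [mem_Icc, le_div_iff₀ p, div_le_iff₀ p]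
      constructor <;> linarith [hy.1, hy.2]
    refine ⟨_, ⟨(y - τ) / (1 + τ), hx, rfl⟩, ?_⟩
    rw [c.slide_arc i τ ⟨hx.1, hx.2.trans zero_le_one⟩, abs_of_nonpos hx.2]
    congr 1
    field_simp
    ring

lemma slide_image_right (i : ℕ) (τ : Ioo (-1 : ℝ) 1) :
    c.slide i τ '' (c.arc i '' uIcc 0 1) = c.arc i '' uIcc (τ : ℝ) 1 := by
  have h1 := τ.2.1
  have h2 := τ.2.2
  have p : (0 : ℝ) < 1 - τ := by linarith
  rw [uIcc_of_le (by norm_num), uIcc_of_le h2.le]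
  refine Subset.antisymm ?_ ?_
  · rintro _ ⟨_, ⟨x, hx, rfl⟩, rfl⟩
    refine ⟨_, ?_, (c.slide_arc i τ ⟨by linarith [hx.1], hx.2⟩).symm⟩
    rw [abs_of_nonneg hx.1]
    constructor <;> nlinarith [hx.1, hx.2]
  · rintro _ ⟨y, hy, rfl⟩
    have hx : (y - τ) / (1 - τ) ∈ Icc (0 : ℝ) 1 := by
      rw [mem_Icc, le_div_iff₀ p, div_le_iff₀ p]
      constructor <;> linarith [hy.1, hy.2]
    refine ⟨_, ⟨(y - τ) / (1 - τ), hx, rfl⟩, ?_⟩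
    rw [c.slide_arc i τ ⟨by linarith [hx.1], hx.2⟩, abs_of_nonneg hx.1]
    congr 1
    field_simp
    ring

end Cell

/-- A locally finite disjoint family of uniform cells gives rise to a family of sliders. -/
def cellSliders {M : Type*} [MetricSpace M] {κ : Type*} {K : ℝ} {n : ℕ} {m : κ → ℕ}
    (hm : ∀ k, m k ≤ n) (c : ∀ k, Cell M K (m k))
    (hdis : Pairwise (Function.onFun Disjoint fun k => (c k).e.target))
    (hlf : LocallyFinite fun k => (c k).e.target) : CellSliders M κ :=
  have hsub : ∀ p : κ × ℕ, (c p.1).e '' axisBox ((1 / 2) ^ p.2) ((1 / 2) ^ p.2 / 8) ⊆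
      (c p.1).e.target := fun p => by
    rintro _ ⟨v, hv, rfl⟩
    exact (c p.1).e.map_source ((c p.1).axisBox_subset_source _ hv)
  have hlf' : LocallyFinite fun k => ⋃ i,
      (c (k, i).1).e '' axisBox ((1 / 2) ^ (k, i).2) ((1 / 2) ^ (k, i).2 / 8) :=
    hlf.subset fun k => iUnion_subset fun i => hsub (k, i)
  have hev : ∀ k, ∀ U ∈ 𝓝 ((c k).e 0), ∀ᶠ i in Filter.atTop,
      (c (k, i).1).e '' axisBox ((1 / 2) ^ (k, i).2) ((1 / 2) ^ (k, i).2 / 8) ⊆ U := by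
    intro k U hU
    have h0 : (0 : Fin (m k + 1) → ℝ) ∈ (c k).e.source :=
      (c k).closedBall_subset_source (by simp)
    obtain ⟨ρ, hρ, hb⟩ := Metric.mem_nhds_iff.1 ((c k).e.continuousAt h0 hU)
    have ht : Filter.Tendsto (fun i : ℕ => 2 * (1 / 2 : ℝ) ^ i) Filter.atTop (𝓝 0) := by
      simpa using (tendsto_pow_atTop_nhds_zero_of_lt_one (by norm_num : (0 : ℝ) ≤ 1 / 2)
        (by norm_num)).const_mul 2
    filter_upwards [ht.eventually_lt_const hρ] with i hi
    rintro _ ⟨v, hv, rfl⟩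
    exact hb (Metric.closedBall_subset_ball hi (Cell.axisBox_subset i hv))
  { D := fun p => (c p.1).e '' axisBox ((1 / 2) ^ p.2) ((1 / 2) ^ p.2 / 8)
    isCompact_D := fun p => (isCompact_axisBox _ _).image_of_continuousOn
      ((c p.1).e.continuousOn.mono ((c p.1).axisBox_subset_source _))
    disjoint_D := by
      rintro ⟨k, i⟩ ⟨l, j⟩ hne
      by_cases hkl : k = l
      · subst hkl
        have hij : i ≠ j := fun h => hne (by rw [h])
        refine disjoint_left.2 ?_
        rintro _ ⟨v, hv, rfl⟩ ⟨w, hw, he⟩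
        have := (c k).e.injOn ((c k).axisBox_subset_source _ hw)
          ((c k).axisBox_subset_source _ hv) he
        exact disjoint_left.1 (Cell.disjoint_axisBox hij) hv (this ▸ hw)
      · exact (hdis hkl).mono (hsub (k, i)) (hsub (l, j))
    isLocallyNull_D := isLocallyNull_of_eventually_subset hlf' hev
    arc := fun p => (c p.1).arc p.2
    continuous_arc := fun p => (c p.1).continuous_arc p.2
    injOn_arc := fun p => (c p.1).injOn_arc p.2
    arc_mem := fun p x => mem_image_of_mem _ (Cell.modelArc_mem p.2 x)
    slide := fun p => (c p.1).slide p.2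
    continuous_slide := fun p => (c p.1).continuous_slide p.2
    continuous_slide_symm := fun p => (c p.1).continuous_slide_symm p.2
    slide_of_notMem := fun p τ x hx => chartConj_of_notMem (c p.1).e
      (fun _ hv => axisSlide_of_notMem hv) hx
    slide_zero := fun p x => by
      change chartConj _ _ _ = _
      by_cases hx : x ∈ (c p.1).e.target
      · rw [← (c p.1).e.right_inv hx, chartConj_apply _ ((c p.1).e.map_target hx)]
        simp [axisSlide]
      · exact chartConj_of_notMem_target _ hx
    image_left := fun p => (c p.1).slide_image_left p.2
    image_right := fun p => (c p.1).slide_image_right p.2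
    locallyFinite := hlf'
    exists_compact := fun k => ⟨(c k).e '' Metric.closedBall 0 2,
      (isCompact_closedBall _ _).image_of_continuousOn
        ((c k).e.continuousOn.mono (c k).closedBall_subset_source),
      fun i => image_mono (Cell.axisBox_subset_closedBall i)⟩
    pt := fun k => (c k).e 0
    eventually_subset := hev
    bilip := K
    arc_bilip := fun p => ⟨(c p.1).R * ((1 / 2) ^ p.2 / 8),
      mul_pos (c p.1).R_pos (by positivity), fun _ hx _ hy => (c p.1).arc_bilip p.2 hx hy⟩
    slide_lip := fun δ hδ => by
      -- The dimension `m p.1` of a cell is replaced by the common bound `n`, so that one constant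
      -- serves all cells.
      refine ⟨max (K * K * (1 + (n + 1) / (1 - δ))) (1 + 4 * K * K),
        le_max_of_le_right (by nlinarith [mul_self_nonneg K]), fun p τ hτ x y => ?_⟩
      have h := (c p.1).dist_slide_le p.2 hδ hτ x y
      have hpos : 0 < 1 - δ := by linarith
      have hle : max (K * K * (1 + ((m p.1 : ℝ) + 1) / (1 - δ))) (1 + 4 * K * K) ≤
          max (K * K * (1 + ((n : ℝ) + 1) / (1 - δ))) (1 + 4 * K * K) := by
        refine max_le_max_right _ (mul_le_mul_of_nonneg_left ?_ (mul_self_nonneg K))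
        have : (m p.1 : ℝ) ≤ n := by exact_mod_cast hm p.1
        gcongr
      exact ⟨h.1.trans (mul_le_mul_of_nonneg_right hle dist_nonneg),
        h.2.trans (mul_le_mul_of_nonneg_right hle dist_nonneg)⟩ }

end Cell

/-! ### Charts of Riemannian manifolds are locally almost isometric -/

section RiemannianChart

open Set Bundle Manifold MeasureTheory
open scoped ENNReal NNReal

variable {E : Type*} [NormedAddCommGroup E] [NormedSpace ℝ E]
  {H : Type*} [TopologicalSpace H] (I : ModelWithCorners ℝ E H)
  {M : Type*} [PseudoEMetricSpace M] [ChartedSpace H M] [IsManifold I 1 M]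
  [RiemannianBundle (fun x : M => TangentSpace I x)]
  [IsContinuousRiemannianBundle E (fun x : M => TangentSpace I x)]
  [IsRiemannianManifold I M]
  {F : Type*} [NormedAddCommGroup F] [NormedSpace ℝ F]

attribute [local instance] normedAddCommGroupTangentSpaceVectorSpace
attribute [local instance] normedSpaceTangentSpaceVectorSpace

-- The norm `‖B ·‖` is the Riemannian norm at `p` read in the trivialization, so at `p` itself the
-- comparison is isometric; continuity of the metric keeps the factor below 2 nearby.
omit [IsRiemannianManifold I M] in
lemma eventually_norm_comp_mfderiv_extChartAt_le (p : M) {B : E →L[ℝ] F}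
    (hB : ∀ v, ‖B v‖ = ‖(trivializationAt E (fun x : M => TangentSpace I x) p).symmL ℝ p v‖) :
    ∀ᶠ y in 𝓝 p, ∀ w : TangentSpace I y,
      ‖B (mfderiv I 𝓘(ℝ, E) (extChartAt I p) y w)‖ ≤ 2 * ‖w‖ := by
  filter_upwards [eventually_norm_symmL_trivializationAt_self_comp_lt E
    (fun x : M => TangentSpace I x) p one_lt_two, chart_source_mem_nhds H p] with y hy hys w
  refine (hB (mfderiv I 𝓘(ℝ, E) (extChartAt I p) y w)).trans_le ?_
  rw [← TangentBundle.continuousLinearMapAt_trivializationAt hys]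
  exact (ContinuousLinearMap.le_opNorm _ w).trans
    (mul_le_mul_of_nonneg_right hy.le (norm_nonneg _))

omit [IsRiemannianManifold I M] in
lemma eventually_norm_mfderivWithin_symm_extChartAt_le (p : M) {B : E →L[ℝ] F}
    (hB : ∀ v, ‖B v‖ = ‖(trivializationAt E (fun x : M => TangentSpace I x) p).symmL ℝ p v‖) :
    ∀ᶠ z in 𝓝[range I] (extChartAt I p p), ∀ v : E,
      ‖mfderivWithin 𝓘(ℝ, E) I (extChartAt I p).symm (range I) z v‖ ≤ 2 * ‖B v‖ := by
  have key : ∀ᶠ y in 𝓝 p, ∀ v : E,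
      ‖mfderivWithin 𝓘(ℝ, E) I (extChartAt I p).symm (range I) (extChartAt I p y) v‖ ≤
        2 * ‖B v‖ := by
    filter_upwards [eventually_norm_symmL_trivializationAt_comp_self_lt E
      (fun x : M => TangentSpace I x) p one_lt_two, chart_source_mem_nhds H p] with y hy hys v
    have hA : (extChartAt I p).symm (extChartAt I p y) = y :=
      (extChartAt I p).left_inv (by simpa using hys)
    have h1 := (ContinuousLinearMap.le_opNorm _
      ((trivializationAt E (fun x : M => TangentSpace I x) p).symmL ℝ p v)).trans
      (mul_le_mul_of_nonneg_right hy.le (norm_nonneg _))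
    rw [← hB, ContinuousLinearMap.comp_apply,
      Trivialization.continuousLinearMapAt_symmL _ (FiberBundle.mem_baseSet_trivializationAt' p),
      TangentBundle.symmL_trivializationAt hys] at h1
    convert! h1 using 2
    congr
  have hp : 𝓝 p = 𝓝 ((extChartAt I p).symm (extChartAt I p p)) := by simp
  rw [hp] at key
  have hcont : ContinuousAt (extChartAt I p).symm (extChartAt I p p) := continuousAt_extChartAt_symm _
  filter_upwards [nhdsWithin_le_nhds (hcont.preimage_mem_nhds key),
    extChartAt_target_mem_nhdsWithin p] with z hz hz'
  have hzz : (extChartAt I p) ((extChartAt I p).symm z) = z := (extChartAt I p).right_inv hz'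
  simp only [preimage_ofPred_eq, mem_ofPred_eq] at hz
  rwa [hzz] at hz

/-- The distance is at most the length of the preimage of the straight segment in the chart. The
segment stays in the chart because `range I` is convex, also at boundary points. -/
lemma eventually_edist_le_extChartAt (p : M) {B : E →L[ℝ] F}
    (hB : ∀ v, ‖B v‖ = ‖(trivializationAt E (fun x : M => TangentSpace I x) p).symmL ℝ p v‖) :
    ∃ U ∈ 𝓝 p, ∀ x ∈ U, ∀ y ∈ U,
      edist x y ≤ 2 * ‖B (extChartAt I p y - extChartAt I p x)‖ₑ := by
  obtain ⟨r, r_pos, hr⟩ : ∃ r > 0,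
      Metric.ball (extChartAt I p p) r ∩ range I ⊆ (extChartAt I p).target ∩
        {z | ∀ v : E, ‖mfderivWithin 𝓘(ℝ, E) I (extChartAt I p).symm (range I) z v‖ ≤
          2 * ‖B v‖} :=
    Metric.mem_nhdsWithin_iff.1 (Filter.inter_mem (extChartAt_target_mem_nhdsWithin p)
      (eventually_norm_mfderivWithin_symm_extChartAt_le I p hB))
  have A : (extChartAt I p) ⁻¹' (Metric.ball (extChartAt I p p) r ∩ range I) ∈ 𝓝 p := by
    apply extChartAt_preimage_mem_nhds_of_mem_nhdsWithin (by simp)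
    rw [inter_comm]
    exact inter_mem_nhdsWithin _ (Metric.ball_mem_nhds _ r_pos)
  refine ⟨_, Filter.inter_mem A (chart_source_mem_nhds H p), fun x hx y hy => ?_⟩
  let η := ContinuousAffineMap.lineMap (R := ℝ) (extChartAt I p x) (extChartAt I p y)
  set γ := (extChartAt I p).symm ∘ η
  have hη : Icc 0 1 ⊆ ⇑η ⁻¹' ((extChartAt I p).target ∩
        {z | ∀ v : E, ‖mfderivWithin 𝓘(ℝ, E) I (extChartAt I p).symm (range I) z v‖ ≤
          2 * ‖B v‖}) := by
    simp only [← image_subset_iff, ContinuousAffineMap.coe_lineMap_eq,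
     ← segment_eq_image_lineMap, η]
    apply Subset.trans _ hr
    exact ((convex_ball _ _).inter I.convex_range).segment_subset hx.1 hy.1
  simp only [preimage_inter, subset_inter_iff] at hη
  have η_smooth : ContMDiffOn 𝓘(ℝ, ℝ) 𝓘(ℝ, E) 1 η (Icc 0 1) := by
    apply ContMDiff.contMDiffOn
    rw [contMDiff_iff_contDiff]
    exact ContinuousAffineMap.contDiff _
  rw [IsRiemannianManifold.out (I := I) x y]
  have hle : riemannianEDist I x y ≤ pathELength I γ 0 1 := by
    apply riemannianEDist_le_pathELength _ _ _ zero_le_one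
    · exact (contMDiffOn_extChartAt_symm p).comp η_smooth hη.1
    · simp [γ, η, ContinuousAffineMap.coe_lineMap_eq, hx.2]
    · simp [γ, η, ContinuousAffineMap.coe_lineMap_eq, hy.2]
  apply hle.trans
  rw [pathELength_eq_lintegral_mfderivWithin_Icc]
  have hc : ∫⁻ _ in Icc (0 : ℝ) 1, 2 * ‖B (extChartAt I p y - extChartAt I p x)‖ₑ =
      2 * ‖B (extChartAt I p y - extChartAt I p x)‖ₑ := by simp
  rw [← hc]
  apply setLIntegral_mono' measurableSet_Icc (fun t ht ↦ ?_)
  have h1 : mfderivWithin 𝓘(ℝ, ℝ) I γ (Icc 0 1) t =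
      (mfderivWithin 𝓘(ℝ, E) I (extChartAt I p).symm (range I) (η t)) ∘L
        (mfderivWithin 𝓘(ℝ, ℝ) 𝓘(ℝ, E) η (Icc 0 1) t) := by
    apply mfderivWithin_comp
    · exact mdifferentiableWithinAt_extChartAt_symm (hη.1 ht)
    · exact η_smooth.mdifferentiableOn one_ne_zero t ht
    · exact hη.1.trans (preimage_mono (extChartAt_target_subset_range p))
    · rw [uniqueMDiffWithinAt_iff_uniqueDiffWithinAt]
      exact uniqueDiffOn_Icc zero_lt_one t ht
  have h2 : mfderivWithin 𝓘(ℝ, ℝ) I γ (Icc 0 1) t 1 =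
      (mfderivWithin 𝓘(ℝ, E) I (extChartAt I p).symm (range I) (η t))
        (mfderivWithin 𝓘(ℝ, ℝ) 𝓘(ℝ, E) η (Icc 0 1) t 1) := congr($h1 1)
  have h3 : mfderivWithin 𝓘(ℝ, ℝ) 𝓘(ℝ, E) η (Icc 0 1) t 1 =
      extChartAt I p y - extChartAt I p x := by
    have h5 : ∀ a b : E, fderiv ℝ (ContinuousAffineMap.lineMap (R := ℝ) a b) t 1 = b - a :=
      fun a b => by simp
    rw [mfderivWithin_eq_fderivWithin, fderivWithin_eq_fderiv (uniqueDiffOn_Icc zero_lt_one _ ht)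
      (ContinuousAffineMap.differentiableAt _)]
    exact h5 _ _
  rw [h2, h3]
  have h4 := hη.2 ht (extChartAt I p y - extChartAt I p x)
  rw [← ofReal_norm, ← ofReal_norm, ← ENNReal.ofReal_ofNat 2,
    ← ENNReal.ofReal_mul zero_le_two]
  exact ENNReal.ofReal_le_ofReal h4

/-- A path of almost minimal length between points within `ρ / 3` of `p` has length below `2ρ / 3`,
so it stays in the ball of radius `ρ`, where the derivative of the chart is controlled. Integrating
its speed bounds the displacement in the chart. -/
lemma eventually_extChartAt_le_edist (p : M) {B : E →L[ℝ] F}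
    (hB : ∀ v, ‖B v‖ = ‖(trivializationAt E (fun x : M => TangentSpace I x) p).symmL ℝ p v‖) :
    ∃ U ∈ 𝓝 p, ∀ x ∈ U, ∀ y ∈ U,
      ‖B (extChartAt I p y - extChartAt I p x)‖ₑ ≤ 2 * edist x y := by
  obtain ⟨ρ, hρ, hball⟩ := EMetric.mem_nhds_iff.1
    (Filter.inter_mem (eventually_norm_comp_mfderiv_extChartAt_le I p hB)
      (chart_source_mem_nhds H p))
  have hρ3 : 0 < ρ / 3 := ENNReal.div_pos hρ.ne' (by simp)
  refine ⟨_, Metric.eball_mem_nhds p hρ3, fun x hx y hy => ?_⟩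
  have hxy : edist x y < ρ / 3 + ρ / 3 := by
    refine (edist_triangle_right x y p).trans_lt (ENNReal.add_lt_add ?_ ?_)
    · exact hx
    · exact hy
  have h3 : ρ / 3 + (ρ / 3 + ρ / 3) = ρ := by rw [← add_assoc]; exact ENNReal.add_thirds ρ
  rw [mul_comm, ← ENNReal.div_le_iff_le_mul (b := 2) (Or.inl (by simp)) (Or.inl (by simp))]
  refine le_of_forall_gt fun r' hr' => ?_
  obtain ⟨r, hr, hrr', hr2⟩ : ∃ r, edist x y < r ∧ r ≤ r' ∧ r ≤ ρ / 3 + ρ / 3 :=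
    ⟨min r' (ρ / 3 + ρ / 3), lt_min hr' hxy, min_le_left _ _, min_le_right _ _⟩
  rw [IsRiemannianManifold.out (I := I) x y] at hr
  obtain ⟨γ, hγx, hγy, γ_smooth, hγ⟩ := exists_lt_of_riemannianEDist_lt hr
  refine lt_of_le_of_lt ?_ (hγ.trans_le hrr')
  rw [ENNReal.div_le_iff_le_mul (b := 2) (Or.inl (by simp)) (Or.inl (by simp))]
  have hmem : ∀ t ∈ Icc (0 : ℝ) 1, γ t ∈ {y | ∀ w : TangentSpace I y,
      ‖B (mfderiv I 𝓘(ℝ, E) (extChartAt I p) y w)‖ ≤ 2 * ‖w‖} ∩ (chartAt H p).source := by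
    intro t ht
    apply hball
    have h4 : edist x (γ t) ≤ pathELength I γ 0 1 := by
      rw [IsRiemannianManifold.out (I := I) x (γ t)]
      exact (riemannianEDist_le_pathELength
        (γ_smooth.mono (Icc_subset_Icc_right ht.2)) hγx rfl ht.1).trans
        (pathELength_mono le_rfl ht.2)
    have h5 : edist p x < ρ / 3 := by rw [edist_comm]; exact hx
    have h6 : edist (γ t) p < ρ := by
      rw [edist_comm, ← h3]
      exact (edist_triangle p x (γ t)).trans_lt
        (ENNReal.add_lt_add h5 (h4.trans_lt (hγ.trans_le hr2)))
    exact h6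
  let γ' : ℝ → F := fun t => B (extChartAt I p (γ t))
  have hfγ : ContMDiffOn 𝓘(ℝ, ℝ) 𝓘(ℝ, E) 1 (extChartAt I p ∘ γ) (Icc 0 1) :=
    contMDiffOn_extChartAt.comp (I' := I) (t := (chartAt H p).source)
      γ_smooth (fun t' ht' ↦ (hmem t' ht').2)
  have hγ'd : ContDiffOn ℝ 1 γ' (Icc 0 1) :=
    B.contDiff.comp_contDiffOn (contMDiffOn_iff_contDiffOn.1 hfγ)
  have hd : ∀ t ∈ Icc (0 : ℝ) 1, ‖derivWithin γ' (Icc 0 1) t‖ₑ ≤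
      2 * ‖mfderivWithin 𝓘(ℝ, ℝ) I γ (Icc 0 1) t 1‖ₑ := by
    intro t ht
    have hu : UniqueDiffWithinAt ℝ (Icc (0 : ℝ) 1) t := uniqueDiffOn_Icc zero_lt_one t ht
    have h1 : mfderivWithin 𝓘(ℝ, ℝ) 𝓘(ℝ, E) (extChartAt I p ∘ γ) (Icc 0 1) t =
        (mfderiv I 𝓘(ℝ, E) (extChartAt I p) (γ t)) ∘L
          (mfderivWithin 𝓘(ℝ, ℝ) I γ (Icc 0 1) t) := by
      apply mfderiv_comp_mfderivWithin
      · exact mdifferentiableAt_extChartAt (hmem t ht).2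
      · exact γ_smooth.mdifferentiableOn one_ne_zero _ ht
      · rwa [uniqueMDiffWithinAt_iff_uniqueDiffWithinAt]
    have h2 : mfderivWithin 𝓘(ℝ, ℝ) 𝓘(ℝ, E) (extChartAt I p ∘ γ) (Icc 0 1) t 1 =
        (mfderiv I 𝓘(ℝ, E) (extChartAt I p) (γ t))
          (mfderivWithin 𝓘(ℝ, ℝ) I γ (Icc 0 1) t 1) := congr($h1 1)
    have h4 : derivWithin γ' (Icc 0 1) t =
        B (mfderivWithin 𝓘(ℝ, ℝ) 𝓘(ℝ, E) (extChartAt I p ∘ γ) (Icc 0 1) t 1) := by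
      rw [mfderivWithin_eq_fderivWithin, ← fderivWithin_derivWithin]
      have hdiff : DifferentiableWithinAt ℝ (extChartAt I p ∘ γ) (Icc 0 1) t :=
        ((contMDiffOn_iff_contDiffOn.1 hfγ).differentiableOn one_ne_zero) t ht
      exact congr($((B.hasFDerivAt.comp_hasFDerivWithinAt t
        hdiff.hasFDerivWithinAt).fderivWithin hu) 1)
    rw [h4, h2]
    have h5 := (hmem t ht).1 (mfderivWithin 𝓘(ℝ, ℝ) I γ (Icc 0 1) t 1)
    rw [← ofReal_norm, ← ofReal_norm, ← ENNReal.ofReal_ofNat 2,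
      ← ENNReal.ofReal_mul zero_le_two]
    exact ENNReal.ofReal_le_ofReal h5
  calc ‖B (extChartAt I p y - extChartAt I p x)‖ₑ = ‖γ' 1 - γ' 0‖ₑ := by
        simp only [γ', hγx, hγy, map_sub]
    _ ≤ ∫⁻ t in Icc 0 1, ‖derivWithin γ' (Icc 0 1) t‖ₑ :=
        enorm_sub_le_lintegral_derivWithin_Icc_of_contDiffOn_Icc hγ'd zero_le_one
    _ ≤ ∫⁻ t in Icc 0 1, 2 * ‖mfderivWithin 𝓘(ℝ, ℝ) I γ (Icc 0 1) t 1‖ₑ :=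
        setLIntegral_mono' measurableSet_Icc hd
    _ = pathELength I γ 0 1 * 2 := by
        rw [lintegral_const_mul' _ _ (by simp), ← pathELength_eq_lintegral_mfderivWithin_Icc,
          mul_comm]

end RiemannianChart

/-! ### Charts normalized by a linear map to be nearly isometric at a point -/

section AlmostIsometricChart

open Set Bundle

variable {n : ℕ} {H : Type*} [TopologicalSpace H]
  (I : ModelWithCorners ℝ (EuclideanSpace ℝ (Fin n)) H)
  {M : Type*} [MetricSpace M] [ChartedSpace H M] [IsManifold I ∞ M]
  [RiemannianBundle (fun x : M => TangentSpace I x)]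
  [IsContMDiffRiemannianBundle I ∞ (EuclideanSpace ℝ (Fin n)) (fun x : M => TangentSpace I x)]
  [IsRiemannianManifold I M]

/-- After a linear change of coordinates, the chart at `p` distorts distances near `p` at most by
the factor `2`. -/
theorem exists_almost_isometric_chart (p : M) :
    ∃ B : EuclideanSpace ℝ (Fin n) ≃L[ℝ] EuclideanSpace ℝ (Fin n), ∃ U ∈ 𝓝 p, ∀ x ∈ U, ∀ y ∈ U,
      dist x y ≤ 2 * ‖B (extChartAt I p x) - B (extChartAt I p y)‖ ∧
      ‖B (extChartAt I p x) - B (extChartAt I p y)‖ ≤ 2 * dist x y := by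
  have : IsContinuousRiemannianBundle (EuclideanSpace ℝ (Fin n))
    (fun x : M => TangentSpace I x) :=  by
    obtain ⟨g, hg, h⟩ := IsContMDiffRiemannianBundle.exists_contMDiff (IB := I) (n := ∞)
      (F := EuclideanSpace ℝ (Fin n)) (E := fun x : M => TangentSpace I x)
    exact ⟨g, hg.continuous, h⟩
  have hfr : Module.finrank ℝ (TangentSpace I p) = n := by
    change Module.finrank ℝ (EuclideanSpace ℝ (Fin n)) = n
    simp
  have : FiniteDimensional ℝ (TangentSpace I p) :=
    inferInstanceAs (FiniteDimensional ℝ (EuclideanSpace ℝ (Fin n)))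
  let b : OrthonormalBasis (Fin n) ℝ (TangentSpace I p) :=
    (stdOrthonormalBasis ℝ (TangentSpace I p)).reindex (finCongr hfr)
  let t := trivializationAt (EuclideanSpace ℝ (Fin n)) (fun x : M => TangentSpace I x) p
  let L : EuclideanSpace ℝ (Fin n) ≃L[ℝ] TangentSpace I p :=
    (t.continuousLinearEquivAt ℝ p (FiberBundle.mem_baseSet_trivializationAt' p)).symm
  -- Orthonormal coordinates of the tangent space at `p` turn its Riemannian norm into the Euclidean
  -- norm.
  let B : EuclideanSpace ℝ (Fin n) ≃L[ℝ] EuclideanSpace ℝ (Fin n) :=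
    L.trans b.repr.toContinuousLinearEquiv
  have hB : ∀ v, ‖(B : EuclideanSpace ℝ (Fin n) →L[ℝ] EuclideanSpace ℝ (Fin n)) v‖ =
      ‖t.symmL ℝ p v‖ := by
    intro v
    have hL : L v = t.symmL ℝ p v := congrFun (Trivialization.symm_continuousLinearEquivAt_eq t
      (FiberBundle.mem_baseSet_trivializationAt' p)) v
    rw [← hL]
    exact b.repr.norm_map (L v)
  obtain ⟨U, hU, h₁⟩ := eventually_edist_le_extChartAt I p hB
  obtain ⟨V, hV, h₂⟩ := eventually_extChartAt_le_edist I p hB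
  have e2 : ∀ r : ℝ, (2 : ENNReal) * ENNReal.ofReal r = ENNReal.ofReal (2 * r) := fun r => by
    rw [ENNReal.ofReal_mul zero_le_two, ENNReal.ofReal_ofNat]
  refine ⟨B, U ∩ V, Filter.inter_mem hU hV, fun x hx y hy => ?_⟩
  have k₁ := h₁ x hx.1 y hy.1
  have k₂ := h₂ x hx.2 y hy.2
  rw [edist_dist, ← ofReal_norm, e2, ENNReal.ofReal_le_ofReal_iff (by positivity)] at k₁ k₂
  rw [norm_sub_rev, ← map_sub]
  exact ⟨k₁, k₂⟩

end AlmostIsometricChart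

/-! ### Strict differentiability along convex sets -/

section StrictDeriv

open Set

variable {F E : Type*} [NormedAddCommGroup F] [NormedSpace ℝ F] [NormedAddCommGroup E]
  [NormedSpace ℝ E]

/-- The mean value inequality on the convex set `S` near `z` upgrades the derivative at `z` to a
strict one. -/
lemma exists_approximatesLinearOn_of_convex {g : F → E} {S : Set F} (hS : Convex ℝ S) {z : F}
    (hz : z ∈ S) (hg : ContDiffWithinAt ℝ 1 g S z) :
    ∃ D : F →L[ℝ] E, HasFDerivWithinAt g D S z ∧ ∀ ε > 0, ∃ U ∈ 𝓝 z, ∀ x ∈ S ∩ U, ∀ y ∈ S ∩ U,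
      ‖g x - g y - D (x - y)‖ ≤ ε * ‖x - y‖ := by
  obtain ⟨u, hu, -, f', hf', hc⟩ :=
    (contDiffWithinAt_succ_iff_hasFDerivWithinAt (n := 0) (by simp)).1 hg
  rw [insert_eq_of_mem hz] at hu
  obtain ⟨O, hO, hOu⟩ := mem_nhdsWithin_iff_exists_mem_nhds_inter.1 hu
  have hzu : z ∈ u := hOu ⟨mem_of_mem_nhds hO, hz⟩
  refine ⟨f' z, (hf' z hzu).mono_of_mem_nhdsWithin hu, fun ε hε => ?_⟩
  have h1 : ∀ᶠ x in 𝓝[u] z, ‖f' x - f' z‖ < ε := by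
    have := hc.continuousWithinAt (Metric.ball_mem_nhds _ hε)
    filter_upwards [this] with x hx
    rwa [mem_preimage, mem_ball_iff_norm] at hx
  obtain ⟨O', hO', hOu'⟩ := mem_nhdsWithin_iff_exists_mem_nhds_inter.1 h1
  obtain ⟨δ, hδ, hball⟩ := Metric.mem_nhds_iff.1 (Filter.inter_mem hO hO')
  have hsub : S ∩ Metric.ball z δ ⊆ u := fun x hx => hOu ⟨(hball hx.2).1, hx.1⟩
  refine ⟨Metric.ball z δ, Metric.ball_mem_nhds _ hδ, fun x hx y hy => ?_⟩
  refine (hS.inter (convex_ball z δ)).norm_image_sub_le_of_norm_hasFDerivWithin_le'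
    (fun w hw => (hf' w (hsub hw)).mono hsub)
    (fun w hw => (hOu' ⟨(hball hw.2).2, hsub hw⟩ : ‖f' w - f' z‖ < ε).le) hy hx

/-- By convexity every vector from `z` to a point of `S` is a tangent direction at `z`, and these
vectors span. -/
lemma HasFDerivWithinAt.eq_on_vectorSpan {g : F → E} {S : Set F} (hS : Convex ℝ S) {z : F}
    (hz : z ∈ S) {D D' : F →L[ℝ] E} (hD : HasFDerivWithinAt g D S z)
    (hD' : HasFDerivWithinAt g D' S z) {v : F} (hv : v ∈ vectorSpan ℝ S) : D v = D' v := by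
  rw [vectorSpan_eq_span_vsub_set_right ℝ hz] at hv
  have h : EqOn D D' ((· -ᵥ z) '' S) := by
    rintro _ ⟨x, hx, rfl⟩
    refine hD.unique_on hD' ?_
    exact mem_tangentConeAt_of_segment_subset (by simpa using hS.segment_subset hz hx)
  exact LinearMap.eqOn_span (f := (D : F →ₗ[ℝ] E)) (g := (D' : F →ₗ[ℝ] E)) h hv

lemma exists_antilipschitz_of_injective [FiniteDimensional ℝ F] {D : F →L[ℝ] E}
    {V : Submodule ℝ F} (hD : ∀ v ∈ V, D v = 0 → v = 0) :
    ∃ c > 0, ∀ v ∈ V, c * ‖v‖ ≤ ‖D v‖ := by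
  obtain ⟨K, hK, h⟩ := LinearMap.exists_antilipschitzWith ((D : F →ₗ[ℝ] E).domRestrict V)
    (LinearMap.ker_eq_bot'.2 fun v hv => Subtype.ext (hD v v.2 hv))
  refine ⟨(K : ℝ)⁻¹, by positivity, fun v hv => ?_⟩
  have := h.le_mul_dist ⟨v, hv⟩ 0
  simp only [map_zero, dist_zero_right] at this
  rw [inv_mul_le_iff₀ (by positivity)]
  exact this

end StrictDeriv

/-! ### Diameters of continua -/

section ChainDiam

open Set MeasureTheory

/-- The function distance-to-`x` is 1-Lipschitz and maps the connected set `A` onto a set containing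
`[0, dist y x]`. The images of the pieces cover this interval, and each has Lebesgue measure at most
the diameter of its piece. -/
lemma IsPreconnected.diam_le_sum {M ι : Type*} [MetricSpace M] {A : Set M} (hA : IsPreconnected A)
    (hc : IsCompact A) (J : Finset ι) {S : ι → Set M} (hS : A ⊆ ⋃ j ∈ J, S j) :
    Metric.diam A ≤ ∑ j ∈ J, Metric.diam (A ∩ S j) := by
  have hnn : 0 ≤ ∑ j ∈ J, Metric.diam (A ∩ S j) := Finset.sum_nonneg fun _ _ => Metric.diam_nonneg
  refine Metric.diam_le_of_forall_dist_le hnn fun x hx y hy => ?_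
  have hI : Icc 0 (dist y x) ⊆ ⋃ j ∈ J, (fun z => dist z x) '' (A ∩ S j) := by
    have h1 := (hA.image (fun z => dist z x) (by fun_prop)).Icc_subset
      (mem_image_of_mem _ hx) (mem_image_of_mem _ hy)
    rw [dist_self] at h1
    rintro t ht
    obtain ⟨z, hz, rfl⟩ := h1 ht
    obtain ⟨j, hj, hzj⟩ := mem_iUnion₂.1 (hS hz)
    exact mem_iUnion₂.2 ⟨j, hj, z, ⟨hz, hzj⟩, rfl⟩
  have h2 : ENNReal.ofReal (dist y x) ≤ ∑ j ∈ J, ENNReal.ofReal (Metric.diam (A ∩ S j)) := by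
    calc ENNReal.ofReal (dist y x) = volume (Icc 0 (dist y x)) := by simp
      _ ≤ volume (⋃ j ∈ J, (fun z => dist z x) '' (A ∩ S j)) := measure_mono hI
      _ ≤ ∑ j ∈ J, volume ((fun z => dist z x) '' (A ∩ S j)) := measure_biUnion_finset_le _ _
      _ ≤ _ := Finset.sum_le_sum fun j _ => by
        refine (Real.volume_le_diam _).trans ?_
        have h3 := (LipschitzWith.dist_left x).ediam_image_le (A ∩ S j)
        rw [ENNReal.coe_one, one_mul] at h3
        refine h3.trans ?_
        rw [Metric.diam, ENNReal.ofReal_toReal]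
        exact (hc.isBounded.subset inter_subset_left).ediam_ne_top
  rw [← ENNReal.ofReal_sum_of_nonneg fun _ _ => Metric.diam_nonneg,
    ENNReal.ofReal_le_ofReal_iff hnn] at h2
  rwa [dist_comm]

end ChainDiam

/-! ### Local geometry of a triangulation -/

section TriangulationGeometry

open Set Bundle

variable {n : ℕ} {H : Type*} [TopologicalSpace H]
  {I : ModelWithCorners ℝ (EuclideanSpace ℝ (Fin n)) H}
  {M : Type*} [MetricSpace M] [ChartedSpace H M]

namespace C1Triangulation

lemma toFun_continuousOn (T : C1Triangulation I M) : ContinuousOn T.toFun T.K.space := by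
  rw [continuousOn_iff_continuous_domRestrict]
  refine T.homeo.continuous.congr fun x => ?_
  exact (T.toFun_eq x).symm

/-- The inverse of the triangulation, as a map into the ambient Euclidean space. -/
def embed (T : C1Triangulation I M) (x : M) : EuclideanSpace ℝ (Fin T.N) := T.homeo.symm x

lemma continuous_embed (T : C1Triangulation I M) : Continuous T.embed :=
  continuous_subtype_val.comp T.homeo.symm.continuous

lemma embed_injective (T : C1Triangulation I M) : Function.Injective T.embed :=
  Subtype.val_injective.comp T.homeo.symm.injective

lemma embed_mem (T : C1Triangulation I M) (x : M) : T.embed x ∈ T.K.space :=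
  (T.homeo.symm x).2

lemma toFun_embed (T : C1Triangulation I M) (x : M) : T.toFun (T.embed x) = x := by
  rw [embed, T.toFun_eq, T.homeo.apply_symm_apply]

lemma embed_toFun (T : C1Triangulation I M) {y} (hy : y ∈ T.K.space) : T.embed (T.toFun y) = y := by
  rw [T.toFun_eq ⟨y, hy⟩, embed, T.homeo.symm_apply_apply]

lemma convexHull_subset_space (T : C1Triangulation I M) {s} (hs : s ∈ T.K.faces) :
    convexHull ℝ (s : Set (EuclideanSpace ℝ (Fin T.N))) ⊆ T.K.space :=
  fun _ hx => Geometry.SimplicialComplex.mem_space_iff.2 ⟨s, hs, hx⟩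

/-- The derivative furnished by the `C¹` condition and the one in `nondegenerate` may differ as
ambient maps, but they agree along the simplex, so injectivity passes from one to the other. -/
lemma exists_deriv [IsManifold I 1 M] (T : C1Triangulation I M) {s} (hs : s ∈ T.K.faces) {z}
    (hz : z ∈ convexHull ℝ (s : Set (EuclideanSpace ℝ (Fin T.N)))) :
    ∃ D : EuclideanSpace ℝ (Fin T.N) →L[ℝ] EuclideanSpace ℝ (Fin n),
      (∀ v ∈ vectorSpan ℝ (s : Set (EuclideanSpace ℝ (Fin T.N))), D v = 0 → v = 0) ∧
      ∀ ε > 0, ∃ U ∈ 𝓝 z, ∀ x ∈ convexHull ℝ (s : Set (EuclideanSpace ℝ (Fin T.N))) ∩ U,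
        ∀ y ∈ convexHull ℝ (s : Set (EuclideanSpace ℝ (Fin T.N))) ∩ U,
        ‖extChartAt I (T.toFun z) (T.toFun x) - extChartAt I (T.toFun z) (T.toFun y) -
          D (x - y)‖ ≤ ε * ‖x - y‖ := by
  have h1 := (contMDiffWithinAt_iff.1 (T.contMDiffOn s hs z hz)).2
  simp only [mfld_simps] at h1
  obtain ⟨D, hD, hε⟩ := exists_approximatesLinearOn_of_convex (convex_convexHull ℝ _) hz h1
  refine ⟨D, fun v hv h0 => ?_, hε⟩
  obtain ⟨D', hD', hinj⟩ := T.nondegenerate s hs z hz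
  have h2 := hD'.2
  simp only [mfld_simps] at h2
  refine hinj v hv ?_
  have hv' : v ∈ vectorSpan ℝ (convexHull ℝ (s : Set (EuclideanSpace ℝ (Fin T.N)))) :=
    vectorSpan_mono ℝ (subset_convexHull ℝ _) hv
  exact (HasFDerivWithinAt.eq_on_vectorSpan (convex_convexHull ℝ _) hz h2 hD hv').trans h0

variable [IsManifold I ∞ M]
  [RiemannianBundle (fun x : M => TangentSpace I x)]
  [IsContMDiffRiemannianBundle I ∞ (EuclideanSpace ℝ (Fin n)) (fun x : M => TangentSpace I x)]
  [IsRiemannianManifold I M]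

/-- Near a point of a closed simplex, the triangulation is, up to the factor `2`, metrically close
to an injective linear map. -/
lemma exists_almost_linear (T : C1Triangulation I M) {s} (hs : s ∈ T.K.faces) {z}
    (hz : z ∈ convexHull ℝ (s : Set (EuclideanSpace ℝ (Fin T.N)))) :
    ∃ D : EuclideanSpace ℝ (Fin T.N) →L[ℝ] EuclideanSpace ℝ (Fin n),
      (∀ v ∈ vectorSpan ℝ (s : Set (EuclideanSpace ℝ (Fin T.N))), D v = 0 → v = 0) ∧
      ∀ ε > 0, ∃ U ∈ 𝓝 z, ∀ x ∈ convexHull ℝ (s : Set (EuclideanSpace ℝ (Fin T.N))) ∩ U,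
        ∀ y ∈ convexHull ℝ (s : Set (EuclideanSpace ℝ (Fin T.N))) ∩ U,
        dist (T.toFun x) (T.toFun y) ≤ 2 * (‖D (x - y)‖ + ε * ‖x - y‖) ∧
        ‖D (x - y)‖ ≤ 2 * dist (T.toFun x) (T.toFun y) + ε * ‖x - y‖ := by
  have : IsManifold I 1 M := IsManifold.of_le (n := ∞) (by simp)
  obtain ⟨D, hinj, hD⟩ := T.exists_deriv hs hz
  obtain ⟨B, W, hW, hB⟩ := exists_almost_isometric_chart I (T.toFun z)
  refine ⟨(B : EuclideanSpace ℝ (Fin n) →L[ℝ] EuclideanSpace ℝ (Fin n)).comp D,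
    fun v hv h0 => hinj v hv (by simpa using h0), fun ε hε => ?_⟩
  set b := ‖(B : EuclideanSpace ℝ (Fin n) →L[ℝ] EuclideanSpace ℝ (Fin n))‖
  have hb : 0 ≤ b := norm_nonneg _
  obtain ⟨U, hU, h⟩ := hD (ε / (b + 1)) (by positivity)
  have hc : ContinuousWithinAt T.toFun (convexHull ℝ (s : Set (EuclideanSpace ℝ (Fin T.N)))) z :=
    (T.toFun_continuousOn.mono (T.convexHull_subset_space hs)) z hz
  obtain ⟨U', hU', h'⟩ := mem_nhdsWithin_iff_exists_mem_nhds_inter.1 (hc hW)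
  refine ⟨U ∩ U', Filter.inter_mem hU hU', fun x hx y hy => ?_⟩
  obtain ⟨h1, h2⟩ := hB _ (h' ⟨hx.2.2, hx.1⟩) _ (h' ⟨hy.2.2, hy.1⟩)
  have h3 := h x ⟨hx.1, hx.2.1⟩ y ⟨hy.1, hy.2.1⟩
  have h4 : ‖B (extChartAt I (T.toFun z) (T.toFun x)) - B (extChartAt I (T.toFun z) (T.toFun y)) -
      B (D (x - y))‖ ≤ ε * ‖x - y‖ := by
    rw [← map_sub, ← map_sub]
    refine (ContinuousLinearMap.le_opNorm
      (B : EuclideanSpace ℝ (Fin n) →L[ℝ] EuclideanSpace ℝ (Fin n)) _).trans ?_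
    calc b * _ ≤ b * (ε / (b + 1) * ‖x - y‖) := by gcongr
      _ ≤ (b + 1) * (ε / (b + 1) * ‖x - y‖) := by gcongr; linarith
      _ = ε * ‖x - y‖ := by field_simp
  have h5 := norm_sub_norm_le (B (extChartAt I (T.toFun z) (T.toFun x)) -
    B (extChartAt I (T.toFun z) (T.toFun y))) (B (D (x - y)))
  have h6 := norm_sub_norm_le (B (D (x - y))) (B (extChartAt I (T.toFun z) (T.toFun x)) -
    B (extChartAt I (T.toFun z) (T.toFun y)))
  rw [norm_sub_rev (B (D (x - y)))] at h6
  simp only [ContinuousLinearMap.comp_apply, ContinuousLinearEquiv.coe_coe]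
  constructor <;> linarith

/-- The triangulation is locally bi-Lipschitz on each closed simplex. -/
lemma exists_bilip (T : C1Triangulation I M) {s} (hs : s ∈ T.K.faces) {z}
    (hz : z ∈ convexHull ℝ (s : Set (EuclideanSpace ℝ (Fin T.N)))) :
    ∃ C > 0, ∃ U ∈ 𝓝 z, ∀ x ∈ convexHull ℝ (s : Set (EuclideanSpace ℝ (Fin T.N))) ∩ U,
        ∀ y ∈ convexHull ℝ (s : Set (EuclideanSpace ℝ (Fin T.N))) ∩ U,
        dist (T.toFun x) (T.toFun y) ≤ C * dist x y ∧
          dist x y ≤ C * dist (T.toFun x) (T.toFun y) := by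
  obtain ⟨D, hinj, hD⟩ := T.exists_almost_linear hs hz
  obtain ⟨c, hc, hcv⟩ := exists_antilipschitz_of_injective hinj
  -- An error of half the lower bound `c` of `D` leaves `c / 2` for the lower estimate.
  obtain ⟨U, hU, h⟩ := hD (c / 2) (by positivity)
  refine ⟨2 * (‖D‖ + c / 2) + 4 / c, by positivity, U, hU, fun x hx y hy => ?_⟩
  obtain ⟨h1, h2⟩ := h x hx y hy
  have hv : x - y ∈ vectorSpan ℝ (s : Set (EuclideanSpace ℝ (Fin T.N))) := by
    have := vsub_mem_vectorSpan ℝ hx.1 hy.1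
    rwa [← direction_affineSpan, affineSpan_convexHull, direction_affineSpan] at this
  have h3 := hcv _ hv
  have h4 := D.le_opNorm (x - y)
  rw [← dist_eq_norm] at h1 h2 h3 h4
  have h0 : 0 ≤ dist x y := dist_nonneg
  have h0' : 0 ≤ dist (T.toFun x) (T.toFun y) := dist_nonneg
  have p : (0 : ℝ) < 4 / c := by positivity
  constructor
  · nlinarith
  · have h5 : dist x y ≤ 4 / c * dist (T.toFun x) (T.toFun y) := by
      rw [div_mul_eq_mul_div, le_div_iff₀ hc]
      linarith
    refine h5.trans (mul_le_mul_of_nonneg_right ?_ h0')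
    have := norm_nonneg D
    linarith

lemma isClosed_convexHull_finset {N : ℕ} (s : Finset (EuclideanSpace ℝ (Fin N))) :
    IsClosed (convexHull ℝ (s : Set (EuclideanSpace ℝ (Fin N)))) :=
  (s.finite_toSet.isCompact_convexHull (𝕜 := ℝ)).isClosed

/-- Near `q` finitely many closed simplices occur, and the triangulation is bi-Lipschitz on each. A
continuum has diameter at most the sum over its traces on the simplices, so distances between points
of different simplices never have to be compared. -/
lemma exists_diamComparable (T : C1Triangulation I M) (q : M) :
    ∃ C > 0, ∃ U ∈ 𝓝 q, CellSliders.DiamComparable T.embed C U := by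
  classical
  obtain ⟨U₀, hU₀, hfin⟩ := T.locallyFinite (T.embed q) (T.embed_mem q)
  have hloc : ∀ s : T.K.faces, ∃ C > 0, ∃ U ∈ 𝓝 (T.embed q),
      ∀ x ∈ convexHull ℝ (s.1 : Set (EuclideanSpace ℝ (Fin T.N))) ∩ U,
      ∀ y ∈ convexHull ℝ (s.1 : Set (EuclideanSpace ℝ (Fin T.N))) ∩ U,
        dist (T.toFun x) (T.toFun y) ≤ C * dist x y ∧
          dist x y ≤ C * dist (T.toFun x) (T.toFun y) := by
    rintro ⟨s, hs⟩
    by_cases hq : T.embed q ∈ convexHull ℝ (s : Set (EuclideanSpace ℝ (Fin T.N)))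
    · exact T.exists_bilip hs hq
    -- A simplex missing the point is avoided by a neighbourhood, and the estimate there is vacuous.
    · refine ⟨1, one_pos, _, (isClosed_convexHull_finset s).isOpen_compl.mem_nhds hq, ?_⟩
      rintro x ⟨h1, h2⟩
      exact absurd h1 h2
  choose C hC U hU hb using hloc
  have hfin' : {s : T.K.faces |
      (convexHull ℝ (s.1 : Set (EuclideanSpace ℝ (Fin T.N))) ∩ U₀).Nonempty}.Finite :=
    Finite.of_finite_image (f := Subtype.val) (hfin.subset (by
      rintro _ ⟨s, hs, rfl⟩
      exact ⟨s.2, hs⟩)) Subtype.val_injective.injOn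
  set J := hfin'.toFinset
  have hW : U₀ ∩ ⋂ s ∈ J, U s ∈ 𝓝 (T.embed q) :=
    Filter.inter_mem hU₀ ((Filter.biInter_finset_mem J).2 fun s _ => hU s)
  have hsum : 0 ≤ ∑ s ∈ J, C s := Finset.sum_nonneg fun s _ => (hC s).le
  refine ⟨∑ s ∈ J, C s + 1, by linarith, _,
    T.continuous_embed.continuousAt.preimage_mem_nhds hW, fun A hA hAc hAp => ?_⟩
  have hcov : ∀ x ∈ A, ∃ s ∈ J, T.embed x ∈ convexHull ℝ (s.1 : Set (EuclideanSpace ℝ (Fin T.N))) := by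
    intro x hx
    obtain ⟨s, hs, hxs⟩ := Geometry.SimplicialComplex.mem_space_iff.1 (T.embed_mem x)
    exact ⟨⟨s, hs⟩, hfin'.mem_toFinset.2 ⟨_, hxs, (hA hx).1⟩, hxs⟩
  have hAU : ∀ x ∈ A, ∀ s ∈ J, T.embed x ∈ U s := fun x hx s hs => mem_iInter₂.1 (hA hx).2 s hs
  constructor
  · have h1 := (hAp.image T.embed T.continuous_embed.continuousOn).diam_le_sum
      (hAc.image T.continuous_embed) J
      (S := fun s => convexHull ℝ (s.1 : Set (EuclideanSpace ℝ (Fin T.N)))) (by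
        rintro _ ⟨x, hx, rfl⟩
        obtain ⟨s, hs, hxs⟩ := hcov x hx
        exact mem_iUnion₂.2 ⟨s, hs, hxs⟩)
    refine h1.trans ((Finset.sum_le_sum (g := fun s => C s * Metric.diam A) fun s hs => ?_).trans ?_)
    · refine Metric.diam_le_of_forall_dist_le (mul_nonneg (hC s).le Metric.diam_nonneg) ?_
      rintro _ ⟨⟨x, hx, rfl⟩, hxs⟩ _ ⟨⟨y, hy, rfl⟩, hys⟩
      have h2 := (hb s _ ⟨hxs, hAU x hx s hs⟩ _ ⟨hys, hAU y hy s hs⟩).2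
      rw [toFun_embed, toFun_embed] at h2
      exact h2.trans (mul_le_mul_of_nonneg_left
        (Metric.dist_le_diam_of_mem hAc.isBounded hx hy) (hC s).le)
    · rw [← Finset.sum_mul]
      exact mul_le_mul_of_nonneg_right (by linarith) Metric.diam_nonneg
  · have h1 := hAp.diam_le_sum hAc J
      (S := fun s => T.embed ⁻¹' convexHull ℝ (s.1 : Set (EuclideanSpace ℝ (Fin T.N)))) (by
        intro x hx
        obtain ⟨s, hs, hxs⟩ := hcov x hx
        exact mem_iUnion₂.2 ⟨s, hs, hxs⟩)
    refine h1.trans ((Finset.sum_le_sum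
      (g := fun s => C s * Metric.diam (T.embed '' A)) fun s hs => ?_).trans ?_)
    · refine Metric.diam_le_of_forall_dist_le (mul_nonneg (hC s).le Metric.diam_nonneg) ?_
      rintro x ⟨hx, hxs⟩ y ⟨hy, hys⟩
      have h2 := (hb s _ ⟨hxs, hAU x hx s hs⟩ _ ⟨hys, hAU y hy s hs⟩).1
      rw [toFun_embed, toFun_embed] at h2
      exact h2.trans (mul_le_mul_of_nonneg_left
        (Metric.dist_le_diam_of_mem (hAc.image T.continuous_embed).isBounded
          (mem_image_of_mem _ hx) (mem_image_of_mem _ hy)) (hC s).le)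
    · rw [← Finset.sum_mul]
      exact mul_le_mul_of_nonneg_right (by linarith) Metric.diam_nonneg

end C1Triangulation

end TriangulationGeometry

/-! ### Flat points of a triangulated manifold -/

section FlatPoints

open Set

variable {F : Type*} [NormedAddCommGroup F] [NormedSpace ℝ F]

lemma vectorSpan_convexHull (s : Set F) : vectorSpan ℝ (convexHull ℝ s) = vectorSpan ℝ s := by
  rw [← direction_affineSpan, affineSpan_convexHull, direction_affineSpan]

lemma exists_ball_vectorSpan_subset [FiniteDimensional ℝ F] {S : Set F} (hS : Convex ℝ S)
    (hne : S.Nonempty) :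
    ∃ c ∈ S, ∃ δ > 0, ∀ v ∈ vectorSpan ℝ S, ‖v‖ < δ → c + v ∈ S := by
  obtain ⟨c, hc⟩ := hne.intrinsicInterior hS
  have hcS := intrinsicInterior_subset hc
  obtain ⟨c', hc', rfl⟩ := mem_intrinsicInterior.1 hc
  obtain ⟨δ, hδ, hb⟩ := Metric.mem_nhds_iff.1 (mem_interior_iff_mem_nhds.1 hc')
  refine ⟨c', hcS, δ, hδ, fun v hv hvδ => ?_⟩
  have hv' : (c' : F) + v ∈ affineSpan ℝ S := by
    rw [add_comm]
    exact AffineSubspace.vadd_mem_of_mem_direction (by rwa [direction_affineSpan]) c'.2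
  have := hb (show (⟨_, hv'⟩ : affineSpan ℝ S) ∈ Metric.ball c' δ by
    rw [Metric.mem_ball, Subtype.dist_eq, dist_eq_norm]
    simpa using hvδ)
  exact this

/-- Contract a relatively interior point `c` of `S` towards `x`; a relative ball about `c` shrinks
by the factor `t`. -/
lemma exists_ball_vectorSpan_subset_near [FiniteDimensional ℝ F] {S : Set F} (hS : Convex ℝ S)
    {x : F} (hx : x ∈ S) {U : Set F} (hU : U ∈ 𝓝 x) :
    ∃ y ∈ S ∩ U, ∃ δ > 0, ∀ v ∈ vectorSpan ℝ S, ‖v‖ < δ → y + v ∈ S := by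
  obtain ⟨c, hc, δ, hδ, h⟩ := exists_ball_vectorSpan_subset hS ⟨x, hx⟩
  have ht : Filter.Tendsto (fun t : ℝ => AffineMap.lineMap x c t) (𝓝[>] 0) (𝓝 x) := by
    have : ContinuousAt (fun t : ℝ => AffineMap.lineMap x c t) 0 := by fun_prop
    have h2 := this.tendsto
    simp only [AffineMap.lineMap_apply_zero] at h2
    exact h2.mono_left nhdsWithin_le_nhds
  obtain ⟨t, htU, ht0, ht1⟩ := ((ht.eventually_mem hU).and
    (Ioo_mem_nhdsGT (zero_lt_one (α := ℝ)))).exists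
  refine ⟨_, ⟨?_, htU⟩, t * δ, by positivity, fun v hv hvδ => ?_⟩
  · exact hS.lineMap_mem hx hc ⟨ht0.le, ht1.le⟩
  · have h1 := h (t⁻¹ • v) (Submodule.smul_mem _ _ hv) (by
      rw [norm_smul, norm_inv, Real.norm_of_nonneg ht0.le]
      rwa [inv_mul_lt_iff₀ ht0])
    have h2 := hS.lineMap_mem hx h1 ⟨ht0.le, ht1.le⟩
    convert h2 using 1
    simp only [AffineMap.lineMap_apply_module, smul_add, smul_inv_smul₀ ht0.ne', add_assoc]

/-- A relatively interior point lies on no proper face. If a vertex `p` were missing from `u`, then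
`y` would lie in the face opposite `p`. Pushing `y` slightly away from `p` stays in the simplex, and
solving for `p` puts it in the affine span of the other vertices. -/
lemma subset_of_mem_convexHull_inter {s : Set F} (hs : AffineIndependent ℝ ((↑) : s → F)) {u : Set F}
    {y : F} (hy : y ∈ convexHull ℝ (s ∩ u)) {δ : ℝ} (hδ : 0 < δ)
    (hb : ∀ v ∈ vectorSpan ℝ s, ‖v‖ < δ → y + v ∈ convexHull ℝ s) : s ⊆ u := by
  intro p hp
  by_contra hpu
  have hsub : s ∩ u ⊆ s \ {p} := fun q hq => ⟨hq.1, fun h => hpu (h ▸ hq.2)⟩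
  have hne : (s \ {p}).Nonempty := (convexHull_nonempty_iff.1 ⟨y, hy⟩).mono hsub
  have hnot : p ∉ affineSpan ℝ (s \ {p}) := by
    have := hs.notMem_affineSpan_sdiff ⟨p, hp⟩ univ
    have e : Subtype.val '' (univ \ {⟨p, hp⟩} : Set s) = s \ {p} := by
      ext q
      constructor
      · rintro ⟨q, ⟨-, h2⟩, rfl⟩
        exact ⟨q.2, fun h => h2 (Subtype.ext h)⟩
      · rintro ⟨h1, h2⟩
        exact ⟨⟨q, h1⟩, ⟨trivial, fun h => h2 (congrArg Subtype.val h)⟩, rfl⟩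
    rwa [e] at this
  have hy1 : y ∈ affineSpan ℝ (s \ {p}) :=
    convexHull_subset_affineSpan _ (convexHull_mono hsub hy)
  have hys : y ∈ convexHull ℝ s := convexHull_mono inter_subset_left hy
  have hv : y - p ∈ vectorSpan ℝ s := by
    rw [← vectorSpan_convexHull]
    exact vsub_mem_vectorSpan ℝ hys (subset_convexHull ℝ s hp)
  set ε := δ / (2 * (‖y - p‖ + 1)) with hε
  have hε0 : 0 < ε := by positivity
  have hlt : ‖ε • (y - p)‖ < δ := by
    rw [norm_smul, Real.norm_of_nonneg hε0.le, hε, div_mul_eq_mul_div, div_lt_iff₀ (by positivity)]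
    nlinarith [norm_nonneg (y - p)]
  have h1 := hb _ (Submodule.smul_mem _ ε hv) hlt
  rw [← insert_sdiff_self_of_mem hp, convexHull_insert hne] at h1
  obtain ⟨p', hp', z, hz, a, b, ha, hb', hab, hseg⟩ := mem_convexJoin.1 h1
  rw [mem_singleton_iff.1 hp'] at hseg
  have hz1 : z ∈ affineSpan ℝ (s \ {p}) := convexHull_subset_affineSpan _ hz
  refine hnot ?_
  have hpos : 0 < a + ε := by linarith
  have : p = AffineMap.lineMap y z (-b / (a + ε)) := by
    have e : (a + ε) • p = (1 + ε) • y - b • z := by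
      rw [add_smul, eq_sub_iff_add_eq, add_right_comm, hseg]
      module
    have e2 : p = (a + ε)⁻¹ • ((1 + ε) • y - b • z) := by rw [← e, inv_smul_smul₀ hpos.ne']
    rw [AffineMap.lineMap_apply_module, e2, smul_sub, smul_smul, smul_smul, sub_eq_add_neg,
      ← neg_smul]
    congr 2
    · have : b = 1 - a := by linarith
      rw [this]; field_simp; ring
    · field_simp
  have hmem := AffineMap.lineMap_mem (-b / (a + ε)) hy1 hz1
  rwa [← this] at hmem

end FlatPoints

/-! ### Points of a triangulation near which only one simplex occurs -/

section TriangulationFlat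

open Set Bundle

variable {n : ℕ} {H : Type*} [TopologicalSpace H]
  {I : ModelWithCorners ℝ (EuclideanSpace ℝ (Fin n)) H}
  {M : Type*} [MetricSpace M] [ChartedSpace H M]

namespace C1Triangulation

/-- Every nonempty open set contains a point at which the triangulation is a single simplex. -/
lemma exists_flat_point (T : C1Triangulation I M) {O : Set M} (hO : IsOpen O) (hne : O.Nonempty) :
    ∃ s ∈ T.K.faces, ∃ y ∈ convexHull ℝ (s : Set (EuclideanSpace ℝ (Fin T.N))), T.toFun y ∈ O ∧
      ∃ δ > 0, (∀ v ∈ vectorSpan ℝ (s : Set (EuclideanSpace ℝ (Fin T.N))), ‖v‖ < δ →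
        y + v ∈ convexHull ℝ (s : Set (EuclideanSpace ℝ (Fin T.N)))) ∧
      ∀ x ∈ T.K.space, ‖x - y‖ < δ → x ∈ convexHull ℝ (s : Set (EuclideanSpace ℝ (Fin T.N))) := by
  classical
  -- Minimizing `T.N + 1 - s.card` selects a simplex meeting `O` with the largest number of
  -- vertices; affine independence bounds that number by `T.N + 1`.
  obtain ⟨s, ⟨hs, x₀, hx₀, hx₀s⟩, hmax⟩ := WellFounded.has_min
    (measure fun s : Finset (EuclideanSpace ℝ (Fin T.N)) => T.N + 1 - s.card).wf
    {s | s ∈ T.K.faces ∧ ∃ x ∈ O, T.embed x ∈ convexHull ℝ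
      (s : Set (EuclideanSpace ℝ (Fin T.N)))} (by
      obtain ⟨x, hx⟩ := hne
      obtain ⟨s, hs, hxs⟩ := Geometry.SimplicialComplex.mem_space_iff.1 (T.embed_mem x)
      exact ⟨s, hs, x, hx, hxs⟩)
  have hcard : ∀ t ∈ T.K.faces, t.card ≤ T.N + 1 := fun t ht => by
    have := (T.K.indep ht).card_le_finrank_succ
    rw [Fintype.card_coe] at this
    refine this.trans (Nat.succ_le_succ ((Submodule.finrank_le _).trans ?_))
    simp
  obtain ⟨U, hU, hUO⟩ := mem_nhdsWithin_iff_exists_mem_nhds_inter.1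
    (T.toFun_continuousOn (T.embed x₀) (T.embed_mem x₀)
      ((T.toFun_embed x₀).symm ▸ hO.mem_nhds hx₀))
  obtain ⟨y, ⟨hys, hyU⟩, δ₁, hδ₁, hb⟩ :=
    exists_ball_vectorSpan_subset_near (convex_convexHull ℝ _) hx₀s hU
  rw [vectorSpan_convexHull] at hb
  have hyK := T.convexHull_subset_space hs hys
  have hyO : T.toFun y ∈ O := hUO ⟨hyU, hyK⟩
  -- A simplex containing the relatively interior point `y` has `s` as a face, and equals `s` by
  -- maximality.
  have huniq : ∀ t ∈ T.K.faces, y ∈ convexHull ℝ (t : Set (EuclideanSpace ℝ (Fin T.N))) →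
      s = t := by
    intro t ht hyt
    have hst : s ⊆ t := by
      have := subset_of_mem_convexHull_inter (T.K.indep hs)
        (T.K.inter_subset_convexHull hs ht ⟨hys, hyt⟩) hδ₁ hb
      exact_mod_cast this
    refine Finset.eq_of_subset_of_card_le hst ?_
    have := hmax t ⟨ht, T.toFun y, hyO, by rwa [T.embed_toFun hyK]⟩
    have h1 := hcard t ht
    have h2 := hcard s hs
    have h3 : ¬ (T.N + 1 - t.card < T.N + 1 - s.card) := this
    omega
  obtain ⟨U₀, hU₀, hfin⟩ := T.locallyFinite y hyK
  have hW : U₀ ∩ ⋂ t ∈ {t ∈ {t ∈ T.K.faces |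
      (convexHull ℝ (t : Set (EuclideanSpace ℝ (Fin T.N))) ∩ U₀).Nonempty} | t ≠ s},
      (convexHull ℝ (t : Set (EuclideanSpace ℝ (Fin T.N))))ᶜ ∈ 𝓝 y := by
    refine Filter.inter_mem hU₀ ((Filter.biInter_mem (hfin.subset fun t ht => ht.1)).2 ?_)
    rintro t ⟨⟨ht, -⟩, hts⟩
    exact (isClosed_convexHull_finset t).isOpen_compl.mem_nhds fun h => hts (huniq t ht h).symm
  obtain ⟨δ₂, hδ₂, hball⟩ := Metric.mem_nhds_iff.1 hW
  refine ⟨s, hs, y, hys, hyO, min δ₁ δ₂, lt_min hδ₁ hδ₂,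
    fun v hv h => hb v hv (h.trans_le (min_le_left _ _)), fun x hx h => ?_⟩
  have hxW := hball (mem_ball_iff_norm.2 (h.trans_le (min_le_right _ _)))
  obtain ⟨t, ht, hxt⟩ := Geometry.SimplicialComplex.mem_space_iff.1 hx
  by_cases hts : t = s
  · exact hts ▸ hxt
  · exact absurd hxt (mem_iInter₂.1 hxW.2 t ⟨⟨ht, _, hxt, hxW.1⟩, hts⟩)

end C1Triangulation

/-- A manifold of positive dimension has no isolated points. -/
lemma not_isOpen_singleton_of_charted (I : ModelWithCorners ℝ (EuclideanSpace ℝ (Fin n)) H)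
    (hn : 1 ≤ n) (q : M) : ¬ IsOpen ({q} : Set M) := by
  intro hq
  have h1 : IsOpen ({chartAt H q q} : Set H) := by
    rw [← image_singleton]
    exact (chartAt H q).isOpen_image_of_subset_source hq (by simp)
  have h2 : 𝓝[range I] I (chartAt H q q) = pure (I (chartAt H q q)) := by
    rw [← I.map_nhds_eq, isOpen_singleton_iff_nhds_eq_pure _ |>.1 h1, Filter.map_pure]
  have : Nonempty (Fin n) := ⟨⟨0, hn⟩⟩
  have : Nontrivial (EuclideanSpace ℝ (Fin n)) := inferInstance
  have h3 := (I.uniqueDiffOn _ (mem_range_self (chartAt H q q))).accPt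
  rw [accPt_principal_iff_nhdsWithin] at h3
  have h4 : 𝓝[range I \ {I (chartAt H q q)}] I (chartAt H q q) = ⊥ := by
    rw [sdiff_eq, nhdsWithin_inter', h2, Filter.inf_principal_eq_bot]
    simp
  exact h3.ne h4

end TriangulationFlat

/-! ### Uniform cells in a triangulated manifold -/

section UniformCells

open Set Bundle

lemma norm_toLp_bounds {m : ℕ} (v : Fin (m + 1) → ℝ) :
    ‖v‖ ≤ ‖(WithLp.toLp 2 v : EuclideanSpace ℝ (Fin (m + 1)))‖ ∧
      ‖(WithLp.toLp 2 v : EuclideanSpace ℝ (Fin (m + 1)))‖ ≤ (m + 1) * ‖v‖ := by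
  constructor
  · refine (pi_norm_le_iff_of_nonneg (norm_nonneg _)).2 fun i => ?_
    exact PiLp.norm_apply_le (WithLp.toLp 2 v : EuclideanSpace ℝ (Fin (m + 1))) i
  · rw [EuclideanSpace.norm_eq]
    refine Real.sqrt_le_iff.2 ⟨by positivity, ?_⟩
    have h : ∀ i ∈ (Finset.univ : Finset (Fin (m + 1))), ‖v i‖ ^ 2 ≤ ‖v‖ ^ 2 := fun i _ => by
      gcongr
      exact norm_le_pi_norm v i
    refine (Finset.sum_le_card_nsmul _ _ _ h).trans ?_
    simp only [Finset.card_univ, Fintype.card_fin, nsmul_eq_mul, Nat.cast_add, Nat.cast_one]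
    have h1 : (0 : ℝ) ≤ m := by positivity
    nlinarith [sq_nonneg ‖v‖, mul_nonneg h1 (sq_nonneg ‖v‖), mul_nonneg h1 (mul_nonneg h1 (sq_nonneg ‖v‖))]

/-- An orthonormal basis of the image of `V` under `D` is pulled back to `V`. The bounds then
involve only the comparison of sup norm and Euclidean norm, not the size of `D`. -/
lemma exists_linear_param {F : Type*} [NormedAddCommGroup F] [NormedSpace ℝ F]
    [FiniteDimensional ℝ F] {E : Type*} [NormedAddCommGroup E] [InnerProductSpace ℝ E]
    {D : F →L[ℝ] E} {V : Submodule ℝ F} (hD : ∀ v ∈ V, D v = 0 → v = 0) {m : ℕ}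
    (hm : Module.finrank ℝ V = m + 1) :
    ∃ A : (Fin (m + 1) → ℝ) ≃ₗ[ℝ] V, ∀ v, ‖v‖ ≤ ‖D (A v)‖ ∧ ‖D (A v)‖ ≤ (m + 1) * ‖v‖ := by
  let f : V →ₗ[ℝ] E := (D : F →ₗ[ℝ] E).domRestrict V
  have hf : Function.Injective f :=
    LinearMap.ker_eq_bot.1 (LinearMap.ker_eq_bot'.2 fun v hv => Subtype.ext (hD v v.2 hv))
  let g := LinearEquiv.ofInjective f hf
  have hr : Module.finrank ℝ (LinearMap.range f) = m + 1 := by rw [← hm, g.finrank_eq]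
  let b : OrthonormalBasis (Fin (m + 1)) ℝ (LinearMap.range f) :=
    (stdOrthonormalBasis ℝ _).reindex (finCongr hr)
  refine ⟨(WithLp.linearEquiv 2 ℝ (Fin (m + 1) → ℝ)).symm ≪≫ₗ b.repr.symm.toLinearEquiv ≪≫ₗ g.symm,
    fun v => ?_⟩
  have h : ‖D ((((WithLp.linearEquiv 2 ℝ (Fin (m + 1) → ℝ)).symm ≪≫ₗ
      b.repr.symm.toLinearEquiv ≪≫ₗ g.symm) v : V) : F)‖ =
      ‖(WithLp.toLp 2 v : EuclideanSpace ℝ (Fin (m + 1)))‖ := by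
    rw [← b.repr.symm.norm_map]
    exact congrArg (fun w : LinearMap.range f => ‖w‖)
      (g.apply_symm_apply (b.repr.symm (WithLp.toLp 2 v)))
  rw [h]
  exact norm_toLp_bounds v

variable {n : ℕ} {H : Type*} [TopologicalSpace H]
  {I : ModelWithCorners ℝ (EuclideanSpace ℝ (Fin n)) H}
  {M : Type*} [MetricSpace M] [ChartedSpace H M] [IsManifold I ∞ M]
  [RiemannianBundle (fun x : M => TangentSpace I x)]
  [IsContMDiffRiemannianBundle I ∞ (EuclideanSpace ℝ (Fin n)) (fun x : M => TangentSpace I x)]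
  [IsRiemannianManifold I M]

namespace C1Triangulation

/-- Every nonempty open set contains a cell, read linearly in the triangulation, whose distortion
is bounded in terms of the dimension only. -/
theorem exists_cell (T : C1Triangulation I M) (hn : 1 ≤ n) {O : Set M} (hO : IsOpen O)
    (hne : O.Nonempty) :
    ∃ m ≤ n, ∃ c : Cell M (2 * n + 6) m, c.e.target ⊆ O ∧ ∃ y : EuclideanSpace ℝ (Fin T.N),
      ∃ A : (Fin (m + 1) → ℝ) →L[ℝ] EuclideanSpace ℝ (Fin T.N),
        ∀ v ∈ Metric.ball 0 4, T.embed (c.e v) = y + A v := by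
  obtain ⟨s, hs, y, hys, hyO, δ, hδ, hin, hflat⟩ := T.exists_flat_point hO hne
  have hyK := T.convexHull_subset_space hs hys
  set V := vectorSpan ℝ (s : Set (EuclideanSpace ℝ (Fin T.N))) with hVdef
  have hVs : ∀ x ∈ convexHull ℝ (s : Set (EuclideanSpace ℝ (Fin T.N))), x - y ∈ V := fun x hx => by
    have := vsub_mem_vectorSpan ℝ hx hys
    rwa [vectorSpan_convexHull] at this
  -- A zero-dimensional simplex here would be an isolated point of `M`.
  have hfr0 : 0 < Module.finrank ℝ V := by
    rw [Module.finrank_pos_iff_exists_ne_zero]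
    by_contra! hV
    refine not_isOpen_singleton_of_charted I hn (T.toFun y) ?_
    have : ({T.toFun y} : Set M) = T.embed ⁻¹' Metric.ball y δ := by
      ext x
      rw [mem_singleton_iff, mem_preimage, mem_ball_iff_norm]
      refine ⟨fun h => by rw [h, T.embed_toFun hyK]; simpa using hδ, fun h => ?_⟩
      have h1 := hV ⟨_, hVs _ (hflat _ (T.embed_mem x) h)⟩
      rw [Submodule.mk_eq_zero, sub_eq_zero] at h1
      rw [← h1, T.toFun_embed]
    rw [this]
    exact Metric.isOpen_ball.preimage T.continuous_embed
  obtain ⟨m, hm⟩ := Nat.exists_eq_succ_of_ne_zero hfr0.ne'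
  obtain ⟨D, hinj, hD⟩ := T.exists_almost_linear hs hys
  -- Injectivity of `D` bounds the dimension of the simplex; equality with `n` is not needed, so
  -- neither is invariance of domain.
  have hmn : m + 1 ≤ n := by
    have := LinearMap.finrank_le_finrank_of_injective
      (f := (D : EuclideanSpace ℝ (Fin T.N) →ₗ[ℝ] EuclideanSpace ℝ (Fin n)).domRestrict V)
      (LinearMap.ker_eq_bot.1 (LinearMap.ker_eq_bot'.2 fun v hv => Subtype.ext (hinj v v.2 hv)))
    rw [hm] at this
    simpa using this
  obtain ⟨A, hA⟩ := exists_linear_param hinj hm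
  let A' : (Fin (m + 1) → ℝ) →L[ℝ] EuclideanSpace ℝ (Fin T.N) :=
    LinearMap.toContinuousLinearMap (V.subtype ∘ₗ (A : (Fin (m + 1) → ℝ) →ₗ[ℝ] V))
  have hA' : ∀ v, A' v = (A v : EuclideanSpace ℝ (Fin T.N)) := fun v => rfl
  -- A left inverse of the parametrization, defined on the whole ambient space by orthogonal
  -- projection; it provides the chart inverse.
  let G : EuclideanSpace ℝ (Fin T.N) →L[ℝ] Fin (m + 1) → ℝ :=
    (LinearMap.toContinuousLinearMap (A.symm : V →ₗ[ℝ] Fin (m + 1) → ℝ)).comp V.orthogonalProjectionOnto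
  have hGA : ∀ v, G (A' v) = v := fun v => by
    change A.symm (V.orthogonalProjectionOnto (A v : EuclideanSpace ℝ (Fin T.N))) = v
    rw [Submodule.orthogonalProjectionOnto_mem_subspace_eq_self, A.symm_apply_apply]
  have hAG : ∀ v ∈ V, A' (G v) = v := fun v hv => by
    change (A (A.symm (V.orthogonalProjectionOnto v)) : EuclideanSpace ℝ (Fin T.N)) = v
    rw [A.apply_symm_apply]
    exact congrArg Subtype.val (Submodule.orthogonalProjectionOnto_mem_subspace_eq_self (⟨v, hv⟩ : V))
  set a := ‖A'‖ + 1 with ha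
  have ha0 : 0 < a := by positivity
  have hAa : ∀ v, ‖A' v‖ ≤ a * ‖v‖ := fun v => (A'.le_opNorm v).trans (by gcongr; linarith)
  -- As `A'` has norm at most `a`, this error contributes at most half of `R * dist v w`.
  obtain ⟨U, hU, hDU⟩ := hD (1 / (2 * a)) (by positivity)
  have hO' := (T.toFun_continuousOn y hyK) (hO.mem_nhds hyO)
  obtain ⟨U', hU', hUO⟩ := mem_nhdsWithin_iff_exists_mem_nhds_inter.1 hO'
  obtain ⟨δ', hδ', hball⟩ := Metric.mem_nhds_iff.1 (Filter.inter_mem hU hU')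
  set η := min δ δ' with hη
  have hη0 : 0 < η := lt_min hδ hδ'
  have hzs : ∀ z ∈ T.K.space, ‖z - y‖ < η →
      z ∈ convexHull ℝ (s : Set (EuclideanSpace ℝ (Fin T.N))) ∩ U ∧ T.toFun z ∈ O := by
    intro z hz h
    have h1 := hball (mem_ball_iff_norm.2 (h.trans_le (min_le_right _ _)))
    exact ⟨⟨hflat z hz (h.trans_le (min_le_left _ _)), h1.1⟩, hUO ⟨h1.2, hz⟩⟩
  have hcont : ∀ᶠ q in 𝓝 (T.toFun y), ‖T.embed q - y‖ < η := by
    have h1 : ContinuousAt T.embed (T.toFun y) := T.continuous_embed.continuousAt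
    have h2 := h1 (Metric.ball_mem_nhds _ hη0)
    rw [T.embed_toFun hyK] at h2
    filter_upwards [h2] with q hq
    exact mem_ball_iff_norm.1 hq
  obtain ⟨ρ, hρ, hρb⟩ := Metric.eventually_nhds_iff.1 hcont
  set C : ℝ := 2 * n + 6 with hC
  have hC6 : 6 ≤ C := by rw [hC]; have : (0 : ℝ) ≤ n := by positivity
                         linarith
  -- The first term keeps the image of the ball of radius 4 inside the flat region. The second keeps
  -- every point within `R / C` of the image of the ball of radius 2 in that region too, which is
  -- used for `far`.
  set R := min (η / (5 * a)) (ρ / (3 * C)) with hR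
  have hR0 : 0 < R := lt_min (by positivity) (by positivity)
  have hRη : 4 * (R * a) < η := by
    have : R ≤ η / (5 * a) := min_le_left _ _
    rw [le_div_iff₀ (by positivity)] at this
    nlinarith [mul_pos hR0 ha0]
  have hRρ : R * (3 * C) ≤ ρ := by
    have : R ≤ ρ / (3 * C) := min_le_right _ _
    rwa [le_div_iff₀ (by positivity)] at this
  have hmem : ∀ v ∈ Metric.ball (0 : Fin (m + 1) → ℝ) 4, ‖R • A' v‖ < η := fun v hv => by
    rw [mem_ball_zero_iff] at hv
    rw [norm_smul, Real.norm_of_nonneg hR0.le]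
    have := hAa v
    calc R * ‖A' v‖ ≤ R * (a * 4) := by gcongr; exact this.trans (by gcongr)
      _ < η := by linarith
  have hK : ∀ v ∈ Metric.ball (0 : Fin (m + 1) → ℝ) 4, y + R • A' v ∈ T.K.space := fun v hv =>
    T.convexHull_subset_space hs (hin _ (V.smul_mem _ (A v).2)
      ((hmem v hv).trans_le (min_le_left _ _)))
  have hlow : ∀ v w, y + R • A' v ∈ T.K.space → ‖R • A' v‖ < η →
      y + R • A' w ∈ T.K.space → ‖R • A' w‖ < η →
      dist (T.toFun (y + R • A' v)) (T.toFun (y + R • A' w)) ≤ C * (R * dist v w) ∧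
        R * dist v w ≤ 4 * dist (T.toFun (y + R • A' v)) (T.toFun (y + R • A' w)) := by
    intro v w hv hv' hw hw'
    obtain ⟨h1, h2⟩ := hDU _ (hzs _ hv (by simpa using hv')).1 _ (hzs _ hw (by simpa using hw')).1
    have e : y + R • A' v - (y + R • A' w) = R • A' (v - w) := by
      rw [add_sub_add_left_eq_sub, ← smul_sub, map_sub]
    obtain ⟨h3, h4⟩ := hA (v - w)
    rw [← hA'] at h3 h4
    have h5 := hAa (v - w)
    rw [e, map_smul, norm_smul, norm_smul, Real.norm_of_nonneg hR0.le] at h1 h2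
    rw [← dist_eq_norm] at h3 h4 h5
    have h6 : 1 / (2 * a) * (R * ‖A' (v - w)‖) ≤ R * dist v w / 2 := by
      calc 1 / (2 * a) * (R * ‖A' (v - w)‖) ≤ 1 / (2 * a) * (R * (a * dist v w)) := by gcongr
        _ = R * dist v w / 2 := by field_simp
    have h7 : R * ‖D (A' (v - w))‖ ≤ R * ((m + 1) * dist v w) := by gcongr
    have h8 : R * dist v w ≤ R * ‖D (A' (v - w))‖ := by gcongr
    have h9 : (m : ℝ) + 1 ≤ n := by exact_mod_cast hmn
    have h10 : 0 ≤ R * dist v w := by positivity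
    constructor
    · rw [hC]
      nlinarith
    · linarith
  let e : OpenPartialHomeomorph (Fin (m + 1) → ℝ) M :=
    { toFun := fun v => T.toFun (y + R • A' v)
      invFun := fun q => G (R⁻¹ • (T.embed q - y))
      source := Metric.ball 0 4
      target := {q | ‖T.embed q - y‖ < η ∧ ‖G (R⁻¹ • (T.embed q - y))‖ < 4}
      map_source' := fun v hv => by
        rw [mem_ofPred_eq, T.embed_toFun (hK v hv), add_sub_cancel_left, inv_smul_smul₀ hR0.ne', hGA]
        exact ⟨hmem v hv, mem_ball_zero_iff.1 hv⟩
      map_target' := fun q hq => mem_ball_zero_iff.2 hq.2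
      left_inv' := fun v hv => by
        rw [T.embed_toFun (hK v hv), add_sub_cancel_left, inv_smul_smul₀ hR0.ne', hGA]
      right_inv' := fun q hq => by
        have h1 := hVs _ (hzs _ (T.embed_mem q) hq.1).1.1
        rw [hAG _ (V.smul_mem _ h1), smul_inv_smul₀ hR0.ne', add_sub_cancel, T.toFun_embed]
      open_source := Metric.isOpen_ball
      open_target := by
        have := T.continuous_embed
        have h1 : Continuous fun q => ‖T.embed q - y‖ := by fun_prop
        have h2 : Continuous fun q => ‖G (R⁻¹ • (T.embed q - y))‖ := by fun_prop
        exact (isOpen_lt h1 continuous_const).inter (isOpen_lt h2 continuous_const)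
      continuousOn_toFun := T.toFun_continuousOn.comp (by fun_prop) hK
      continuousOn_invFun := by
        have := T.continuous_embed
        exact Continuous.continuousOn (by fun_prop) }
  have he : ∀ v, e v = T.toFun (y + R • A' v) := fun v => rfl
  refine ⟨m, by omega, ⟨e, rfl, R, hR0, fun v hv w hw => ?_, fun v hv q hq => ?_⟩, ?_, y, R • A',
    fun v hv => T.embed_toFun (hK v hv)⟩
  · obtain ⟨h1, h2⟩ := hlow v w (hK v hv) (hmem v hv) (hK w hw) (hmem w hw)
    exact ⟨h1, h2.trans (mul_le_mul_of_nonneg_right (by linarith) dist_nonneg)⟩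
  -- A point `q` off the target but too close to `e v` would still be in the flat region, hence
  -- would have a linear coordinate `w` with `‖w‖ ≥ 4`. Then `dist v w ≥ 2`, and `hlow` together
  -- with `6 ≤ C` contradicts the closeness.
  · by_contra! hlt
    have hv4 : v ∈ Metric.ball (0 : Fin (m + 1) → ℝ) 4 :=
      Metric.closedBall_subset_ball (by norm_num) hv
    have h0 : (0 : Fin (m + 1) → ℝ) ∈ Metric.ball (0 : Fin (m + 1) → ℝ) 4 := by simp
    have h1 := (hlow v 0 (hK v hv4) (hmem v hv4) (hK 0 h0) (hmem 0 h0)).1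
    rw [map_zero, smul_zero, add_zero] at h1
    have h2 : R * dist v 0 ≤ R * 2 := by gcongr; exact hv
    have h3 : dist (e v) q < R := by
      have : 1 * dist (e v) q ≤ C * dist (e v) q := by gcongr; linarith
      linarith
    have hq' : dist q (T.toFun y) < ρ := by
      rw [he] at h3
      have h4 := dist_triangle_left q (T.toFun y) (T.toFun (y + R • A' v))
      have h5 : C * (R * dist v 0) ≤ C * (R * 2) := by gcongr
      nlinarith
    have hqη := hρb hq'
    have hqs := hzs _ (T.embed_mem q) hqη
    set w := G (R⁻¹ • (T.embed q - y)) with hw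
    have hyw : y + R • A' w = T.embed q := by
      rw [hw, hAG _ (V.smul_mem _ (hVs _ hqs.1.1)), smul_inv_smul₀ hR0.ne', add_sub_cancel]
    have hw4 : 4 ≤ ‖w‖ := by
      by_contra! hlt4
      exact hq ⟨hqη, hlt4⟩
    have hd : 2 ≤ dist v w := by
      have := norm_sub_norm_le w v
      rw [mem_closedBall_zero_iff] at hv
      rw [dist_comm, dist_eq_norm]
      linarith
    have h6 := (hlow v w (hK v hv4) (hmem v hv4) (hyw ▸ T.embed_mem q)
      (by rw [← add_sub_cancel_left y (R • A' w), hyw]; exact hqη)).2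
    rw [hyw, T.toFun_embed, ← he] at h6
    have h7 : R * 2 ≤ R * dist v w := by gcongr
    have h8 : 6 * dist (e v) q ≤ C * dist (e v) q := by gcongr
    linarith [dist_nonneg (x := e v) (y := q)]
  · intro q hq
    have := (hzs _ (T.embed_mem q) hq.1).2
    rwa [T.toFun_embed] at this

end C1Triangulation

end UniformCells

/-! ### Piecewise linear maps -/

section StarAffine

open Set

variable {F G : Type*} [NormedAddCommGroup F] [NormedSpace ℝ F] [NormedAddCommGroup G]
  [NormedSpace ℝ G]

/-- Near `a`, the map `f` is affine along each segment issuing from `a`. -/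
def StarAffineAt (f : F → G) (a : F) : Prop :=
  ∀ᶠ x in 𝓝 a, ∀ t ∈ Icc (0 : ℝ) 1,
    f (AffineMap.lineMap a x t) = AffineMap.lineMap (f a) (f x) t

namespace StarAffineAt

lemma congr {f g : F → G} {a : F} (hf : StarAffineAt f a) (h : ∀ᶠ x in 𝓝 a, g x = f x) :
    StarAffineAt g a := by
  obtain ⟨δ, hδ, hb⟩ := Metric.mem_nhds_iff.1 h
  filter_upwards [hf, Metric.ball_mem_nhds a hδ] with x hx hxδ t ht
  have ha := Metric.mem_ball_self (x := a) hδ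
  rw [hb ((convex_ball a δ).lineMap_mem ha hxδ ht), hb ha, hb hxδ, hx t ht]

lemma of_affine (f : F →ᵃ[ℝ] G) (a : F) : StarAffineAt f a :=
  Filter.Eventually.of_forall fun x t _ => f.apply_lineMap a x t

lemma const (c : G) (a : F) : StarAffineAt (fun _ : F => c) a :=
  of_affine (AffineMap.const ℝ F c) a

lemma linear (f : F →ₗ[ℝ] G) (a : F) : StarAffineAt (fun x => f x) a :=
  of_affine f.toAffineMap a

lemma comp_linear {K : Type*} [NormedAddCommGroup K] [NormedSpace ℝ K] {f : F → G} {a : F}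
    (hf : StarAffineAt f a) (L : G →ₗ[ℝ] K) : StarAffineAt (fun x => L (f x)) a := by
  filter_upwards [hf] with x hx t ht
  rw [hx t ht]
  exact L.toAffineMap.apply_lineMap _ _ t

lemma add {f g : F → G} {a : F} (hf : StarAffineAt f a) (hg : StarAffineAt g a) :
    StarAffineAt (fun x => f x + g x) a := by
  filter_upwards [hf, hg] with x hx hx' t ht
  rw [hx t ht, hx' t ht]
  simp only [AffineMap.lineMap_apply_module]
  module

lemma neg {f : F → G} {a : F} (hf : StarAffineAt f a) : StarAffineAt (fun x => -f x) a :=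
  hf.comp_linear (-LinearMap.id)

lemma sub {f g : F → G} {a : F} (hf : StarAffineAt f a) (hg : StarAffineAt g a) :
    StarAffineAt (fun x => f x - g x) a := by
  simpa only [sub_eq_add_neg] using hf.add hg.neg

lemma sum {ι : Type*} (s : Finset ι) {f : ι → F → G} {a : F} (hf : ∀ i, StarAffineAt (f i) a) :
    StarAffineAt (fun x => ∑ i ∈ s, f i x) a := by
  classical
  induction s using Finset.induction_on with
  | empty => simpa using const 0 a
  | insert i s hi ih =>
    simp only [Finset.sum_insert hi]
    exact (hf i).add ih

/-- If the values at `a` differ, one function dominates nearby. If they agree, the maximum is taken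
of the increments, and it commutes with scaling by `t ≥ 0`. -/
lemma max {f g : F → ℝ} {a : F} (hf : StarAffineAt f a) (hg : StarAffineAt g a)
    (hfc : Continuous f) (hgc : Continuous g) : StarAffineAt (fun x => max (f x) (g x)) a := by
  rcases lt_trichotomy (f a) (g a) with h | h | h
  · refine hg.congr ?_
    filter_upwards [hfc.continuousAt.eventually_lt hgc.continuousAt h] with x hx
    exact max_eq_right hx.le
  · filter_upwards [hf, hg] with x hx hx' t ht
    rw [hx t ht, hx' t ht, h, max_self]
    simp only [AffineMap.lineMap_apply_module, smul_eq_mul]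
    rw [max_add_add_left, mul_max_of_nonneg _ _ ht.1]
  · refine hf.congr ?_
    filter_upwards [hgc.continuousAt.eventually_lt hfc.continuousAt h] with x hx
    exact max_eq_left hx.le

lemma min {f g : F → ℝ} {a : F} (hf : StarAffineAt f a) (hg : StarAffineAt g a)
    (hfc : Continuous f) (hgc : Continuous g) : StarAffineAt (fun x => min (f x) (g x)) a := by
  have := (hf.neg.max hg.neg hfc.neg hgc.neg).neg
  simpa only [max_neg_neg, neg_neg] using this

lemma abs {f : F → ℝ} {a : F} (hf : StarAffineAt f a) (hfc : Continuous f) :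
    StarAffineAt (fun x => |f x|) a :=
  hf.max hf.neg hfc hfc.neg

end StarAffineAt

lemma starAffineAt_axisSlide {m : ℕ} (a r τ : ℝ) (v : Fin (m + 1) → ℝ) :
    StarAffineAt (axisSlide a r τ) v := by
  have hc : ∀ j : Fin (m + 1), StarAffineAt (fun x : Fin (m + 1) → ℝ => x j) v := fun j =>
    StarAffineAt.linear (LinearMap.proj j) v
  have hw : StarAffineAt (fun x : Fin (m + 1) → ℝ => r - ∑ j : Fin m, |x j.succ|) v :=
    (StarAffineAt.const r v).sub
      (StarAffineAt.sum _ fun j => (hc j.succ).abs (continuous_apply _))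
  have hs : StarAffineAt (fun x : Fin (m + 1) → ℝ => x 0 - a) v :=
    (hc 0).sub (StarAffineAt.const a v)
  have hb : StarAffineAt (axisBump a r) v :=
    (StarAffineAt.const 0 v).max ((hw.add hs).min (hw.sub hs) (by fun_prop) (by fun_prop))
      (by fun_prop) (by fun_prop)
  exact (StarAffineAt.linear LinearMap.id v).add
    (hb.comp_linear (LinearMap.single ℝ (fun _ : Fin (m + 1) => ℝ) 0 ∘ₗ LinearMap.mulLeft ℝ τ))

end StarAffine

namespace IsPiecewiseLinear

open Set

variable {F G K : Type*} [NormedAddCommGroup F] [NormedSpace ℝ F] [NormedAddCommGroup G]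
  [NormedSpace ℝ G] [NormedAddCommGroup K] [NormedSpace ℝ K] {P : Set F} {Q : Set G} {R : Set K}

lemma comp {f : Q → R} {g : P → Q} (hf : IsPiecewiseLinear Q R f)
    (hg : IsPiecewiseLinear P Q g) : IsPiecewiseLinear P R (f ∘ g) := by
  refine ⟨hf.1.comp hg.1, fun a => ?_⟩
  obtain ⟨U, hU, h⟩ := hg.2 a
  obtain ⟨V, hV, h'⟩ := hf.2 (g a)
  refine ⟨U ∩ g ⁻¹' V, Filter.inter_mem hU (hg.1.continuousAt hV), fun x hx t ht => ?_⟩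
  obtain ⟨h1, h2⟩ := h x hx.1 t ht
  obtain ⟨h3, h4⟩ := h' (g x) hx.2 t ht
  refine ⟨h1, ?_⟩
  rw [Function.comp_apply, Function.comp_apply, Function.comp_apply, ← h4]
  exact congrArg (fun y => (f y : K)) (Subtype.ext h2)

/-- The image of a segment from `a` under `g` is the segment between the images with the same
parameter, so the inverse reads it back affinely. -/
lemma symm {g : P ≃ₜ Q} (hg : IsPiecewiseLinear P Q g) : IsPiecewiseLinear Q P g.symm := by
  refine ⟨g.symm.continuous, fun b => ?_⟩
  obtain ⟨U, hU, h⟩ := hg.2 (g.symm b)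
  refine ⟨g.symm ⁻¹' U, g.symm.continuous.continuousAt hU, fun y hy t ht => ?_⟩
  obtain ⟨h1, h2⟩ := h (g.symm y) hy t ht
  rw [g.apply_symm_apply, g.apply_symm_apply] at h2
  have h3 : AffineMap.lineMap (b : G) (y : G) t ∈ Q := h2 ▸ (g ⟨_, h1⟩).2
  refine ⟨h3, ?_⟩
  have : (⟨_, h3⟩ : Q) = g ⟨_, h1⟩ := Subtype.ext h2.symm
  rw [this, g.symm_apply_apply]

lemma of_eventuallyEq {g : P → Q} (hg : Continuous g)
    (h : ∀ a, ∃ g', IsPiecewiseLinear P Q g' ∧ ∀ᶠ x in 𝓝 a, g x = g' x) :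
    IsPiecewiseLinear P Q g := by
  refine ⟨hg, fun a => ?_⟩
  obtain ⟨g', hg', he⟩ := h a
  obtain ⟨U, hU, h'⟩ := hg'.2 a
  obtain ⟨δ, hδ, hb⟩ := Metric.mem_nhds_iff.1 he
  refine ⟨U ∩ Metric.ball a δ, Filter.inter_mem hU (Metric.ball_mem_nhds a hδ),
    fun x hx t ht => ?_⟩
  obtain ⟨h1, h2⟩ := h' x hx.1 t ht
  have h3 : (⟨_, h1⟩ : P) ∈ Metric.ball a δ :=
    (convex_ball (a : F) δ).lineMap_mem (Metric.mem_ball_self hδ) hx.2 ht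
  exact ⟨h1, by rw [hb h3, hb hx.2, hb (Metric.mem_ball_self hδ), h2]⟩

end IsPiecewiseLinear

/-! ### PL homeomorphisms of a triangulated manifold -/

namespace C1Triangulation

open Set

variable {n : ℕ} {H : Type*} [TopologicalSpace H]
  {I : ModelWithCorners ℝ (EuclideanSpace ℝ (Fin n)) H}
  {M : Type*} [MetricSpace M] [ChartedSpace H M] (T : C1Triangulation I M)

/-- A homeomorphism of `M`, read in the triangulation. -/
def read (h : M ≃ₜ M) : T.K.space ≃ₜ T.K.space := (T.homeo.trans h).trans T.homeo.symm

lemma isPL_iff {h : M ≃ₜ M} : T.IsPL h ↔ IsPiecewiseLinear T.K.space T.K.space (T.read h) := Iff.rfl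

/-- The content is that `|K|` has star neighbourhoods: by local finiteness, every point near `a`
lies in a simplex that also contains `a`. -/
lemma isPL_refl : T.IsPL (Homeomorph.refl M) := by
  rw [isPL_iff]
  refine ⟨(T.read _).continuous, fun a => ?_⟩
  obtain ⟨U, hU, hfin⟩ := T.locallyFinite a a.2
  have hW : U ∩ ⋂ t ∈ {t ∈ {t ∈ T.K.faces |
      (convexHull ℝ (t : Set (EuclideanSpace ℝ (Fin T.N))) ∩ U).Nonempty} |
        (a : EuclideanSpace ℝ (Fin T.N)) ∉ convexHull ℝ (t : Set (EuclideanSpace ℝ (Fin T.N)))},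
      (convexHull ℝ (t : Set (EuclideanSpace ℝ (Fin T.N))))ᶜ ∈
        𝓝 (a : EuclideanSpace ℝ (Fin T.N)) := by
    refine Filter.inter_mem hU ((Filter.biInter_mem (hfin.subset fun t ht => ht.1)).2 ?_)
    rintro t ⟨-, ht⟩
    exact (isClosed_convexHull_finset t).isOpen_compl.mem_nhds ht
  refine ⟨_, continuous_subtype_val.continuousAt.preimage_mem_nhds hW, fun x hx s hs => ?_⟩
  obtain ⟨t, ht, hxt⟩ := Geometry.SimplicialComplex.mem_space_iff.1 x.2
  have hat : (a : EuclideanSpace ℝ (Fin T.N)) ∈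
      convexHull ℝ (t : Set (EuclideanSpace ℝ (Fin T.N))) := by
    by_contra hat
    exact absurd hxt (mem_iInter₂.1 hx.2 t ⟨⟨ht, _, hxt, hx.1⟩, hat⟩)
  have h : ∀ y, T.read (Homeomorph.refl M) y = y := fun y => by simp [read]
  refine ⟨T.convexHull_subset_space ht ((convex_convexHull ℝ _).lineMap_mem hat hxt hs), ?_⟩
  rw [h, h, h]

variable {T}

lemma IsPL.trans {h k : M ≃ₜ M} (hh : T.IsPL h) (hk : T.IsPL k) : T.IsPL (h.trans k) := by
  rw [isPL_iff] at *
  convert hk.comp hh using 1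
  ext y
  simp [read]

lemma IsPL.symm {h : M ≃ₜ M} (hh : T.IsPL h) : T.IsPL h.symm := by
  rw [isPL_iff] at *
  exact IsPiecewiseLinear.symm hh

variable (T)

lemma isPL_of_eventuallyEq {h : M ≃ₜ M} (hh : ∀ q, ∃ k, T.IsPL k ∧ ∀ᶠ x in 𝓝 q, h x = k x) :
    T.IsPL h := by
  rw [isPL_iff]
  refine IsPiecewiseLinear.of_eventuallyEq (T.read h).continuous fun a => ?_
  obtain ⟨k, hk, he⟩ := hh (T.homeo a)
  refine ⟨T.read k, hk, ?_⟩
  filter_upwards [T.homeo.continuous.continuousAt.eventually he] with x hx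
  exact congrArg T.homeo.symm hx

/-- The chart of a cell is linear when read in the triangulation. -/
def IsLinearCell {K : ℝ} {m : ℕ} (c : Cell M K m) : Prop :=
  ∃ y : EuclideanSpace ℝ (Fin T.N), ∃ A : (Fin (m + 1) → ℝ) →L[ℝ] EuclideanSpace ℝ (Fin T.N),
    ∀ v ∈ Metric.ball 0 4, T.embed (c.e v) = y + A v

variable {T}

lemma IsLinearCell.isPL_slide {K : ℝ} {m : ℕ} {c : Cell M K m} (hc : T.IsLinearCell c) (i : ℕ)
    (τ : Ioo (-1 : ℝ) 1) : T.IsPL (c.slide i τ) := by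
  obtain ⟨y, A, hA⟩ := hc
  rw [isPL_iff]
  refine ⟨(T.read _).continuous, fun a => ?_⟩
  by_cases ha : T.homeo a ∈ c.e.target
  · have hv := c.e.map_target ha
    have hN := (c.e.continuousAt_symm ha).eventually
      ((starAffineAt_axisSlide ((1 / 2) ^ i) ((1 / 2) ^ i / 8) τ (c.e.symm (T.homeo a))))
    refine ⟨_, T.homeo.continuous.continuousAt.preimage_mem_nhds
      (Filter.inter_mem hN (c.e.open_target.mem_nhds ha)), ?_⟩
    rintro x ⟨hx, hxt⟩ t ht
    have hxv := c.e.map_target hxt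
    set v := c.e.symm (T.homeo a) with hvdef
    set w := c.e.symm (T.homeo x) with hwdef
    have hav : T.homeo a = c.e v := (c.e.right_inv ha).symm
    have hxw : T.homeo x = c.e w := (c.e.right_inv hxt).symm
    have hread : ∀ (z : T.K.space) (u : Fin (m + 1) → ℝ), u ∈ c.e.source → T.homeo z = c.e u →
        (z : EuclideanSpace ℝ (Fin T.N)) = y + A u ∧
        (T.read (c.slide i τ) z : EuclideanSpace ℝ (Fin T.N)) =
          y + A (axisSlide ((1 / 2) ^ i) ((1 / 2) ^ i / 8) τ u) := by
      intro z u hu hz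
      have h1 : (z : EuclideanSpace ℝ (Fin T.N)) = T.embed (T.homeo z) := by simp [embed]
      have h2 : (T.read (c.slide i τ) z : EuclideanSpace ℝ (Fin T.N)) =
        T.embed (c.slide i τ (T.homeo z)) := rfl
      rw [h1, h2, hz, c.slide_apply, chartConj_apply c.e hu, hA _ (c.source_eq ▸ hu), hA]
      · exact ⟨rfl, rfl⟩
      · rw [← c.source_eq]
        exact mapsTo_source_of_eqOn c.e (c.axisBox_subset_source i)
          (fun _ hv => axisSlide_of_notMem hv) (axisSlideInv_axisSlide _ _ τ.2.1 τ.2.2) hu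
    obtain ⟨ha1, ha2⟩ := hread a v hv hav
    obtain ⟨hx1, hx2⟩ := hread x w hxv hxw
    have hline : ∀ p q : Fin (m + 1) → ℝ, AffineMap.lineMap (y + A p) (y + A q) t =
        y + A (AffineMap.lineMap p q t) := by
      intro p q
      simp only [AffineMap.lineMap_apply_module, map_add, map_smul]
      module
    have hu : AffineMap.lineMap v w t ∈ c.e.source := by
      rw [c.source_eq] at hv hxv ⊢
      exact (convex_ball _ _).lineMap_mem hv hxv ht
    have hz : AffineMap.lineMap (a : EuclideanSpace ℝ (Fin T.N)) (x : EuclideanSpace ℝ (Fin T.N)) t =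
        T.embed (c.e (AffineMap.lineMap v w t)) := by
      rw [ha1, hx1, hline, hA _ (c.source_eq ▸ hu)]
    have hmem : AffineMap.lineMap (a : EuclideanSpace ℝ (Fin T.N))
        (x : EuclideanSpace ℝ (Fin T.N)) t ∈ T.K.space := hz ▸ T.embed_mem _
    refine ⟨hmem, ?_⟩
    have h3 : T.homeo ⟨_, hmem⟩ = c.e (AffineMap.lineMap v w t) := by
      have : (⟨_, hmem⟩ : T.K.space) = T.homeo.symm (c.e (AffineMap.lineMap v w t)) :=
        Subtype.ext hz
      rw [this, T.homeo.apply_symm_apply]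
    rw [(hread _ _ hu h3).2, ha2, hx2, hline]
    exact congrArg (fun u => y + A u) (hx t ht)
  -- Off the chart the slide is the identity nearby, and the star neighbourhood of the identity is
  -- reused.
  · have hcl : IsClosed (c.e '' axisBox ((1 / 2) ^ i) ((1 / 2) ^ i / 8)) :=
      ((isCompact_axisBox _ _).image_of_continuousOn
        (c.e.continuousOn.mono (c.axisBox_subset_source _))).isClosed
    have ha' : T.homeo a ∉ c.e '' axisBox ((1 / 2) ^ i) ((1 / 2) ^ i / 8) := by
      rintro ⟨v, hv, h⟩
      exact ha (h ▸ c.e.map_source (c.axisBox_subset_source i hv))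
    obtain ⟨U, hU, h⟩ := (T.isPL_refl).2 a
    obtain ⟨δ, hδ, hb⟩ := Metric.mem_nhds_iff.1
      (T.homeo.continuous.continuousAt.preimage_mem_nhds (hcl.isOpen_compl.mem_nhds ha'))
    have hread : ∀ z ∈ Metric.ball a δ, T.read (c.slide i τ) z = z := fun z hz => by
      have := chartConj_of_notMem c.e
        (fun v hv => axisSlide_of_notMem (τ := τ) (a := (1 / 2) ^ i) (r := (1 / 2) ^ i / 8) hv) (hb hz)
      change T.homeo.symm (c.slide i τ (T.homeo z)) = z
      rw [c.slide_apply, this, T.homeo.symm_apply_apply]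
    refine ⟨U ∩ Metric.ball a δ, Filter.inter_mem hU (Metric.ball_mem_nhds a hδ),
      fun x hx t ht => ?_⟩
    obtain ⟨h1, -⟩ := h x hx.1 t ht
    have h3 : (⟨_, h1⟩ : T.K.space) ∈ Metric.ball a δ :=
      (convex_ball (a : EuclideanSpace ℝ (Fin T.N)) δ).lineMap_mem (Metric.mem_ball_self hδ) hx.2 ht
    exact ⟨h1, by rw [hread _ h3, hread _ hx.2, hread _ (Metric.mem_ball_self hδ)]⟩

end C1Triangulation

/-! ### Sliders and piecewise linear homeomorphisms -/

namespace C1Triangulation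

open Set

variable {n : ℕ} {H : Type*} [TopologicalSpace H]
  {I : ModelWithCorners ℝ (EuclideanSpace ℝ (Fin n)) H}
  {M : Type*} [MetricSpace M] [ChartedSpace H M] (T : C1Triangulation I M)
  {κ : Type*} (S : CellSliders M κ)

/-- The slides are PL, and the arcs of each cell lie along a ray issuing from its base point. -/
structure LinearSliders : Prop where
  isPL_slide : ∀ p τ, T.IsPL (S.slide p τ)
  exists_ray : ∀ k, ∃ w, ∀ i, ∀ x ∈ Icc (-1 : ℝ) 1, T.embed (S.arc (k, i) x) =
    T.embed (S.pt k) + ((1 / 2) ^ i * (1 + x / 8)) • w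

lemma linearSliders_cellSliders {K : ℝ} {m : κ → ℕ} (hm : ∀ k, m k ≤ n)
    (c : ∀ k, Cell M K (m k)) (hdis : Pairwise (Function.onFun Disjoint fun k => (c k).e.target))
    (hlf : LocallyFinite fun k => (c k).e.target) (hc : ∀ k, T.IsLinearCell (c k)) :
    T.LinearSliders (cellSliders hm c hdis hlf) where
  isPL_slide p τ := (hc p.1).isPL_slide p.2 τ
  exists_ray k := by
    obtain ⟨y, A, hA⟩ := hc k
    refine ⟨A (Pi.single 0 1), fun i x hx => ?_⟩
    change T.embed ((c k).e (Cell.modelArc (m k) i x)) = T.embed ((c k).e 0) + _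
    rw [hA 0 (by simp), hA _ ((c k).source_eq ▸ (c k).modelArc_mem_source i x), map_zero, add_zero,
      Cell.modelArc_of_mem hx, ← map_smul, ← Pi.single_smul', smul_eq_mul, mul_one]
    congr 3
    ring

variable {T S}

/-- Being PL is local. Near `q` only finitely many pieces have a nonzero parameter, and those not
containing `q` can be avoided, so `glue τ` coincides there with one slide or with the identity. This
includes the base points, where infinitely many pieces accumulate. -/
lemma LinearSliders.isPL_glue (hS : T.LinearSliders S) {τ : κ × ℕ → Ioo (-1 : ℝ) 1}
    (hτ : ∀ k, {i | (τ (k, i) : ℝ) ≠ 0}.Finite) : T.IsPL (S.glue τ) := by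
  refine T.isPL_of_eventuallyEq fun q => ?_
  obtain ⟨U, hU, hfin⟩ := S.locallyFinite q
  have hfin' : {p : κ × ℕ | (τ p : ℝ) ≠ 0 ∧ (S.D p ∩ U).Nonempty ∧ q ∉ S.D p}.Finite := by
    refine (hfin.biUnion fun k _ => (hτ k).image (Prod.mk k)).subset ?_
    rintro ⟨k, i⟩ ⟨h1, h2, -⟩
    simp only [mem_iUnion]
    exact ⟨k, h2.mono (inter_subset_inter_left _ (subset_iUnion (fun i => S.D (k, i)) i)), i, h1, rfl⟩
  have hW : U ∩ ⋂ p ∈ {p : κ × ℕ | (τ p : ℝ) ≠ 0 ∧ (S.D p ∩ U).Nonempty ∧ q ∉ S.D p}, (S.D p)ᶜ ∈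
      𝓝 q := by
    refine Filter.inter_mem hU ((Filter.biInter_mem hfin').2 ?_)
    rintro p ⟨-, -, hp⟩
    exact (S.isCompact_D p).isClosed.isOpen_compl.mem_nhds hp
  have key : ∀ x ∈ U ∩ ⋂ p ∈ {p : κ × ℕ | (τ p : ℝ) ≠ 0 ∧ (S.D p ∩ U).Nonempty ∧ q ∉ S.D p},
      (S.D p)ᶜ, ∀ p, x ∈ S.D p → q ∉ S.D p → S.glue τ x = x := by
    intro x hx p hp hq
    have h0 : (τ p : ℝ) = 0 := by
      by_contra h0
      exact mem_iInter₂.1 hx.2 p ⟨h0, ⟨x, hp, hx.1⟩, hq⟩ hp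
    have h0' : τ p = ⟨0, by norm_num⟩ := Subtype.ext h0
    rw [S.glue_of_mem τ hp, h0']
    exact S.slide_zero p x
  by_cases hq : ∃ p, q ∈ S.D p
  · obtain ⟨p, hp⟩ := hq
    refine ⟨S.slide p (τ p), hS.isPL_slide p _, ?_⟩
    filter_upwards [hW] with x hx
    by_cases hxp : x ∈ S.D p
    · exact S.glue_of_mem τ hxp
    · rw [S.slide_of_notMem p (τ p) x hxp]
      by_cases hx' : ∃ p', x ∈ S.D p'
      · obtain ⟨p', hp'⟩ := hx'
        refine key x hx p' hp' fun hq' => ?_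
        have hne : p ≠ p' := fun h => hxp (h ▸ hp')
        exact disjoint_left.1 (S.disjoint_D hne) hp hq'
      · exact S.glue_of_notMem τ (not_exists.1 hx')
  · refine ⟨Homeomorph.refl M, T.isPL_refl, ?_⟩
    filter_upwards [hW] with x hx
    by_cases hx' : ∃ p', x ∈ S.D p'
    · obtain ⟨p', hp'⟩ := hx'
      exact key x hx p' hp' fun hq' => hq ⟨p', hq'⟩
    · exact S.glue_of_notMem τ (not_exists.1 hx')

lemma LinearSliders.twist_mem_PL (hS : T.LinearSliders S) {X : Set M}
    (hX : ∀ p, Disjoint (S.D p) X) {τ : κ × ℕ → Ioo (-1 : ℝ) 1}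
    (hτ : ∀ k, {i | (τ (k, i) : ℝ) ≠ 0}.Finite) {h : HomeoFix M X} (hh : h ∈ HomeoFix.PL T X) :
    S.twist hX h τ ∈ HomeoFix.PL T X ∧ S.untwist hX h τ ∈ HomeoFix.PL T X :=
  ⟨(hS.isPL_glue hτ).trans hh, (hS.isPL_glue hτ).symm.trans hh⟩

/-- The two halves of an affinely parametrized arc have the same size. -/
lemma segSize_eq_of_affine {Z : Type*} [NormedAddCommGroup Z] [NormedSpace ℝ Z] {γ : ℝ → Z}
    {b w : Z} (h : ∀ x ∈ Icc (-1 : ℝ) 1, γ x = b + x • w) : segSize γ (-1) 0 = segSize γ 0 1 := by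
  have hm : γ '' uIcc 0 1 = (fun z => z + w) '' (γ '' uIcc (-1) 0) := by
    rw [uIcc_of_le zero_le_one, uIcc_of_le (by norm_num), image_image]
    have e : Icc (0 : ℝ) 1 = (fun x => x + 1) '' Icc (-1) 0 := by simp
    rw [e, image_image]
    refine image_congr fun x hx => ?_
    rw [h x ⟨hx.1, hx.2.trans zero_le_one⟩, h (x + 1) ⟨by linarith [hx.1], by linarith [hx.2]⟩]
    module
  rw [segSize, segSize, hm, packSize_image fun x _ y _ => dist_add_right x y w]

/-- A PL map is affine on a short initial piece of the ray issuing from the base point. Arcs far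
enough along the sequence lie on that piece, so their images are affinely parametrized; the halves
of such an image are translates of each other, hence balanced at 0. -/
lemma LinearSliders.finite_coord_ne_zero (hS : T.LinearSliders S) {h : M ≃ₜ M} (hh : T.IsPL h)
    (k : κ) : {i | (S.coord T.embed h (k, i) : ℝ) ≠ 0}.Finite := by
  obtain ⟨w, hw⟩ := hS.exists_ray k
  rw [isPL_iff] at hh
  obtain ⟨U, hU, hstar⟩ := hh.2 (T.homeo.symm (S.pt k))
  have hU' : T.homeo.symm ⁻¹' U ∈ 𝓝 (S.pt k) := T.homeo.symm.continuous.continuousAt hU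
  have hev := S.eventually_subset k _ hU'
  obtain ⟨j, hj⟩ := Filter.eventually_atTop.1 hev
  have hread : ∀ q, (T.read h (T.homeo.symm q) : EuclideanSpace ℝ (Fin T.N)) = T.embed (h q) :=
    fun q => by simp [read, embed]
  have hjU : T.homeo.symm (S.arc (k, j) 0) ∈ U := hj j le_rfl (S.arc_mem (k, j) 0)
  set s₀ : ℝ := (1 / 2) ^ j with hs₀
  have hs₀0 : 0 < s₀ := by positivity
  have hp0 : T.embed (S.arc (k, j) 0) = T.embed (S.pt k) + s₀ • w := by
    rw [hw j 0 (by norm_num)]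
    simp [hs₀]
  -- The star property at the base point is applied once, to the midpoint of the `j`-th arc at ray
  -- parameter `s₀`; all smaller ray parameters lie on the segment to it.
  have hray : ∀ i x, x ∈ Icc (-1 : ℝ) 1 → (1 / 2) ^ i * (1 + x / 8) ≤ s₀ →
      T.embed (h (S.arc (k, i) x)) = T.embed (h (S.pt k)) + ((1 / 2) ^ i * (1 + x / 8)) •
        (s₀⁻¹ • (T.embed (h (S.arc (k, j) 0)) - T.embed (h (S.pt k)))) := by
    intro i x hx hle
    have hnn : 0 ≤ (1 / 2 : ℝ) ^ i * (1 + x / 8) :=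
      mul_nonneg (by positivity) (by linarith [hx.1])
    set u := (1 / 2 : ℝ) ^ i * (1 + x / 8)
    obtain ⟨h1, h2⟩ := hstar _ hjU (u / s₀) ⟨by positivity, (div_le_one hs₀0).2 hle⟩
    have e1 : (⟨_, h1⟩ : T.K.space) = T.homeo.symm (S.arc (k, i) x) := by
      refine Subtype.ext ?_
      change AffineMap.lineMap (T.embed (S.pt k)) (T.embed (S.arc (k, j) 0)) (u / s₀) =
        T.embed (S.arc (k, i) x)
      rw [hp0, hw i x hx, AffineMap.lineMap_apply_module', add_sub_cancel_left, smul_smul,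
        div_mul_cancel₀ _ hs₀0.ne', add_comm]
    rw [e1, hread, hread, hread] at h2
    rw [h2, AffineMap.lineMap_apply_module', smul_smul, add_comm, div_eq_mul_inv]
  -- From index `j + 1` on, an arc reaches at most `9/8 * (1/2)^i`, which is below `s₀`; the `j`-th
  -- arc itself extends beyond its midpoint.
  have hz : ∀ i ≥ j + 1, (S.coord T.embed h (k, i) : ℝ) = 0 := by
    intro i hi
    have h0 : (0 : ℝ) ∈ Ioo (-1 : ℝ) 1 := by norm_num
    suffices hc : S.coord T.embed h (k, i) = ⟨0, h0⟩ by rw [hc]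
    rw [S.coord_eq_iff T.continuous_embed T.embed_injective]
    have hsmall : ∀ x ∈ Icc (-1 : ℝ) 1, (1 / 2 : ℝ) ^ i * (1 + x / 8) ≤ s₀ := by
      intro x hx
      have h1 : (1 / 2 : ℝ) ^ i ≤ (1 / 2) ^ (j + 1) :=
        pow_le_pow_of_le_one (by norm_num) (by norm_num) hi
      rw [pow_succ] at h1
      have h2 : (0 : ℝ) < (1 / 2) ^ i := by positivity
      nlinarith [hx.1, hx.2]
    have e1 : segSize (fun x => T.embed (S.arc (k, i) x)) (-1) 0 =
        segSize (fun x => T.embed (S.arc (k, i) x)) 0 1 :=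
      segSize_eq_of_affine (b := T.embed (S.pt k) + ((1 / 2 : ℝ) ^ i) • w)
        (w := ((1 / 2 : ℝ) ^ i / 8) • w) fun x hx => by
          simp only [hw i x hx]
          module
    have e2 : segSize (fun x => T.embed (h (S.arc (k, i) x))) (-1) 0 =
        segSize (fun x => T.embed (h (S.arc (k, i) x))) 0 1 :=
      segSize_eq_of_affine (b := T.embed (h (S.pt k)) + ((1 / 2 : ℝ) ^ i) •
          (s₀⁻¹ • (T.embed (h (S.arc (k, j) 0)) - T.embed (h (S.pt k)))))
        (w := ((1 / 2 : ℝ) ^ i / 8) •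
          (s₀⁻¹ • (T.embed (h (S.arc (k, j) 0)) - T.embed (h (S.pt k))))) fun x hx => by
          simp only [hray i x hx (hsmall x hx)]
          module
    change _ * segSize (fun x => T.embed (h (S.arc (k, i) x))) (-1) 0 =
      _ * segSize (fun x => T.embed (h (S.arc (k, i) x))) 0 1
    rw [e1, e2]
  refine (finite_lt_nat (j + 1)).subset fun i hi => ?_
  by_contra hlt
  exact hi (hz i (not_lt.1 hlt))

end C1Triangulation

/-! ### From sliding parameters to sequences -/

section Parameters

open Set

/-- The open interval is stretched over the line. -/
def stretch : Ioo (-1 : ℝ) 1 ≃ₜ ℝ where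
  toFun x := x / (1 - |(x : ℝ)|)
  invFun y := ⟨y / (1 + |y|), abs_lt.1 (by
    rw [abs_div, abs_of_pos (by positivity : 0 < 1 + |y|), div_lt_one (by positivity)]
    linarith)⟩
  left_inv x := by
    have h : 0 < 1 - |(x : ℝ)| := sub_pos.2 (abs_lt.2 x.2)
    refine Subtype.ext ?_
    simp only [abs_div, abs_of_pos h]
    field_simp
    ring
  right_inv y := by
    have h : 0 < 1 + |y| := by positivity
    simp only [abs_div, abs_of_pos h]
    field_simp
    ring
  continuous_toFun := Continuous.div (by fun_prop) (by fun_prop) fun x =>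
    (sub_pos.2 (abs_lt.2 x.2)).ne'
  continuous_invFun := by
    have h : Continuous fun y : ℝ => y / (1 + |y|) :=
      Continuous.div (by fun_prop) (by fun_prop) fun y =>
        (by positivity : (0 : ℝ) < 1 + |y|).ne'
    exact h.subtype_mk _

lemma coe_stretch_symm (y : ℝ) : (stretch.symm y : ℝ) = y / (1 + |y|) := rfl

lemma coe_eq_stretch (x : Ioo (-1 : ℝ) 1) : (x : ℝ) = stretch x / (1 + |stretch x|) := by
  rw [← coe_stretch_symm, stretch.symm_apply_apply]

lemma abs_coe_eq_stretch (x : Ioo (-1 : ℝ) 1) :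
    |(x : ℝ)| = |stretch x| / (1 + |stretch x|) := by
  rw [coe_eq_stretch x, abs_div, abs_of_pos (by positivity : 0 < 1 + |stretch x|)]

lemma stretch_eq_zero_iff (x : Ioo (-1 : ℝ) 1) : stretch x = 0 ↔ (x : ℝ) = 0 := by
  rw [coe_eq_stretch x, div_eq_zero_iff]
  have : 1 + |stretch x| ≠ 0 := by positivity
  simp [this]

lemma exists_stretch_bound_iff {J : Type*} (τ : J → Ioo (-1 : ℝ) 1) :
    (∃ C, ∀ j, |stretch (τ j)| ≤ C) ↔ ∃ δ < 1, ∀ j, |(τ j : ℝ)| ≤ δ := by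
  constructor
  · rintro ⟨C, hC⟩
    refine ⟨max C 0 / (1 + max C 0), ?_, fun j => ?_⟩
    · rw [div_lt_one (by positivity)]
      linarith
    · have h := (hC j).trans (le_max_left C 0)
      rw [abs_coe_eq_stretch, div_le_div_iff₀ (by positivity) (by positivity)]
      nlinarith
  · rintro ⟨δ, hδ, h⟩
    refine ⟨δ / (1 - δ), fun j => ?_⟩
    have h1 := h j
    rw [abs_coe_eq_stretch, div_le_iff₀ (by positivity)] at h1
    rw [le_div_iff₀ (by linarith)]
    linarith

/-- Parameters indexed by a single row are sequences. -/
def rowHomeo : (Unit × ℕ → Ioo (-1 : ℝ) 1) ≃ₜ SeqS where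
  toFun τ i := stretch (τ ((), i))
  invFun x p := stretch.symm (x p.2)
  left_inv τ := by ext ⟨⟨⟩, i⟩; simp
  right_inv x := by ext i; simp
  continuous_toFun := continuous_pi fun i => stretch.continuous.comp (continuous_apply _)
  continuous_invFun := continuous_pi fun p => stretch.symm.continuous.comp (continuous_apply _)

/-- Parameters indexed by countably many rows are double sequences. -/
def rowsHomeo : (ℕ × ℕ → Ioo (-1 : ℝ) 1) ≃ₜ SeqSInf where
  toFun τ k i := stretch (τ (k, i))
  invFun x p := stretch.symm (x p.1 p.2)
  left_inv τ := by ext ⟨k, i⟩; simp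
  right_inv x := by ext k i; simp
  continuous_toFun := continuous_pi fun k => continuous_pi fun i =>
    stretch.continuous.comp (continuous_apply _)
  continuous_invFun := continuous_pi fun p =>
    stretch.symm.continuous.comp ((continuous_apply p.2).comp (continuous_apply p.1))

variable {κ : Type*}

/-- All but finitely many entries of each row vanish. -/
def RowFinite (τ : κ × ℕ → Ioo (-1 : ℝ) 1) : Prop := ∀ k, {i | (τ (k, i) : ℝ) ≠ 0}.Finite

/-- All but finitely many rows vanish. -/
def FinitelyManyRows (τ : κ × ℕ → Ioo (-1 : ℝ) 1) : Prop :=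
  {k | ∃ i, (τ (k, i) : ℝ) ≠ 0}.Finite

open CellSliders

lemma tameOn_singleton_iff {τ : κ × ℕ → Ioo (-1 : ℝ) 1} (k : κ) :
    TameOn {k} τ ↔ ∃ C, ∀ i, |stretch (τ (k, i))| ≤ C := by
  simp [exists_stretch_bound_iff (fun i => τ (k, i)), TameOn]

lemma tameOn_univ_iff {τ : κ × ℕ → Ioo (-1 : ℝ) 1} :
    TameOn univ τ ↔ ∃ C, ∀ k i, |stretch (τ (k, i))| ≤ C := by
  simpa [TameOn] using (exists_stretch_bound_iff τ).symm

/-- Finitely many rows have a common bound below 1, and the remaining parameters are 0. Thus locally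
Lipschitz control becomes global. -/
lemma tameOn_univ_of_finitelyManyRows {τ : κ × ℕ → Ioo (-1 : ℝ) 1} (h₁ : ∀ k, TameOn {k} τ)
    (h₂ : FinitelyManyRows τ) : TameOn univ τ := by
  obtain ⟨δ, hδ, h⟩ := tameOn_of_finite h₂ fun k _ => h₁ k
  refine ⟨max δ 0, max_lt hδ one_pos, fun k _ i => ?_⟩
  by_cases h0 : (τ (k, i) : ℝ) = 0
  · rw [h0, abs_zero]
    exact le_max_right _ _
  · exact (h k ⟨i, h0⟩ i).trans (le_max_left _ _)

lemma rowHomeo_mem_bigSigma {τ : Unit × ℕ → Ioo (-1 : ℝ) 1} :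
    rowHomeo τ ∈ bigSigma ↔ ∀ k, TameOn {k} τ :=
  ⟨fun h _ => (tameOn_singleton_iff _).2 h, fun h => (tameOn_singleton_iff _).1 (h ())⟩

lemma rowHomeo_mem_smallSigma {τ : Unit × ℕ → Ioo (-1 : ℝ) 1} :
    rowHomeo τ ∈ smallSigma ↔ RowFinite τ := by
  have : ∀ k, {i | (τ (k, i) : ℝ) ≠ 0} = {i | rowHomeo τ i ≠ 0} := fun k => by
    ext i
    exact (stretch_eq_zero_iff _).not.symm
  simp [RowFinite, smallSigma, this]

lemma rowsHomeo_mem_bigSigmaInf {τ : ℕ × ℕ → Ioo (-1 : ℝ) 1} :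
    rowsHomeo τ ∈ bigSigmaInf ↔ ∀ k, TameOn {k} τ :=
  forall_congr' fun k => (tameOn_singleton_iff k).symm

lemma rowsHomeo_mem_smallSigmaInf {τ : ℕ × ℕ → Ioo (-1 : ℝ) 1} :
    rowsHomeo τ ∈ smallSigmaInf ↔ RowFinite τ := by
  refine forall_congr' fun k => ?_
  have : {i | (τ (k, i) : ℝ) ≠ 0} = {i | rowsHomeo τ k i ≠ 0} := by
    ext i
    exact (stretch_eq_zero_iff _).not.symm
  rw [this]
  rfl

lemma finite_rowsHomeo_ne_zero {τ : ℕ × ℕ → Ioo (-1 : ℝ) 1} :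
    {k | rowsHomeo τ k ≠ 0}.Finite ↔ FinitelyManyRows τ := by
  have : {k | rowsHomeo τ k ≠ 0} = {k | ∃ i, (τ (k, i) : ℝ) ≠ 0} := by
    ext k
    rw [mem_ofPred_eq, Function.ne_iff]
    exact exists_congr fun i => (stretch_eq_zero_iff _).not
  rw [this]
  rfl

lemma rowsHomeo_mem_bigSigmaInfFin {τ : ℕ × ℕ → Ioo (-1 : ℝ) 1} :
    rowsHomeo τ ∈ bigSigmaInfFin ↔ (∀ k, TameOn {k} τ) ∧ FinitelyManyRows τ :=
  and_congr rowsHomeo_mem_bigSigmaInf finite_rowsHomeo_ne_zero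

lemma rowsHomeo_mem_smallSigmaInfFin {τ : ℕ × ℕ → Ioo (-1 : ℝ) 1} :
    rowsHomeo τ ∈ smallSigmaInfFin ↔ RowFinite τ ∧ FinitelyManyRows τ :=
  and_congr rowsHomeo_mem_smallSigmaInf finite_rowsHomeo_ne_zero

lemma rowsHomeo_mem_seqSInfBdd {τ : ℕ × ℕ → Ioo (-1 : ℝ) 1} :
    rowsHomeo τ ∈ seqSInfBdd ↔ TameOn univ τ :=
  tameOn_univ_iff.symm

end Parameters

/-! ### Discrete families of open sets in noncompact spaces -/

section DiscreteFamilies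

open Set Filter

variable {M : Type*} [MetricSpace M]

/-- A sequence without convergent subsequence is locally finite, so it meets compact sets in
finitely many indices. Its range off `X` is therefore infinite and can be enumerated injectively. -/
lemma exists_injective_locallyFinite [NoncompactSpace M] {X : Set M} (hX : IsCompact X) :
    ∃ y : ℕ → M, Function.Injective y ∧ (∀ k, y k ∉ X) ∧ LocallyFinite fun k => {y k} := by
  have hns : ¬ IsSeqCompact (univ : Set M) := fun h =>
    noncompact_univ M (isCompact_iff_isSeqCompact.2 h)
  simp only [IsSeqCompact, mem_univ, forall_const, true_and, not_forall, not_exists] at hns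
  obtain ⟨x, hx⟩ := hns
  have hlf : LocallyFinite fun k => {x k} := by
    intro a
    have hnc : ¬ MapClusterPt a atTop x := fun h => by
      obtain ⟨φ, h1, h2⟩ := h.tendsto_subseq
      exact hx a φ ⟨h1, h2⟩
    rw [mapClusterPt_iff_frequently] at hnc
    push Not at hnc
    obtain ⟨U, hU, h⟩ := hnc
    refine ⟨U, hU, ?_⟩
    rw [← Nat.cofinite_eq_atTop] at h
    refine Set.Finite.subset h ?_
    rintro k ⟨z, hz, hzU⟩
    rw [mem_singleton_iff.1 hz] at hzU
    exact fun hn => hn hzU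
  have hfin : ∀ K : Set M, IsCompact K → {k | x k ∈ K}.Finite := fun K hK =>
    (hlf.finite_nonempty_inter_compact hK).subset fun k hk => ⟨x k, rfl, hk⟩
  have hinf : (range x \ X).Infinite := by
    intro hf
    have h1 := hfin _ (hf.isCompact.union hX)
    refine infinite_univ (h1.subset fun k _ => ?_)
    by_cases hk : x k ∈ X
    · exact Or.inr hk
    · exact Or.inl ⟨⟨k, rfl⟩, hk⟩
  refine ⟨fun k => hinf.natEmbedding _ k, fun k l h => (hinf.natEmbedding _).injective
    (Subtype.ext h), fun k => (hinf.natEmbedding _ k).2.2, fun a => ?_⟩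
  obtain ⟨U, hU, h⟩ := hlf a
  refine ⟨U, hU, Finite.of_finite_image (f := fun k => (hinf.natEmbedding _ k : M))
    ((h.image x).subset ?_) fun k _ l _ h => (hinf.natEmbedding _).injective (Subtype.ext h)⟩
  rintro _ ⟨k, ⟨z, hz, hzU⟩, rfl⟩
  obtain ⟨j, hj⟩ := (hinf.natEmbedding _ k).2.1
  rw [mem_singleton_iff.1 hz] at hzU
  exact ⟨j, ⟨x j, rfl, hj ▸ hzU⟩, hj⟩

lemma exists_discrete_open_family [NoncompactSpace M] {X : Set M} (hX : IsCompact X) :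
    ∃ O : ℕ → Set M, (∀ k, IsOpen (O k)) ∧ (∀ k, (O k).Nonempty) ∧ (∀ k, Disjoint (O k) X) ∧
      Pairwise (Function.onFun Disjoint O) ∧ LocallyFinite O := by
  obtain ⟨y, hy, hyX, hlf⟩ := exists_injective_locallyFinite hX
  have hsep : ∀ k, ∃ ρ > 0, ∀ l, l ≠ k → ρ ≤ dist (y k) (y l) := by
    intro k
    have hcl : IsClosed (⋃ l : {l // l ≠ k}, ({y l} : Set M)) :=
      (hlf.comp_injective Subtype.val_injective).isClosed_iUnion fun l => isClosed_singleton
    have hk : y k ∉ ⋃ l : {l // l ≠ k}, ({y l} : Set M) := by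
      simp only [mem_iUnion, mem_singleton_iff, not_exists]
      exact fun l h => l.2 (hy h.symm)
    obtain ⟨ρ, hρ, hb⟩ := Metric.mem_nhds_iff.1 (hcl.isOpen_compl.mem_nhds hk)
    refine ⟨ρ, hρ, fun l hl => not_lt.1 fun hlt => ?_⟩
    exact hb (show y l ∈ Metric.ball (y k) ρ by rwa [Metric.mem_ball, dist_comm])
      (mem_iUnion.2 ⟨⟨l, hl⟩, rfl⟩)
  choose ρ hρ hρd using hsep
  -- The bound `ρ k / 2` makes the balls disjoint; `1 / (k + 1)` makes them shrink, so that local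
  -- finiteness of the centres passes to the balls.
  have hr : ∀ k : ℕ, 0 < min (ρ k / 2) (1 / (k + 1)) := fun k =>
    lt_min (half_pos (hρ k)) (by positivity)
  refine ⟨fun k => Metric.ball (y k) (min (ρ k / 2) (1 / (k + 1))) \ X,
    fun k => Metric.isOpen_ball.sdiff hX.isClosed,
    fun k => ⟨y k, Metric.mem_ball_self (hr k), hyX k⟩, fun k => disjoint_sdiff_left,
    fun k l hkl => disjoint_left.2 fun z hz hz' => ?_, fun a => ?_⟩
  · have h1 := (Metric.mem_ball.1 hz.1).trans_le (min_le_left _ _)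
    have h2 := (Metric.mem_ball.1 hz'.1).trans_le (min_le_left _ _)
    have h3 := hρd k l hkl.symm
    have h4 := hρd l k hkl
    rw [dist_comm] at h4
    linarith [dist_triangle_left (y k) (y l) z]
  · obtain ⟨U, hU, hfin⟩ := hlf a
    obtain ⟨ε, hε, hb⟩ := Metric.mem_nhds_iff.1 hU
    obtain ⟨N, hN⟩ := exists_nat_one_div_lt (half_pos hε)
    refine ⟨Metric.ball a (ε / 2), Metric.ball_mem_nhds _ (half_pos hε),
      (hfin.union (finite_lt_nat N)).subset ?_⟩
    rintro k ⟨z, ⟨hz, -⟩, hza⟩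
    by_cases hk : k < N
    · exact Or.inr hk
    · refine Or.inl ⟨y k, rfl, hb ?_⟩
      have h1 := (Metric.mem_ball.1 hz).trans_le (min_le_right _ _)
      have h2 : (1 : ℝ) / (k + 1) ≤ 1 / (N + 1) :=
        one_div_le_one_div_of_le (by positivity) (by
          have : (N : ℝ) ≤ k := by exact_mod_cast not_lt.1 hk
          linarith)
      rw [Metric.mem_ball] at hza ⊢
      linarith [dist_triangle_left (y k) a z]

end DiscreteFamilies

/-! ### Stability of groups of homeomorphisms -/

section Stability

open Set Bundle CellSliders

lemma diamComparable_id {M : Type*} [MetricSpace M] : DiamComparable (id : M → M) 1 univ :=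
  fun A _ _ _ => by simp

section Coordinates

variable {M : Type*} [MetricSpace M] {κ : Type*} {S : CellSliders M κ} {X : Set M}
  (hX : ∀ p, Disjoint (S.D p) X)

lemma twist_mem_LIPc {τ : κ × ℕ → Ioo (-1 : ℝ) 1} (h₁ : ∀ k, TameOn {k} τ)
    (h₂ : FinitelyManyRows τ) {h : HomeoFix M X} (hh : h ∈ HomeoFix.LIPc M X) :
    S.twist hX h τ ∈ HomeoFix.LIPc M X ∧ S.untwist hX h τ ∈ HomeoFix.LIPc M X := by
  have a := S.twist_mem_LIP hX (tameOn_univ_of_finitelyManyRows h₁ h₂) hh.1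
  have b := S.twist_mem_compactSupp hX h₂ (fun k hk i => by
    by_contra h0
    exact hk ⟨i, h0⟩) hh.2
  exact ⟨⟨a.1, b.1⟩, a.2, b.2⟩

lemma LIP_subset_locLIP : HomeoFix.LIP M X ⊆ HomeoFix.locLIP M X := by
  rintro h ⟨⟨C₁, h₁⟩, C₂, h₂⟩
  exact ⟨h₁.locallyLipschitz, h₂.locallyLipschitz⟩

variable {n : ℕ} {H : Type*} [TopologicalSpace H]
  {I : ModelWithCorners ℝ (EuclideanSpace ℝ (Fin n)) H} [ChartedSpace H M]
  {T : C1Triangulation I M}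

lemma twist_mem_PLc (hS : T.LinearSliders S) {τ : κ × ℕ → Ioo (-1 : ℝ) 1} (h₁ : RowFinite τ)
    (h₂ : FinitelyManyRows τ) {h : HomeoFix M X} (hh : h ∈ HomeoFix.PLc T X) :
    S.twist hX h τ ∈ HomeoFix.PLc T X ∧ S.untwist hX h τ ∈ HomeoFix.PLc T X := by
  have a := hS.twist_mem_PL hX h₁ hh.1
  have b := S.twist_mem_compactSupp hX h₂ (fun k hk i => by
    by_contra h0
    exact hk ⟨i, h0⟩) hh.2
  exact ⟨⟨a.1, b.1⟩, a.2, b.2⟩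

end Coordinates

variable {n : ℕ} {H : Type*} [TopologicalSpace H]
  {I : ModelWithCorners ℝ (EuclideanSpace ℝ (Fin n)) H}
  {M : Type*} [MetricSpace M] [ChartedSpace H M]

lemma C1Triangulation.IsCompactSubpolyhedron.isCompact {T : C1Triangulation I M} {X : Set M}
    (hX : T.IsCompactSubpolyhedron X) : IsCompact X := by
  obtain ⟨L, hfin, hsub, hL⟩ := hX
  have hc : IsCompact L.space := hfin.isCompact_biUnion fun s _ =>
    s.finite_toSet.isCompact_convexHull (𝕜 := ℝ)
  have : X = T.toFun '' L.space := by
    rw [hL]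
    ext x
    constructor
    · exact fun hx => ⟨T.embed x, ⟨_, ⟨x, hx, rfl⟩, rfl⟩, T.toFun_embed x⟩
    · rintro ⟨_, ⟨_, ⟨x', hx', rfl⟩, rfl⟩, rfl⟩
      exact (T.toFun_embed x').symm ▸ hx'
  rw [this]
  exact hc.image_of_continuousOn (T.toFun_continuousOn.mono hsub)

variable [IsManifold I ∞ M]
  [RiemannianBundle (fun x : M => TangentSpace I x)]
  [IsContMDiffRiemannianBundle I ∞ (EuclideanSpace ℝ (Fin n)) (fun x : M => TangentSpace I x)]
  [IsRiemannianManifold I M]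

/-- Every cell found by `exists_cell` has the same distortion constant, as the uniform estimates of
`cellSliders` require. -/
lemma C1Triangulation.exists_linearSliders (T : C1Triangulation I M) (hn : 1 ≤ n) {κ : Type*}
    {X : Set M} {O : κ → Set M} (hO : ∀ k, IsOpen (O k)) (hne : ∀ k, (O k).Nonempty)
    (hX : ∀ k, Disjoint (O k) X) (hdis : Pairwise (Function.onFun Disjoint O))
    (hlf : LocallyFinite O) :
    ∃ S : CellSliders M κ, T.LinearSliders S ∧ ∀ p, Disjoint (S.D p) X := by
  choose m hm c hc hlin using fun k => T.exists_cell hn (hO k) (hne k)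
  refine ⟨cellSliders hm c (fun k l hkl => (hdis hkl).mono (hc k) (hc l)) (hlf.subset hc),
    T.linearSliders_cellSliders hm c _ _ hlin, fun p => (hX p.1).mono_left ?_⟩
  rintro _ ⟨v, hv, rfl⟩
  exact hc p.1 ((c p.1).e.map_source ((c p.1).axisBox_subset_source _ hv))

variable {T : C1Triangulation I M} {X : Set M} [LocallyCompactSpace M]

/-- With a single row, locally Lipschitz homeomorphisms already have bounded coordinates, while a
bounded row gives a globally Lipschitz slide of compact support. Hence the three Lipschitz groups
share one model set, and so do the two PL groups. -/
lemma isTupleStable_seqS {S : CellSliders M Unit} (hS : T.LinearSliders S)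
    (hX : ∀ p, Disjoint (S.D p) X) :
    IsTupleStable (HomeoFix M X) SeqS
      ![HomeoFix.locLIP M X, HomeoFix.LIP M X, HomeoFix.LIPc M X,
        HomeoFix.PL T X, HomeoFix.PLc T X]
      ![bigSigma, bigSigma, bigSigma, smallSigma, smallSigma] := by
  have hloc : ∀ h ∈ HomeoFix.locLIP M X, rowHomeo (S.coord T.embed h.1) ∈ bigSigma := fun h hh =>
    rowHomeo_mem_bigSigma.2 (S.tameOn_coord T.continuous_embed T.embed_injective
      T.exists_diamComparable hh)
  have hPL : ∀ h ∈ HomeoFix.PL T X, rowHomeo (S.coord T.embed h.1) ∈ smallSigma := fun h hh =>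
    rowHomeo_mem_smallSigma.2 (hS.finite_coord_ne_zero hh)
  have hrow : ∀ τ : Unit × ℕ → Ioo (-1 : ℝ) 1, FinitelyManyRows τ := fun τ => toFinite _
  have hloc' := fun τ (hτ : rowHomeo τ ∈ bigSigma) h hh =>
    S.twist_mem_locLIP (h := h) hX (rowHomeo_mem_bigSigma.1 hτ) hh
  have hLIP' := fun τ (hτ : rowHomeo τ ∈ bigSigma) h hh => S.twist_mem_LIP (h := h) hX
    (tameOn_univ_of_finitelyManyRows (rowHomeo_mem_bigSigma.1 hτ) (hrow τ)) hh
  have hLIPc' := fun τ (hτ : rowHomeo τ ∈ bigSigma) h hh =>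
    twist_mem_LIPc (h := h) hX (rowHomeo_mem_bigSigma.1 hτ) (hrow τ) hh
  have hPL' := fun τ (hτ : rowHomeo τ ∈ smallSigma) h hh =>
    hS.twist_mem_PL (h := h) hX (rowHomeo_mem_smallSigma.1 hτ) hh
  have hPLc' := fun τ (hτ : rowHomeo τ ∈ smallSigma) h hh =>
    twist_mem_PLc (h := h) hX hS (rowHomeo_mem_smallSigma.1 hτ) (hrow τ) hh
  refine S.isTupleStable hX T.continuous_embed T.embed_injective rowHomeo mergeSeq ?_ ?_ ?_ ?_ <;>
    intro j <;> fin_cases j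
  · exact mergeSeq_mem_bigSigma
  · exact mergeSeq_mem_bigSigma
  · exact mergeSeq_mem_bigSigma
  · exact mergeSeq_mem_smallSigma
  · exact mergeSeq_mem_smallSigma
  · exact hloc
  · exact fun h hh => hloc h (LIP_subset_locLIP hh)
  · exact fun h hh => hloc h (LIP_subset_locLIP hh.1)
  · exact hPL
  · exact fun h hh => hPL h hh.1
  · exact fun τ hτ h hh => (hloc' τ hτ h hh).1
  · exact fun τ hτ h hh => (hLIP' τ hτ h hh).1
  · exact fun τ hτ h hh => (hLIPc' τ hτ h hh).1
  · exact fun τ hτ h hh => (hPL' τ hτ h hh).1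
  · exact fun τ hτ h hh => (hPLc' τ hτ h hh).1
  · exact fun τ hτ h hh => (hloc' τ hτ h hh).2
  · exact fun τ hτ h hh => (hLIP' τ hτ h hh).2
  · exact fun τ hτ h hh => (hLIPc' τ hτ h hh).2
  · exact fun τ hτ h hh => (hPL' τ hτ h hh).2
  · exact fun τ hτ h hh => (hPLc' τ hτ h hh).2

lemma isTupleStable_seqSInf {S : CellSliders M ℕ} (hS : T.LinearSliders S)
    (hX : ∀ p, Disjoint (S.D p) X) :
    IsTupleStable (HomeoFix M X) SeqSInf
      ![HomeoFix.locLIP M X, HomeoFix.LIPc M X, HomeoFix.PL T X, HomeoFix.PLc T X]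
      ![bigSigmaInf, bigSigmaInfFin, smallSigmaInf, smallSigmaInfFin] := by
  have hloc : ∀ h ∈ HomeoFix.locLIP M X, ∀ k, TameOn {k} (S.coord T.embed h.1) := fun h hh =>
    S.tameOn_coord T.continuous_embed T.embed_injective T.exists_diamComparable hh
  have hc : ∀ h ∈ HomeoFix.compactSupp M X, FinitelyManyRows (S.coord T.embed h.1) := fun h hh =>
    S.finite_coord_ne_zero T.continuous_embed T.embed_injective hh
  have hPL : ∀ h ∈ HomeoFix.PL T X, RowFinite (S.coord T.embed h.1) := fun h hh =>
    hS.finite_coord_ne_zero hh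
  have hloc' := fun τ (hτ : rowsHomeo τ ∈ bigSigmaInf) h hh =>
    S.twist_mem_locLIP (h := h) hX (rowsHomeo_mem_bigSigmaInf.1 hτ) hh
  have hLIPc' := fun τ (hτ : rowsHomeo τ ∈ bigSigmaInfFin) h hh =>
    twist_mem_LIPc (h := h) hX (rowsHomeo_mem_bigSigmaInfFin.1 hτ).1
      (rowsHomeo_mem_bigSigmaInfFin.1 hτ).2 hh
  have hPL' := fun τ (hτ : rowsHomeo τ ∈ smallSigmaInf) h hh =>
    hS.twist_mem_PL (h := h) hX (rowsHomeo_mem_smallSigmaInf.1 hτ) hh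
  have hPLc' := fun τ (hτ : rowsHomeo τ ∈ smallSigmaInfFin) h hh =>
    twist_mem_PLc (h := h) hX hS (rowsHomeo_mem_smallSigmaInfFin.1 hτ).1
      (rowsHomeo_mem_smallSigmaInfFin.1 hτ).2 hh
  refine S.isTupleStable hX T.continuous_embed T.embed_injective rowsHomeo mergeSeqInf ?_ ?_ ?_ ?_
    <;> intro j <;> fin_cases j
  · exact mergeSeqInf_mem_bigSigmaInf
  · exact mergeSeqInf_mem_bigSigmaInfFin
  · exact mergeSeqInf_mem_smallSigmaInf
  · exact mergeSeqInf_mem_smallSigmaInfFin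
  · exact fun h hh => rowsHomeo_mem_bigSigmaInf.2 (hloc h hh)
  · exact fun h hh => rowsHomeo_mem_bigSigmaInfFin.2
      ⟨hloc h (LIP_subset_locLIP hh.1), hc h hh.2⟩
  · exact fun h hh => rowsHomeo_mem_smallSigmaInf.2 (hPL h hh)
  · exact fun h hh => rowsHomeo_mem_smallSigmaInfFin.2 ⟨hPL h hh.1, hc h hh.2⟩
  · exact fun τ hτ h hh => (hloc' τ hτ h hh).1
  · exact fun τ hτ h hh => (hLIPc' τ hτ h hh).1
  · exact fun τ hτ h hh => (hPL' τ hτ h hh).1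
  · exact fun τ hτ h hh => (hPLc' τ hτ h hh).1
  · exact fun τ hτ h hh => (hloc' τ hτ h hh).2
  · exact fun τ hτ h hh => (hLIPc' τ hτ h hh).2
  · exact fun τ hτ h hh => (hPL' τ hτ h hh).2
  · exact fun τ hτ h hh => (hPLc' τ hτ h hh).2

omit [ChartedSpace H M] [IsManifold I ∞ M] [RiemannianBundle (fun x : M => TangentSpace I x)]
  [IsContMDiffRiemannianBundle I ∞ (EuclideanSpace ℝ (Fin n)) (fun x : M => TangentSpace I x)]
  [IsRiemannianManifold I M] in
-- Sizes are measured in the metric of `M` itself, where diameters are compared globally with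
-- constant 1. A Lipschitz homeomorphism then has coordinates bounded uniformly over all cells,
-- which the merely local comparison for `T.embed` would not give.
lemma isTupleStable_seqSInf_of_lipschitz {S : CellSliders M ℕ} (hX : ∀ p, Disjoint (S.D p) X) :
    IsTupleStable (HomeoFix M X) SeqSInf
      ![HomeoFix.locLIP M X, HomeoFix.LIP M X, HomeoFix.LIPc M X]
      ![bigSigmaInf, seqSInfBdd, bigSigmaInfFin] := by
  have hloc : ∀ h ∈ HomeoFix.locLIP M X, ∀ k, TameOn {k} (S.coord id h.1) := fun h hh =>
    S.tameOn_coord continuous_id Function.injective_id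
      (fun q => ⟨1, one_pos, univ, Filter.univ_mem, diamComparable_id⟩) hh
  have hloc' := fun τ (hτ : rowsHomeo τ ∈ bigSigmaInf) h hh =>
    S.twist_mem_locLIP (h := h) hX (rowsHomeo_mem_bigSigmaInf.1 hτ) hh
  have hLIP' := fun τ (hτ : rowsHomeo τ ∈ seqSInfBdd) h hh =>
    S.twist_mem_LIP (h := h) hX (rowsHomeo_mem_seqSInfBdd.1 hτ) hh
  have hLIPc' := fun τ (hτ : rowsHomeo τ ∈ bigSigmaInfFin) h hh =>
    twist_mem_LIPc (h := h) hX (rowsHomeo_mem_bigSigmaInfFin.1 hτ).1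
      (rowsHomeo_mem_bigSigmaInfFin.1 hτ).2 hh
  refine S.isTupleStable hX continuous_id Function.injective_id rowsHomeo mergeSeqInf ?_ ?_ ?_ ?_
    <;> intro j <;> fin_cases j
  · exact mergeSeqInf_mem_bigSigmaInf
  · exact mergeSeqInf_mem_seqSInfBdd
  · exact mergeSeqInf_mem_bigSigmaInfFin
  · exact fun h hh => rowsHomeo_mem_bigSigmaInf.2 (hloc h hh)
  · exact fun h hh => rowsHomeo_mem_seqSInfBdd.2 (S.tameOn_univ_coord continuous_id
      Function.injective_id one_pos diamComparable_id hh)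
  · exact fun h hh => rowsHomeo_mem_bigSigmaInfFin.2 ⟨hloc h (LIP_subset_locLIP hh.1),
      S.finite_coord_ne_zero continuous_id Function.injective_id hh.2⟩
  · exact fun τ hτ h hh => (hloc' τ hτ h hh).1
  · exact fun τ hτ h hh => (hLIP' τ hτ h hh).1
  · exact fun τ hτ h hh => (hLIPc' τ hτ h hh).1
  · exact fun τ hτ h hh => (hloc' τ hτ h hh).2
  · exact fun τ hτ h hh => (hLIP' τ hτ h hh).2
  · exact fun τ hτ h hh => (hLIPc' τ hτ h hh).2

end Stability

end

theorem proposition4p2 (n : ℕ) (hn : 1 ≤ n) {H : Type*} [TopologicalSpace H]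
    (I : ModelWithCorners ℝ (EuclideanSpace ℝ (Fin n)) H)
    -- the model space is `ℝⁿ` or a closed half-space: `M` is a manifold with or without boundary
    (hI : Set.range I = Set.univ ∨ ∃ i : Fin n, Set.range I = {x | 0 ≤ x i})
    (M : Type*) [MetricSpace M] [ConnectedSpace M] [ChartedSpace H M] [IsManifold I ∞ M]
    [Bundle.RiemannianBundle (fun x : M => TangentSpace I x)]
    [IsContMDiffRiemannianBundle I ∞ (EuclideanSpace ℝ (Fin n)) (fun x : M => TangentSpace I x)]
    [IsRiemannianManifold I M]
    (T : C1Triangulation I M) (X : Set M) (hX : T.IsCompactSubpolyhedron X)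
    (hXM : X ≠ Set.univ) :
    IsTupleStable (HomeoFix M X) SeqS
      ![HomeoFix.locLIP M X, HomeoFix.LIP M X, HomeoFix.LIPc M X,
        HomeoFix.PL T X, HomeoFix.PLc T X]
      ![bigSigma, bigSigma, bigSigma, smallSigma, smallSigma] ∧
    (NoncompactSpace M →
      IsTupleStable (HomeoFix M X) SeqSInf
        ![HomeoFix.locLIP M X, HomeoFix.LIPc M X, HomeoFix.PL T X, HomeoFix.PLc T X]
        ![bigSigmaInf, bigSigmaInfFin, smallSigmaInf, smallSigmaInfFin]) ∧
    (NoncompactSpace M →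
      (∃ ε : ℝ, 0 < ε ∧ ∃ p : ℕ → M, ∀ k l, k ≠ l → ε ≤ dist (p k) (p l)) →
      IsTupleStable (HomeoFix M X) SeqSInf
        ![HomeoFix.locLIP M X, HomeoFix.LIP M X, HomeoFix.LIPc M X]
        ![bigSigmaInf, seqSInfBdd, bigSigmaInfFin]) := by
  have hlc : LocallyCompactSpace M := Manifold.locallyCompact_of_finiteDimensional I
  have hXc := hX.isCompact
  have hrows : NoncompactSpace M →
      ∃ S : CellSliders M ℕ, T.LinearSliders S ∧ ∀ p, Disjoint (S.D p) X := fun _ => by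
    obtain ⟨O, h₁, h₂, h₃, h₄, h₅⟩ := exists_discrete_open_family hXc
    exact T.exists_linearSliders hn h₁ h₂ h₃ h₄ h₅
  refine ⟨?_, fun hM => ?_, fun hM _ => ?_⟩
  -- One cell in the nonempty open complement of `X` suffices, so compact `M` is allowed.
  · obtain ⟨S, hS, hSX⟩ := T.exists_linearSliders hn (κ := Unit) (X := X) (O := fun _ => Xᶜ)
      (fun _ => hXc.isClosed.isOpen_compl) (fun _ => Set.nonempty_compl.2 hXM)
      (fun _ => disjoint_compl_left) (fun k l hkl => absurd (Subsingleton.elim k l) hkl)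
      (locallyFinite_of_finite _)
    exact isTupleStable_seqS hS hSX
  · obtain ⟨S, hS, hSX⟩ := hrows hM
    exact isTupleStable_seqSInf hS hSX
  · obtain ⟨S, -, hSX⟩ := hrows hM
    exact isTupleStable_seqSInf_of_lipschitz hSX
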